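/- For positive integers $a,k$ let ${}^k a$ denote tetration, ${}^1a=a$ and ${}^{k+1}a=a^{({}^k a)}$. The modular tetration problem (MTP) is: given positive integers $a,k,N$, compute ${}^k a \bmod N$, the least nonnegative residue. The squarefree decomposition problem (SDP) is: given a positive integer $N$, compute its squarefree part, that is, the smallest positive integer $r$ such that $r\mid N$ and $N/r$ is the square of an integer. All numbers are written in binary. Theorem. SDP is deterministically polynomial-time reducible to MTP: there are a deterministic oracle Turing machine $M$ and a polynomial $p$ such that for every oracle that answers all instances of MTP correctly (each query counting as one step) and every positive integer $N$, the machine $M$ on input $N$ halts after at most $p(\ell)$ steps, where $\ell$ is the length of the encoded input $N$, and outputs the squarefree part of $N$. -/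

import Mathlib

/-! ### Strings and encodings -/

/-- The tape alphabet: the two bits `some false`, `some true`, and the end-of-number
marker `none`. -/
abbrev TapeSym : Type := Option Bool

abbrev TapeStr : Type := List TapeSym

/-- A finite list of natural numbers as a string: every number is written in binary (least
significant bit first, no superfluous zeros) and followed by the end marker. -/
def encodeNats (l : List ℕ) : TapeStr :=
  l.flatMap fun n => n.bits.map some ++ [none]

theorem bits_injective : Function.Injective Nat.bits := fun m n h =>
  Nat.eq_of_testBit_eq fun i => by rw [Nat.testBit_eq_inth, Nat.testBit_eq_inth, h]

theorem map_some_append_none_inj {u v : List Bool} {s t : TapeStr}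
    (h : u.map some ++ none :: s = v.map some ++ none :: t) : u = v ∧ s = t := by
  induction u generalizing v with
  | nil => cases v with
    | nil => simpa using h
    | cons b v => simp at h
  | cons a u ih => cases v with
    | nil => simp at h
    | cons b v =>
      simp only [List.map_cons, List.cons_append, List.cons.injEq, Option.some.injEq] at h
      obtain ⟨h1, h2⟩ := ih h.2
      exact ⟨by rw [h.1, h1], h2⟩

theorem encodeNats_injective : Function.Injective encodeNats := by
  intro l
  induction l with
  | nil =>
    intro l' h
    cases l' with
    | nil => rfl
    | cons n l' => simp [encodeNats] at h
  | cons m l ih =>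
    intro l' h
    cases l' with
    | nil => simp [encodeNats] at h
    | cons n l' =>
      simp only [encodeNats, List.flatMap_cons, List.append_assoc, List.singleton_append] at h
      obtain ⟨h1, h2⟩ := map_some_append_none_inj h
      rw [bits_injective h1, ih h2]

/-! ### Deterministic oracle Turing machines -/

/-- A deterministic multi-stack Turing machine (Mathlib's `TM2` model) over the alphabet `TapeSym`,
with finitely many stacks, labels and internal states, equipped with an oracle: each label
carries either an ordinary `TM2` statement, or an oracle query together with the label at which
the computation continues. -/
structure OracleTM where
  /-- names of the stacks -/
  K : Type
  [decEqK : DecidableEq K]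
  [finK : Fintype K]
  /-- program labels -/
  Λ : Type
  [finΛ : Fintype Λ]
  /-- internal states -/
  σ : Type
  [finσ : Fintype σ]
  input : K
  output : K
  query : K
  answer : K
  query_ne_answer : query ≠ answer
  main : Λ
  init : σ
  prog : Λ → Turing.TM2.Stmt (fun _ : K => TapeSym) Λ σ ⊕ Λ

namespace OracleTM

variable (M : OracleTM)

instance : DecidableEq M.K := M.decEqK

abbrev Cfg : Type := Turing.TM2.Cfg (fun _ : M.K => TapeSym) M.Λ M.σ

/-- One step with oracle `O`. In a query step, the content `s` of the query stack is erased and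
the content of the answer stack is replaced by `O s`. -/
def step (O : TapeStr → TapeStr) : M.Cfg → Option M.Cfg
  | ⟨none, _, _⟩ => none
  | ⟨some ℓ, v, S⟩ =>
    match M.prog ℓ with
    | Sum.inl q => some (Turing.TM2.stepAux q v S)
    | Sum.inr ℓ' =>
      some ⟨some ℓ', v,
        Function.update (Function.update S M.query []) M.answer (O (S M.query))⟩

/-- The initial configuration: the input on the input stack (first symbol on top), all other
stacks empty. -/
def start (x : TapeStr) : M.Cfg :=
  ⟨some M.main, M.init, Function.update (fun _ => []) M.input x⟩

/-- With oracle `O`, on input `x`, the machine halts after at most `t` steps, and then the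
output stack contains exactly `y`. -/
def OutputsWithin (O : TapeStr → TapeStr) (x y : TapeStr) (t : ℕ) : Prop :=
  ∃ c : M.Cfg, c.l = none ∧ c.stk M.output = y ∧
    Nonempty (StateTransition.EvalsToInTime (M.step O) (M.start x) (some c) t)

end OracleTM

/-! ### Computational problems and polynomial-time reductions -/

/-- A computational problem with a unique answer for each instance. Strings that do not encode
an instance are not part of the problem. -/
structure FunctionProblem where
  Inst : Type
  encode : Inst → TapeStr
  encode_injective : Function.Injective encode
  answer : Inst → TapeStr

/-- A function on strings solves a problem if it is correct on every instance; its values on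
other strings are arbitrary. -/
def FunctionProblem.SolvedBy (P : FunctionProblem) (O : TapeStr → TapeStr) : Prop :=
  ∀ i : P.Inst, O (P.encode i) = P.answer i

/-- Deterministic polynomial-time (Turing) reducibility of `P` to `Q`: one deterministic machine
that, given any oracle solving `Q`, solves every instance of `P` in a number of steps bounded by
a fixed polynomial in the length of the input; an oracle call counts as one step. -/
def PolyTimeReducible (P Q : FunctionProblem) : Prop :=
  ∃ (M : OracleTM) (p : Polynomial ℕ), ∀ O : TapeStr → TapeStr, Q.SolvedBy O →
    ∀ i : P.Inst, M.OutputsWithin O (P.encode i) (P.answer i) (p.eval (P.encode i).length)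

/-! ### The two problems -/

/-- `ᵏa`, a power tower of `k` copies of `a`; `⁰a = 1`. -/
def tetration (a k : ℕ) : ℕ := hyperoperation 4 a k

/-- The squarefree part of `N ≥ 1`: the smallest `r` such that `N / r` is the square of a
natural number. -/
noncomputable def squarefreePart (N : ℕ) : ℕ := sInf {r : ℕ | r ∣ N ∧ IsSquare (N / r)}

/-- Modular tetration: given `a, k, N ≥ 1`, compute the least nonnegative residue of `ᵏa`
modulo `N`. -/
def MTP : FunctionProblem where
  Inst := ℕ+ × ℕ+ × ℕ+
  encode := fun (a, k, N) => encodeNats [a, k, N]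
  encode_injective := by
    rintro ⟨a, k, N⟩ ⟨a', k', N'⟩ h
    have h' := encodeNats_injective h
    simpa using h'
  answer := fun (a, k, N) => encodeNats [tetration a k % N]

/-- The squarefree decomposition problem: given `N ≥ 1`, compute its squarefree part. -/
noncomputable def SDP : FunctionProblem where
  Inst := ℕ+
  encode := fun N => encodeNats [(N : ℕ)]
  encode_injective := by
    intro N N' h
    have h' := encodeNats_injective h
    simpa using h'
  answer := fun N => encodeNats [squarefreePart N]

/-! The oracle reveals the radical of an odd `N` through the `p`-adic valuations of consecutive
tetration gaps `g(a,k) = ᵏ⁺¹a - ᵏa`. Since `g(a,k+1) = a^(ᵏa) * (a^g(a,k) - 1)`, lifting the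
exponent gives, for odd `p` not dividing `a` and as soon as `p - 1 ∣ g(a,k)`, the recursion
`v_p(g(a,k+1)) = w + v_p(g(a,k))` with `w = v_p(a^(p-1) - 1) ≥ 1`
(`padicValNat_tetrationGap_succ_eq`). The divisibility holds for `k ≥ n` when `p ≤ 2^n`, because
iterated totients of an even number at least halve (`dvd_tetrationGap_of_even`).

If `w = 1`, the valuation grows by exactly one per level. A base with `w ≥ 2` (a Wieferich base)
grows faster, and no single base is known to be good for every `p`. Taking the gcd over all bases
`2, …, b` replaces the valuation by a minimum; at height `2n+1` the bases with `w ≥ 2` are already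
so far ahead that one base with `w = 1` forces the minimum to increase by exactly one
(`padicValNat_gapGcd_succ`). Hence the quotient of the gcds at heights `2n+2` and `2n+1`, both cut
off by a power of `N`, is the radical of `N` (`gapGcd_dvd_and_isRadical`).

A good base of size polynomial in `n` exists by counting (`exists_padicValNat_pow_sub_one_eq_one`).
Solutions of `x^p ≡ x` modulo `p²` are determined modulo `p`, so fewer than `p` of those below `p²`
are prime to `p`; if all small primes were solutions, so would be their products, and Chebyshev's
bound yields too many products.

From the radical, the squarefree part follows by repeatedly dividing by the radical and separating
the primes of exponent one from the others (`PeelInv.step`); powers of two are removed beforehand.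
The remainders in the Euclidean algorithm are oracle calls of height one, and every other division
is exact with an odd divisor. A small structured language with step counts, compiled to oracle
machines (`steps_of_runs`), turns this into a machine with a polynomial time bound
(`runs_squarefreeProg`). -/

/-! ### Tetration gaps and their divisibility. -/

theorem tetration_zero (a : ℕ) : tetration a 0 = 1 := by
  simp [tetration, hyperoperation]

theorem tetration_succ (a k : ℕ) : tetration a (k + 1) = a ^ tetration a k := by
  simp [tetration, hyperoperation_recursion]

theorem tetration_one (a : ℕ) : tetration a 1 = a := by
  rw [tetration_succ, tetration_zero, pow_one]

theorem two_pow_le_tetration {a : ℕ} (ha : 2 ≤ a) (k : ℕ) : 2 ^ k ≤ tetration a k := by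
  induction k with
  | zero => simp [tetration_zero]
  | succ k ih =>
    rw [tetration_succ]
    have h : k + 1 ≤ tetration a k := le_trans (Nat.lt_two_pow_self) ih
    exact (Nat.pow_le_pow_left ha _).trans (Nat.pow_le_pow_right (by omega) h)

theorem tetration_lt_succ {a : ℕ} (ha : 2 ≤ a) (k : ℕ) : tetration a k < tetration a (k + 1) := by
  rw [tetration_succ]
  exact Nat.lt_pow_self (by omega)

/-- The difference of two consecutive tetrations. -/
def tetrationGap (a k : ℕ) : ℕ := tetration a (k + 1) - tetration a k

theorem tetrationGap_pos {a : ℕ} (ha : 2 ≤ a) (k : ℕ) : 0 < tetrationGap a k :=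
  Nat.sub_pos_of_lt (tetration_lt_succ ha k)

theorem tetrationGap_succ {a : ℕ} (ha : 2 ≤ a) (k : ℕ) :
    tetrationGap a (k + 1) = a ^ tetration a k * (a ^ tetrationGap a k - 1) := by
  have h := tetration_lt_succ ha k
  rw [Nat.mul_sub, ← pow_add, tetrationGap, tetrationGap, Nat.add_sub_cancel' h.le,
    tetration_succ a (k + 1), tetration_succ a k, mul_one]

/-- Check one prime power `q ^ e` of `M` at a time: if `q ∣ a`, the factor `a ^ Y` absorbs it
because `e ≤ s ≤ Y`; otherwise Euler's theorem applies to `a ^ X - 1`. -/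
theorem dvd_pow_mul_pow_sub_one {a M X Y s : ℕ} (hM : 0 < M) (hMs : M ≤ 2 ^ s) (hY : s ≤ Y)
    (hX : M.totient ∣ X) : M ∣ a ^ Y * (a ^ X - 1) := by
  rw [Nat.dvd_iff_prime_pow_dvd_dvd]
  intro q e hq hqe
  by_cases hqa : q ∣ a
  · have h1 : q ^ e ≤ 2 ^ s := (Nat.le_of_dvd hM hqe).trans hMs
    have h2 : e ≤ s := (Nat.pow_le_pow_iff_right (by norm_num : 1 < 2)).1
      ((Nat.pow_le_pow_left hq.two_le e).trans h1)
    exact ((pow_dvd_pow_of_dvd hqa e).trans (pow_dvd_pow a (h2.trans hY))).mul_right _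
  · refine Dvd.dvd.mul_left ?_ _
    have hc : Nat.Coprime a (q ^ e) :=
      Nat.Coprime.pow_right _ ((Nat.Prime.coprime_iff_not_dvd hq).2 hqa).symm
    obtain ⟨c, rfl⟩ := (Nat.totient_dvd_of_dvd hqe).trans hX
    have h := (Nat.ModEq.pow_totient hc).pow c
    rw [one_pow, ← pow_mul] at h
    rcases Nat.eq_zero_or_pos a with rfl | ha
    · have : q ^ e = 1 := by simpa using hc
      rw [this]; exact one_dvd _
    · exact (Nat.modEq_iff_dvd' (Nat.one_le_pow _ _ ha)).1 h.symm

theorem totient_two_mul_le (m : ℕ) : (2 * m).totient ≤ m := by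
  induction m using Nat.strong_induction_on with
  | _ m ih =>
    rcases Nat.even_or_odd' m with ⟨c, rfl | rfl⟩
    · rcases Nat.eq_zero_or_pos c with rfl | hc
      · simp
      · rw [Nat.totient_mul_of_prime_of_dvd Nat.prime_two (dvd_mul_right 2 c)]
        exact Nat.mul_le_mul_left 2 (ih c (by omega))
    · rw [Nat.totient_mul_of_prime_of_not_dvd Nat.prime_two (by omega)]
      simpa using Nat.totient_le _

/-- One level of the tower trades the modulus for its totient. The class "one or even" is closed
under the totient, and on even numbers the totient at most halves, so `s` levels bring a modulus up
to `2 ^ s` down to one. -/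
theorem dvd_tetrationGap_of_even {a : ℕ} (ha : 2 ≤ a) (s : ℕ) :
    ∀ M k : ℕ, 0 < M → M = 1 ∨ Even M → M ≤ 2 ^ s → s ≤ k → M ∣ tetrationGap a k := by
  induction s with
  | zero =>
    intro M k hM _ h1 _
    have : M = 1 := by simp at h1; omega
    simp [this]
  | succ s ih =>
    intro M k hM he h1 hk
    rcases he with rfl | he
    · exact one_dvd _
    obtain ⟨k, rfl⟩ : ∃ j, k = j + 1 := ⟨k - 1, by omega⟩
    rw [tetrationGap_succ ha]
    refine dvd_pow_mul_pow_sub_one hM h1 ?_ ?_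
    · have : k + 1 ≤ 2 ^ k := Nat.lt_two_pow_self
      have := two_pow_le_tetration ha k
      omega
    · obtain ⟨c, rfl⟩ := he
      rw [← two_mul] at *
      refine ih _ _ (Nat.totient_pos.2 hM) ?_ ((totient_two_mul_le c).trans ?_) (by omega)
      · rcases Nat.lt_or_ge 2 (2 * c) with h | h
        · exact Or.inr (Nat.totient_even h)
        · left
          have : c = 1 := by omega
          simp [this]
      · rw [pow_succ] at h1; omega

/-! ### Valuations of gaps at an odd prime. -/

section Valuation

variable {p a : ℕ} [hp : Fact p.Prime]

theorem prime_dvd_pow_sub_one (hpa : ¬p ∣ a) : p ∣ a ^ (p - 1) - 1 := by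
  have ha : 0 < a := Nat.pos_of_ne_zero (by rintro rfl; simp at hpa)
  have h := Nat.ModEq.pow_totient ((Nat.Prime.coprime_iff_not_dvd hp.out).2 hpa).symm
  rw [Nat.totient_prime hp.out] at h
  exact (Nat.modEq_iff_dvd' (Nat.one_le_pow _ _ ha)).1 h.symm

/-- Lifting the exponent for the base `a ^ (p - 1)`, which is one modulo `p`; dividing `D` by `p -
1` does not change its valuation. -/
theorem padicValNat_pow_sub_one_of_dvd (hodd : Odd p) (ha : 2 ≤ a) (hpa : ¬p ∣ a) {D : ℕ}
    (hD : 0 < D) (h : p - 1 ∣ D) :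
    padicValNat p (a ^ D - 1) = padicValNat p (a ^ (p - 1) - 1) + padicValNat p D := by
  obtain ⟨c, rfl⟩ := h
  have hp1 : 0 < p - 1 := Nat.pos_of_mul_pos_right hD
  have hc : c ≠ 0 := by rintro rfl; simp at hD
  have h1 : 1 < a ^ (p - 1) := Nat.one_lt_pow (by omega) (by omega)
  have := padicValNat.pow_sub_pow hodd h1 (prime_dvd_pow_sub_one hpa)
    (fun h => hpa (hp.out.dvd_of_dvd_pow h)) hc
  rw [one_pow, ← pow_mul] at this
  have h0 : padicValNat p (p - 1) = 0 :=
    padicValNat.eq_zero_of_not_dvd fun h => by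
      have := Nat.le_of_dvd hp1 h
      omega
  rw [this, padicValNat.mul hp1.ne' hc, h0, zero_add]

/-- Without `p - 1 ∣ D` an upper bound survives: replace `D` by the multiple `D * (p - 1)`, which
has the same valuation. -/
theorem padicValNat_pow_sub_one_le (hodd : Odd p) (ha : 2 ≤ a) (hpa : ¬p ∣ a) {D : ℕ}
    (hD : 0 < D) :
    padicValNat p (a ^ D - 1) ≤ padicValNat p (a ^ (p - 1) - 1) + padicValNat p D := by
  have hp1 : 0 < p - 1 := by have := hp.out.two_le; omega
  have h0 : padicValNat p (p - 1) = 0 :=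
    padicValNat.eq_zero_of_not_dvd fun h => by
      have := Nat.le_of_dvd hp1 h
      omega
  have h1 := padicValNat_pow_sub_one_of_dvd hodd ha hpa (Nat.mul_pos hD hp1) (dvd_mul_left _ D)
  rw [padicValNat.mul hD.ne' hp1.ne', h0, add_zero] at h1
  rw [← h1]
  have h2 : a ^ (D * (p - 1)) - 1 ≠ 0 := by
    have : 1 < a ^ (D * (p - 1)) := Nat.one_lt_pow (Nat.mul_pos hD hp1).ne' (by omega)
    omega
  have h3 : a ^ D - 1 ∣ a ^ (D * (p - 1)) - 1 := by
    rw [pow_mul]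
    simpa using Nat.sub_dvd_pow_sub_pow (a ^ D) 1 (p - 1)
  exact (padicValNat_dvd_iff_le h2).1 (pow_padicValNat_dvd.trans h3)

theorem padicValNat_tetrationGap_succ (ha : 2 ≤ a) (hpa : ¬p ∣ a) (k : ℕ) :
    padicValNat p (tetrationGap a (k + 1)) = padicValNat p (a ^ tetrationGap a k - 1) := by
  have h1 : 1 < a ^ tetrationGap a k := Nat.one_lt_pow (tetrationGap_pos ha k).ne' (by omega)
  rw [tetrationGap_succ ha, padicValNat.mul (pow_pos (by omega) _).ne' (by omega),
    padicValNat.pow, padicValNat.eq_zero_of_not_dvd hpa, mul_zero, zero_add]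

/-- Each level adds at most `w = v_p(a^(p-1) - 1)`, even at the low heights where `p - 1` need not
divide the gap. For `w = 1` this caps the minimum over all bases. -/
theorem padicValNat_tetrationGap_le (hodd : Odd p) (ha : 2 ≤ a) (hpa : ¬p ∣ a) (k : ℕ) :
    padicValNat p (tetrationGap a k) ≤ (k + 1) * padicValNat p (a ^ (p - 1) - 1) := by
  induction k with
  | zero =>
    have h1 : tetrationGap a 0 = a ^ 1 - 1 := by
      simp [tetrationGap, tetration_one, tetration_zero]
    have := padicValNat_pow_sub_one_le hodd ha hpa one_pos
    rw [h1]
    simpa using this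
  | succ k ih =>
    rw [padicValNat_tetrationGap_succ ha hpa]
    have := padicValNat_pow_sub_one_le hodd ha hpa (tetrationGap_pos ha k)
    linarith

theorem padicValNat_tetrationGap_succ_eq (hodd : Odd p) (ha : 2 ≤ a) (hpa : ¬p ∣ a) {n k : ℕ}
    (hpn : p ≤ 2 ^ n) (hk : n ≤ k) :
    padicValNat p (tetrationGap a (k + 1)) =
      padicValNat p (a ^ (p - 1) - 1) + padicValNat p (tetrationGap a k) := by
  have h2 := hp.out.two_le
  rw [padicValNat_tetrationGap_succ ha hpa]
  refine padicValNat_pow_sub_one_of_dvd hodd ha hpa (tetrationGap_pos ha k) ?_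
  refine dvd_tetrationGap_of_even ha n _ _ (by omega) (Or.inr ?_) (by omega) hk
  obtain ⟨c, rfl⟩ := hodd
  exact ⟨c, by omega⟩

/-- Above height `n` each level adds exactly `w`. For `w ≥ 2` this lower bound at height `2n+1`
reaches the cap that holds for `w = 1`. -/
theorem mul_le_padicValNat_tetrationGap (hodd : Odd p) (ha : 2 ≤ a) (hpa : ¬p ∣ a) {n : ℕ}
    (hpn : p ≤ 2 ^ n) (j : ℕ) :
    j * padicValNat p (a ^ (p - 1) - 1) ≤ padicValNat p (tetrationGap a (n + j)) := by
  induction j with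
  | zero => simp
  | succ j ih =>
    rw [← add_assoc, padicValNat_tetrationGap_succ_eq hodd ha hpa hpn (by omega)]
    linarith

theorem le_padicValNat_tetrationGap_of_dvd (ha : 2 ≤ a) (hpa : p ∣ a) (k : ℕ) :
    2 ^ k ≤ padicValNat p (tetrationGap a (k + 1)) := by
  refine (padicValNat_dvd_iff_le (tetrationGap_pos ha _).ne').1 ?_
  rw [tetrationGap_succ ha]
  exact Dvd.dvd.mul_right ((pow_dvd_pow_of_dvd hpa _).trans
    (pow_dvd_pow a (two_pow_le_tetration ha k))) _

end Valuation

/-! ### Small bases that are not Wieferich -/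

/-- A natural number whose `p`-th power is congruent to itself modulo `p ^ 2` is determined
modulo `p ^ 2` by its residue modulo `p`. -/
theorem modEq_sq_of_modEq {p x y : ℕ} (hx : x ^ p ≡ x [MOD p ^ 2]) (hy : y ^ p ≡ y [MOD p ^ 2])
    (h : x ≡ y [MOD p]) : x ≡ y [MOD p ^ 2] := by
  refine hx.symm.trans (Nat.ModEq.trans ?_ hy)
  have h1 : ((p : ℕ) : ℤ) ∣ (y : ℤ) - x := (Nat.modEq_iff_dvd).1 h
  -- Congruent modulo `p` implies `p`-th powers congruent modulo `p ^ 2`.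
  have h2 := dvd_sub_pow_of_dvd_sub h1 1
  rw [Nat.modEq_iff_dvd]
  push_cast
  simpa using h2

/-- Reduction modulo `p` is injective on `S`, by uniqueness of the lift, and misses zero. -/
theorem card_le_of_pow_modEq {p : ℕ} (hp : p.Prime) {S : Finset ℕ}
    (hS : ∀ x ∈ S, x < p ^ 2 ∧ x ^ p ≡ x [MOD p ^ 2] ∧ ¬p ∣ x) : S.card < p := by
  have h : S.card ≤ (Finset.Ico 1 p).card := by
    refine Finset.card_le_card_of_injOn (· % p) ?_ ?_
    · intro x hx
      have h1 := (hS x hx).2.2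
      simp only [Finset.coe_Ico, Set.mem_Ico]
      exact ⟨Nat.pos_of_ne_zero fun h0 => h1 (Nat.dvd_of_mod_eq_zero h0), Nat.mod_lt _ hp.pos⟩
    · intro x hx y hy hxy
      have h1 := modEq_sq_of_modEq (hS x hx).2.1 (hS y hy).2.1 hxy
      exact Nat.ModEq.eq_of_lt_of_lt h1 (hS x hx).1 (hS y hy).1
  have := hp.pos
  simp at h
  omega

/-- Chebyshev's lower bound through the least common multiple of `1, …, n`: every prime contributes
its largest power not exceeding `n`, hence a factor at most `n`. -/
theorem two_pow_le_pow_primeCounting (n : ℕ) :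
    2 ^ n ≤ (n + 1) * n ^ (Nat.primesLE n).card := by
  refine (Chebyshev.two_pow_le_mul_lcmUpto n).trans (Nat.mul_le_mul_left _ ?_)
  rw [Nat.lcmUpto_eq_prod_pow_log]
  refine Finset.prod_le_pow_card _ _ _ fun p hp => ?_
  exact Nat.pow_log_le_self p (by rintro rfl; simp at hp)

theorem two_pow_le_mul_card_primesLE (b : ℕ) (hb : 0 < b) :
    2 ^ b ≤ b * ((Nat.primesLE (2 ^ b)).card + 2) := by
  have h := two_pow_le_pow_primeCounting (2 ^ b)
  set c := (Nat.primesLE (2 ^ b)).card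
  have h1 : (2 ^ b + 1) ≤ 2 ^ (b * 2) := by
    have : 2 ≤ 2 ^ b := by simpa using Nat.pow_le_pow_right (n := 2) (by norm_num) hb
    rw [pow_mul]; nlinarith
  have h2 : 2 ^ 2 ^ b ≤ 2 ^ (b * (c + 2)) := by
    refine h.trans ?_
    rw [mul_add, pow_add, mul_comm (2 ^ (b * c)), pow_mul 2 b c]
    exact Nat.mul_le_mul_right _ h1
  exact (Nat.pow_le_pow_iff_right (by norm_num)).1 h2

theorem pow_modEq_self_of_sq_dvd {p a : ℕ} (hp : 0 < p) (ha : 0 < a)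
    (h : p ^ 2 ∣ a ^ (p - 1) - 1) : a ^ p ≡ a [MOD p ^ 2] := by
  have h1 : 1 ≡ a ^ (p - 1) [MOD p ^ 2] := (Nat.modEq_iff_dvd' (Nat.one_le_pow _ _ ha)).2 h
  have h2 := h1.symm.mul_right a
  rwa [← pow_succ, Nat.sub_add_cancel hp, one_mul] at h2

/-- The solution of `x ^ p ≡ x` modulo `p ^ 2` lying over `-1` is `p ^ 2 - 1`, so by uniqueness `p -
1` is not one. This supplies an explicit good base when `p` itself is small. -/
theorem not_sub_one_pow_modEq_self {p : ℕ} (hp : 3 ≤ p) (hodd : Odd p) :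
    ¬(p - 1) ^ p ≡ p - 1 [MOD p ^ 2] := by
  intro h
  have hsq : p < p ^ 2 := by nlinarith
  have hy : (p ^ 2 - 1) ^ p ≡ p ^ 2 - 1 [MOD p ^ 2] := by
    rw [Nat.modEq_iff_dvd]
    push_cast [Nat.cast_sub (show 1 ≤ p ^ 2 by omega)]
    have h1 : ((p : ℤ) ^ 2 - 1 - (-1)) ∣ ((p : ℤ) ^ 2 - 1) ^ p - (-1) ^ p :=
      sub_dvd_pow_sub_pow _ _ _
    rw [hodd.neg_one_pow] at h1
    have h2 : (p : ℤ) ^ 2 ∣ ((p : ℤ) ^ 2 - 1) ^ p + 1 := by simpa using h1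
    have h3 := (dvd_refl ((p : ℤ) ^ 2)).sub h2
    rwa [sub_add_eq_sub_sub_swap] at h3
  have hxy : p - 1 ≡ p ^ 2 - 1 [MOD p] := by
    refine (Nat.modEq_iff_dvd' (by omega)).2 ⟨p - 1, ?_⟩
    rw [Nat.mul_sub, ← sq]; omega
  have := Nat.ModEq.eq_of_lt_of_lt (modEq_sq_of_modEq h hy hxy) (by omega) (by omega)
  omega

/-- From `(N + 1 - u) ^ u / u ! ≤ N.choose u` together with `u ! ≤ u ^ u`. -/
theorem pow_mul_le_choose {N u g : ℕ} (h : u * 2 ^ g + u ≤ N + 1) : 2 ^ (g * u) ≤ N.choose u := by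
  have h1 := Nat.pow_le_choose (α := ℚ) u N
  rw [div_le_iff₀ (by positivity)] at h1
  have h2 : (N + 1 - u) ^ u ≤ N.choose u * u.factorial := by exact_mod_cast h1
  have h3 : (u * 2 ^ g) ^ u ≤ (N + 1 - u) ^ u := Nat.pow_le_pow_left (by omega) _
  rw [mul_pow, ← pow_mul] at h3
  have h4 : u.factorial * 2 ^ (g * u) ≤ u.factorial * N.choose u := by
    calc _ ≤ u ^ u * 2 ^ (g * u) := Nat.mul_le_mul_right _ (Nat.factorial_le_pow u)
      _ ≤ _ := h3.trans h2
      _ = _ := mul_comm _ _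
  exact Nat.le_of_mul_le_mul_left h4 (Nat.factorial_pos u)

/-- Counting products of `u` distinct primes below `2 ^ b`. -/
theorem choose_lt_of_forall_pow_modEq {p b u : ℕ} (hp : p.Prime) (hpb : 2 ^ b < p)
    (hu : 2 ^ (b * u) ≤ p ^ 2) (H : ∀ q ≤ 2 ^ b, q.Prime → q ^ p ≡ q [MOD p ^ 2]) :
    (Nat.primesLE (2 ^ b)).card.choose u < p := by
  rw [← Finset.card_powersetCard]
  have hinj : Set.InjOn (fun s : Finset ℕ => ∏ q ∈ s, q)
      (Finset.powersetCard u (Nat.primesLE (2 ^ b)) : Set (Finset ℕ)) := by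
    intro s hs t ht hst
    rw [Finset.mem_coe, Finset.mem_powersetCard] at hs ht
    have h1 := Nat.primeFactors_prod (s := s) fun q hq => (Nat.mem_primesLE.1 (hs.1 hq)).2
    have h2 := Nat.primeFactors_prod (s := t) fun q hq => (Nat.mem_primesLE.1 (ht.1 hq)).2
    rw [← h1, ← h2]
    exact congrArg _ hst
  rw [← Finset.card_image_of_injOn hinj]
  refine card_le_of_pow_modEq hp fun x hx => ?_
  obtain ⟨s, hs, rfl⟩ := Finset.mem_image.1 hx
  obtain ⟨hsub, hcard⟩ := Finset.mem_powersetCard.1 hs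
  have hpr : ∀ q ∈ s, q ≤ 2 ^ b ∧ q.Prime := fun q hq => Nat.mem_primesLE.1 (hsub hq)
  have hnd : ¬p ∣ ∏ q ∈ s, q := by
    rw [Prime.dvd_finsetProd_iff hp.prime]
    rintro ⟨q, hq, hpq⟩
    have := Nat.le_of_dvd (hpr q hq).2.pos hpq
    have := (hpr q hq).1
    omega
  refine ⟨?_, ?_, hnd⟩
  · have h1 : ∏ q ∈ s, q ≤ (2 ^ b) ^ s.card :=
      Finset.prod_le_pow_card _ _ _ fun q hq => (hpr q hq).1
    rw [hcard, ← pow_mul] at h1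
    -- Equality with `p ^ 2` is impossible because `p` does not divide the product.
    refine lt_of_le_of_ne (h1.trans hu) fun h => hnd ?_
    exact h ▸ dvd_pow_self p two_ne_zero
  · rw [← Finset.prod_pow]
    exact Nat.ModEq.prod fun q hq => H q (hpr q hq).1 (hpr q hq).2

/-- With primes up to `2 ^ (8 * s)`, products of `u` of them stay within `p ^ 2` while each choice
contributes at least `6 * s + 1` bits to the binomial coefficient. The ratio is above the one half
needed to beat `p`; the remaining nearly `2 * s` bits pay for the density of the primes and for the
division by `u`. -/
theorem le_choose_card_primesLE {p n s : ℕ} (hpn : p < 2 ^ n) (hns : n < 2 ^ s)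
    (hps : 2 ^ (8 * s) < p) :
    ∃ u, 2 ^ (8 * s * u) ≤ p ^ 2 ∧ p ≤ (Nat.primesLE (2 ^ (8 * s))).card.choose u := by
  have hp0 : p ≠ 0 := (Nat.zero_lt_of_lt hps).ne'
  set e := Nat.log 2 p with he
  have h1 : 2 ^ e ≤ p := Nat.pow_log_le_self 2 hp0
  have h2 : p < 2 ^ (e + 1) := Nat.lt_pow_succ_log_self (by norm_num) p
  have h3 : 8 * s ≤ e := by
    have : 2 ^ (8 * s) < 2 ^ (e + 1) := hps.trans h2
    have := (Nat.pow_lt_pow_iff_right (by norm_num : 1 < 2)).1 this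
    omega
  have h4 : e < n := by
    have : 2 ^ e < 2 ^ n := lt_of_le_of_lt h1 hpn
    exact (Nat.pow_lt_pow_iff_right (by norm_num : 1 < 2)).1 this
  have hs : 4 ≤ s := by
    by_contra h
    interval_cases s <;> omega
  -- The largest `u` for which the products are guaranteed not to exceed `2 ^ (2 * e) ≤ p ^ 2`.
  -- Since `8 * s ≤ e`, it is at least two, so rounding loses at most a third: `e < 4 * s * (u + 1)
  -- ≤ 6 * s * u`.
  set u := 2 * e / (8 * s) with hu
  have hu1 : 8 * s * u ≤ 2 * e := Nat.mul_div_le _ _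
  have hu2 : 2 * e < 8 * s * (u + 1) := Nat.lt_mul_div_succ _ (by omega)
  have hu3 : 2 ≤ u := (Nat.le_div_iff_mul_le (by omega)).2 (by omega)
  refine ⟨u, ?_, ?_⟩
  · calc 2 ^ (8 * s * u) ≤ 2 ^ (e * 2) := Nat.pow_le_pow_right (by norm_num) (by omega)
      _ = (2 ^ e) ^ 2 := pow_mul _ _ _
      _ ≤ p ^ 2 := Nat.pow_le_pow_left h1 2
  · have hg : e + 1 ≤ (6 * s + 1) * u := by
      have : s * 2 ≤ s * u := Nat.mul_le_mul_left s hu3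
      nlinarith
    refine h2.le.trans ((Nat.pow_le_pow_right (by norm_num) hg).trans (pow_mul_le_choose ?_))
    have hpi := two_pow_le_mul_card_primesLE (8 * s) (by omega)
    set c := (Nat.primesLE (2 ^ (8 * s))).card
    have hsu : 8 * s * u < 2 * 2 ^ s := by omega
    refine Nat.le_of_mul_le_mul_left (c := 8 * s) ?_ (by omega)
    have h5 : 8 * s * (u * 2 ^ (6 * s + 1) + u) ≤ 2 * 2 ^ s * (2 ^ (6 * s + 1) + 1) := by
      rw [show u * 2 ^ (6 * s + 1) + u = u * (2 ^ (6 * s + 1) + 1) by ring, ← mul_assoc]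
      exact Nat.mul_le_mul_right _ hsu.le
    have h6 : s < 2 ^ s := Nat.lt_two_pow_self
    have h7 : 16 ≤ 2 ^ s := by
      simpa using Nat.pow_le_pow_right (n := 2) (by norm_num) hs
    have e1 : 2 ^ (6 * s + 1) = 2 * (2 ^ s) ^ 6 := by rw [pow_succ, mul_comm 6, pow_mul]; ring
    have e2 : 2 ^ (8 * s) = (2 ^ s) ^ 8 := by rw [mul_comm 8, pow_mul]
    rw [e1] at h5 ⊢
    rw [e2] at hpi
    generalize 2 ^ s = z at *
    have h8 : 2 * z * (2 * z ^ 6 + 1) + 8 * z ≤ z ^ 8 := by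
      have a1 : 16 * z ^ 7 ≤ z ^ 8 := by rw [pow_succ z 7, mul_comm]; exact Nat.mul_le_mul_left _ h7
      have a2 : z ≤ z ^ 7 := Nat.le_self_pow (by norm_num) z
      nlinarith
    nlinarith

/-- For `p ≤ 2 ^ (8 * s)` the base `p - 1` works. For larger `p`, if every small prime base were
bad, the two counts of products of small primes would contradict each other. -/
theorem exists_padicValNat_pow_sub_one_eq_one {p n s : ℕ} [hp : Fact p.Prime] (hodd : Odd p)
    (hpn : p < 2 ^ n) (hns : n < 2 ^ s) :
    ∃ a, 2 ≤ a ∧ a ≤ 2 ^ (8 * s) ∧ ¬p ∣ a ∧ padicValNat p (a ^ (p - 1) - 1) = 1 := by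
  have hp3 : 3 ≤ p := by
    have := hp.out.two_le
    obtain ⟨c, rfl⟩ := hodd
    omega
  have key : ∀ a, 2 ≤ a → ¬p ∣ a → padicValNat p (a ^ (p - 1) - 1) ≠ 1 →
      a ^ p ≡ a [MOD p ^ 2] := by
    intro a ha hpa hv
    have h0 : a ^ (p - 1) - 1 ≠ 0 := by
      have : 1 < a ^ (p - 1) := Nat.one_lt_pow (by omega) (by omega)
      omega
    have h1 := one_le_padicValNat_of_dvd h0 (prime_dvd_pow_sub_one hpa)
    exact pow_modEq_self_of_sq_dvd (by omega) (by omega)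
      ((padicValNat_dvd_iff_le h0).2 (by omega))
  by_cases hpB : p ≤ 2 ^ (8 * s)
  · have hnd : ¬p ∣ p - 1 := fun h => by
      have := Nat.le_of_dvd (by omega) h
      omega
    refine ⟨p - 1, by omega, by omega, hnd, ?_⟩
    by_contra hv
    exact not_sub_one_pow_modEq_self hp3 hodd (key _ (by omega) hnd hv)
  · push Not at hpB
    by_contra! H
    obtain ⟨u, hu1, hu2⟩ := le_choose_card_primesLE hpn hns hpB
    refine absurd (choose_lt_of_forall_pow_modEq hp.out hpB hu1 fun q hq hqp => ?_) (by omega)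
    have hnd : ¬p ∣ q := fun h => by
      have := Nat.le_of_dvd hqp.pos h
      omega
    exact key q hqp.two_le hnd (H q hqp.two_le hq hnd)

/-! ### The radical from tetration gaps -/

/-- The greatest common divisor of `m` and the gaps at height `k` of all bases `2, …, b`. -/
def gapGcd (m b k : ℕ) : ℕ := m.gcd ((Finset.Icc 2 b).gcd fun a => tetrationGap a k)

theorem gapGcd_dvd (m b k : ℕ) : gapGcd m b k ∣ m := Nat.gcd_dvd_left _ _

theorem gapGcd_succ {b : ℕ} (hb : 1 ≤ b) (m k : ℕ) :
    gapGcd m (b + 1) k = (gapGcd m b k).gcd (tetrationGap (b + 1) k) := by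
  have : Finset.Icc 2 (b + 1) = insert (b + 1) (Finset.Icc 2 b) := by
    ext x; simp; omega
  rw [gapGcd, gapGcd, this, Finset.gcd_insert, Nat.gcd_assoc]
  congr 1
  exact Nat.gcd_comm _ _

theorem pow_dvd_gapGcd_iff {m b k d : ℕ} :
    d ∣ gapGcd m b k ↔ d ∣ m ∧ ∀ a, 2 ≤ a → a ≤ b → d ∣ tetrationGap a k := by
  rw [gapGcd, Nat.dvd_gcd_iff, Finset.dvd_gcd_iff]
  simp

/-- The valuation of the gcd is a minimum over bases. Every base prime to `p` gains at least one
from height `2n+1` to `2n+2`, so the point is that the minimum gains no more. The exponent `2n+3` of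
`N` keeps the cut-off from interfering, as the minimum at the lower height is at most `2n+2`. -/
theorem padicValNat_gapGcd_succ {p N n s b : ℕ} [hp : Fact p.Prime] (hodd : Odd p) (hN : 0 < N)
    (hpN : p ∣ N) (hNn : N < 2 ^ n) (hns : n < 2 ^ s) (hb : 2 ^ (8 * s) ≤ b) :
    padicValNat p (gapGcd (N ^ (2 * n + 3)) b (2 * n + 2)) =
      padicValNat p (gapGcd (N ^ (2 * n + 3)) b (2 * n + 1)) + 1 := by
  have hpn : p < 2 ^ n := (Nat.le_of_dvd hN hpN).trans_lt hNn
  obtain ⟨a₀, h2, hab, hna, hv⟩ := exists_padicValNat_pow_sub_one_eq_one hodd hpn hns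
  have hm0 : N ^ (2 * n + 3) ≠ 0 := (pow_pos hN _).ne'
  have hg0 : ∀ k, gapGcd (N ^ (2 * n + 3)) b k ≠ 0 := fun k =>
    (Nat.gcd_pos_of_pos_left _ (pow_pos hN _)).ne'
  have hle : ∀ k d, d ≤ padicValNat p (gapGcd (N ^ (2 * n + 3)) b k) ↔
      d ≤ padicValNat p (N ^ (2 * n + 3)) ∧
        ∀ a, 2 ≤ a → a ≤ b → d ≤ padicValNat p (tetrationGap a k) := by
    intro k d
    rw [← padicValNat_dvd_iff_le (hg0 k), pow_dvd_gapGcd_iff, padicValNat_dvd_iff_le hm0]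
    refine and_congr_right fun _ => forall_congr' fun a => forall_congr' fun ha =>
      forall_congr' fun _ => padicValNat_dvd_iff_le (tetrationGap_pos ha k).ne'
  have hm : 2 * n + 3 ≤ padicValNat p (N ^ (2 * n + 3)) := by
    rw [padicValNat.pow]
    exact Nat.le_mul_of_pos_right _ (one_le_padicValNat_of_dvd hN.ne' hpN)
  have hgood : padicValNat p (tetrationGap a₀ (2 * n + 1)) ≤ 2 * n + 2 := by
    have := padicValNat_tetrationGap_le hodd h2 hna (2 * n + 1)
    rw [hv] at this
    omega
  have hstep : ∀ a, 2 ≤ a → ¬p ∣ a → _ := fun a ha hpa =>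
    padicValNat_tetrationGap_succ_eq hodd ha hpa hpn.le (show n ≤ 2 * n + 1 by omega)
  -- Bases divisible by `p` have gap valuations beyond the whole relevant range. The inequality
  -- needs `n ≥ 2`, which follows from `2 ≤ p < 2 ^ n`.
  have hp2 : 2 * n + 3 ≤ 2 ^ (2 * n) := by
    have hn : 2 ≤ n := by
      by_contra! h
      have h1 : 2 ^ n ≤ 2 ^ 1 := Nat.pow_le_pow_right (by norm_num) (by omega)
      have := hp.out.two_le
      omega
    obtain ⟨j, hj⟩ : ∃ j, 2 * n = j + 1 := ⟨2 * n - 1, by omega⟩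
    have : j < 2 ^ j := Nat.lt_two_pow_self
    rw [hj, pow_succ]
    omega
  have hp3 : 2 ^ (2 * n + 1) = 2 ^ (2 * n) * 2 := pow_succ _ _
  set μ := padicValNat p (gapGcd (N ^ (2 * n + 3)) b (2 * n + 1)) with hμ
  have hμ' := (hle (2 * n + 1) μ).1 le_rfl
  have hμ2 : μ ≤ 2 * n + 2 := (hμ'.2 a₀ h2 (hab.trans hb)).trans hgood
  refine le_antisymm ?_ ?_
  -- A gain of two or more would mean that all bases already had valuation at least `μ + 1` at the
  -- lower height, contradicting the choice of `μ`.
  · by_contra! hlt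
    have h3 := (hle (2 * n + 2) (μ + 2)).1 hlt
    refine absurd ((hle (2 * n + 1) (μ + 1)).2 ⟨by omega, fun a ha hab' => ?_⟩) (by omega)
    by_cases hpa : p ∣ a
    · have := le_padicValNat_tetrationGap_of_dvd ha hpa (2 * n)
      omega
    · have h4 := h3.2 a ha hab'
      rw [hstep a ha hpa] at h4
      rcases Nat.lt_or_ge 1 (padicValNat p (a ^ (p - 1) - 1)) with h | h
      · have h5 := mul_le_padicValNat_tetrationGap hodd ha hpa hpn.le (n + 1)
        have h6 := h3.2 a₀ h2 (hab.trans hb)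
        rw [hstep a₀ h2 hna, hv] at h6
        rw [show n + (n + 1) = 2 * n + 1 by ring] at h5
        nlinarith
      · omega
  · refine (hle (2 * n + 2) (μ + 1)).2 ⟨by omega, fun a ha hab' => ?_⟩
    by_cases hpa : p ∣ a
    · have h4 : 2 ^ (2 * n + 1) ≤ padicValNat p (tetrationGap a (2 * n + 2)) :=
        le_padicValNat_tetrationGap_of_dvd ha hpa (2 * n + 1)
      omega
    · rw [hstep a ha hpa]
      have h0 : a ^ (p - 1) - 1 ≠ 0 := by
        have : 1 < a ^ (p - 1) :=
          Nat.one_lt_pow (by have := hp.out.two_le; omega) (by omega)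
        omega
      have h1 := one_le_padicValNat_of_dvd h0 (prime_dvd_pow_sub_one hpa)
      have := hμ'.2 a ha hab'
      omega

theorem odd_of_dvd {d N : ℕ} (hodd : Odd N) (h : d ∣ N) : Odd d := by
  obtain ⟨c, rfl⟩ := h
  exact (Nat.odd_mul.1 hodd).1

/-- The data of a radical: `R` is squarefree and divides `N`, and every prime factor of `N`
divides `R`. -/
structure IsRadicalOf (N R : ℕ) : Prop where
  squarefree : Squarefree R
  dvd : R ∣ N
  prime_dvd : ∀ p, p.Prime → p ∣ N → p ∣ R

/-- Prime by prime, the exponent of the gcd grows by one if `p ∣ N`; otherwise it is zero at both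
heights, because the gcd divides a power of `N`. -/
theorem gapGcd_dvd_and_isRadical {N n s b : ℕ} (hodd : Odd N) (hNn : N < 2 ^ n)
    (hns : n < 2 ^ s) (hb : 2 ^ (8 * s) ≤ b) :
    ∃ R, gapGcd (N ^ (2 * n + 3)) b (2 * n + 2) = gapGcd (N ^ (2 * n + 3)) b (2 * n + 1) * R ∧
      IsRadicalOf N R := by
  have hN := hodd.pos
  set g := gapGcd (N ^ (2 * n + 3)) b with hg
  have hg0 : ∀ k, g k ≠ 0 := fun k => (Nat.gcd_pos_of_pos_left _ (pow_pos hN _)).ne'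
  have hval : ∀ p, p.Prime → (g (2 * n + 2)).factorization p =
      (g (2 * n + 1)).factorization p + if p ∣ N then 1 else 0 := by
    intro p hp
    have := Fact.mk hp
    rw [Nat.factorization_def _ hp, Nat.factorization_def _ hp]
    split_ifs with h
    · exact padicValNat_gapGcd_succ (odd_of_dvd hodd h) hN h hNn hns hb
    · have : ∀ k, padicValNat p (g k) = 0 := fun k =>
        padicValNat.eq_zero_of_not_dvd fun h' =>
          h (hp.dvd_of_dvd_pow (h'.trans (gapGcd_dvd _ _ _)))
      rw [this, this]
  have hdvd : g (2 * n + 1) ∣ g (2 * n + 2) := by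
    rw [← Nat.factorization_prime_le_iff_dvd (hg0 _) (hg0 _)]
    intro p hp
    rw [hval p hp]
    omega
  obtain ⟨R, hR⟩ := hdvd
  have hR0 : R ≠ 0 := by
    rintro rfl
    exact hg0 _ hR
  have hvR : ∀ p, p.Prime → R.factorization p = if p ∣ N then 1 else 0 := by
    intro p hp
    have h1 := hval p hp
    rw [hR, Nat.factorization_mul (hg0 _) hR0, Finsupp.add_apply] at h1
    omega
  refine ⟨R, hR, ?_, ?_, ?_⟩
  · rw [Nat.squarefree_iff_factorization_le_one hR0]
    intro p
    by_cases hp : p.Prime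
    · rw [hvR p hp]; split_ifs <;> omega
    · simp [Nat.factorization_eq_zero_of_not_prime _ hp]
  · rw [← Nat.factorization_prime_le_iff_dvd hR0 hN.ne']
    intro p hp
    rw [hvR p hp]
    split_ifs with h
    · exact hp.factorization_pos_of_dvd hN.ne' h
    · omega
  · intro p hp h
    by_contra h'
    have := hvR p hp
    rw [if_pos h, Nat.factorization_eq_zero_of_not_dvd h'] at this
    omega

/-! ### Squarefree part from the radical -/

/-- Minimality comes from parity: for any competitor `r`, the exponents of `p` in `A` and `r` agree
modulo two, and the one in `A` is at most one, so `A ∣ r`. -/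
theorem squarefreePart_eq {A b : ℕ} (hA : Squarefree A) (hb : 0 < b) :
    squarefreePart (A * b ^ 2) = A := by
  have hA0 : A ≠ 0 := hA.ne_zero
  refine le_antisymm (Nat.sInf_le ⟨dvd_mul_right _ _, ?_⟩) (le_csInf ⟨A, dvd_mul_right _ _, ?_⟩ ?_)
  · rw [Nat.mul_div_cancel_left _ (Nat.pos_of_ne_zero hA0)]; exact ⟨b, sq b⟩
  · rw [Nat.mul_div_cancel_left _ (Nat.pos_of_ne_zero hA0)]; exact ⟨b, sq b⟩
  · rintro r ⟨hr, c, hc⟩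
    have h1 : A * b ^ 2 = r * (c * c) := by rw [← hc, Nat.mul_div_cancel' hr]
    have h0 : A * b ^ 2 ≠ 0 := mul_ne_zero hA0 (pow_pos hb 2).ne'
    have hr0 : r ≠ 0 := by rintro rfl; simp at h1; omega
    have hc0 : c ≠ 0 := by rintro rfl; simp at h1; omega
    refine Nat.le_of_dvd (Nat.pos_of_ne_zero hr0) ?_
    rw [← Nat.factorization_prime_le_iff_dvd hA0 hr0]
    intro p hp
    have h2 := congrArg (fun x => x.factorization p) h1
    simp only [Nat.factorization_mul hA0 (pow_pos hb 2).ne', Nat.factorization_pow,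
      Nat.factorization_mul hr0 (mul_ne_zero hc0 hc0), Nat.factorization_mul hc0 hc0,
      Finsupp.add_apply, Finsupp.smul_apply, smul_eq_mul] at h2
    have h3 := (Nat.squarefree_iff_factorization_le_one hA0).1 hA p
    omega

/-- The invariant of the loop that peels off squares of prime factors. -/
structure PeelInv (N₀ N R A : ℕ) : Prop where
  odd : Odd N₀
  rad : IsRadicalOf N R
  sqA : Squarefree A
  cop : A.Coprime N
  pos : 0 < N
  eq : ∃ b, 0 < b ∧ N₀ = A * N * b ^ 2

theorem PeelInv.dvd_left {N₀ N R A : ℕ} (h : PeelInv N₀ N R A) : A * N ∣ N₀ := by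
  obtain ⟨b, -, hb⟩ := h.eq
  exact ⟨_, hb⟩

theorem PeelInv.start {N R : ℕ} (hN : Odd N) (h : IsRadicalOf N R) : PeelInv N N R 1 :=
  ⟨hN, h, squarefree_one, Nat.coprime_one_left _, hN.pos, 1, one_pos, by ring⟩

/-- After dividing `N` by its radical, `R₁` collects the primes that had exponent at least two and
`R / R₁` those of exponent exactly one. The latter move to `A`; dividing by `R₁` once more removes
`R₁ ^ 2` in all, and `R₂` is the radical of what is left. -/
theorem PeelInv.step {N₀ N R A N₁ R₁ N₂ R₂ A₂ : ℕ} (h : PeelInv N₀ N R A) (hN₁ : N₁ = N / R)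
    (hR₁ : R₁ = R.gcd N₁) (hN₂ : N₂ = N₁ / R₁) (hA₂ : A₂ = A * R / R₁) (hR₂ : R₂ = R₁.gcd N₂) :
    PeelInv N₀ N₂ R₂ A₂ := by
  obtain ⟨hodd, ⟨hsq, hdvd, hpd⟩, hsA, hcop, hpos, b, hb, heq⟩ := h
  have e1 : N = R * N₁ := by rw [hN₁, Nat.mul_div_cancel' hdvd]
  have hR₁R : R₁ ∣ R := hR₁ ▸ Nat.gcd_dvd_left _ _
  have hR₁N : R₁ ∣ N₁ := hR₁ ▸ Nat.gcd_dvd_right _ _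
  obtain ⟨S, hS⟩ := hR₁R
  have e2 : N₁ = R₁ * N₂ := by rw [hN₂, Nat.mul_div_cancel' hR₁N]
  have hR₁0 : 0 < R₁ := Nat.pos_of_ne_zero (by rintro rfl; simp [hS] at hsq)
  have e3 : A₂ = A * S := by
    rw [hA₂, hS, show A * (R₁ * S) = R₁ * (A * S) by ring, Nat.mul_div_cancel_left _ hR₁0]
  have hcRS : R₁.Coprime S := Nat.coprime_of_squarefree_mul (hS ▸ hsq)
  have hsqS : Squarefree S := hsq.squarefree_of_dvd ⟨R₁, by rw [hS]; ring⟩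
  have hcAR : A.Coprime R := hcop.coprime_dvd_right hdvd
  refine ⟨hodd, ⟨?_, ?_, ?_⟩, ?_, ?_, ?_, b * R₁, Nat.mul_pos hb hR₁0, ?_⟩
  · exact hsq.squarefree_of_dvd ((hR₂ ▸ Nat.gcd_dvd_left _ _ : R₂ ∣ R₁).trans ⟨S, hS⟩)
  · exact hR₂ ▸ Nat.gcd_dvd_right _ _
  · intro p hp hpN
    have h1 : p ∣ N₁ := e2 ▸ hpN.mul_left _
    have h2 : p ∣ R := hpd p hp (e1 ▸ h1.mul_left _)
    rw [hR₂, hR₁]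
    exact Nat.dvd_gcd (Nat.dvd_gcd h2 h1) hpN
  · rw [e3, Nat.squarefree_mul (hcAR.coprime_dvd_right ⟨R₁, by rw [hS]; ring⟩)]
    exact ⟨hsA, hsqS⟩
  · rw [e3]
    refine Nat.Coprime.mul_left (hcop.coprime_dvd_right ?_) ?_
    · exact ⟨R * R₁, by rw [e1, e2]; ring⟩
    · refine Nat.Coprime.symm (Nat.coprime_of_dvd fun p hp hpN hpS => ?_)
      have h1 : p ∣ N₁ := e2 ▸ hpN.mul_left _
      have h2 : p ∣ R₁ := hR₁ ▸ Nat.dvd_gcd (hS ▸ hpS.mul_left _) h1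
      exact hp.one_lt.ne' (Nat.eq_one_of_dvd_coprimes hcRS h2 hpS)
  · refine Nat.pos_of_ne_zero ?_
    rintro rfl
    simp [e1, e2] at hpos
  · rw [heq, e1, e2, e3, hS]; ring

/-- The radical is at least two unless `N = 1`, so each round of peeling halves the bound. This
limits the number of rounds by the bit length. -/
theorem PeelInv.div_le {N₀ N R A c : ℕ} (h : PeelInv N₀ N R A) (hN : N ≤ 2 ^ (c + 1)) :
    N / R ≤ 2 ^ c := by
  rcases Nat.lt_or_ge 1 R with hR | hR
  · refine (Nat.div_le_div_left (show 2 ≤ R from hR) (by norm_num)).trans ?_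
    rw [pow_succ] at hN
    omega
  · have hN1 : N = 1 := by
      by_contra hne
      obtain ⟨p, hp, hpN⟩ := Nat.exists_prime_and_dvd hne
      have := Nat.le_of_dvd (Nat.pos_of_ne_zero h.rad.squarefree.ne_zero) (h.rad.prime_dvd p hp hpN)
      have := hp.two_le
      omega
    rw [hN1]
    exact (Nat.div_le_self _ _).trans Nat.one_le_two_pow

theorem PeelInv.squarefreePart_eq {N₀ R A j : ℕ} (h : PeelInv N₀ 1 R A) :
    squarefreePart (N₀ * 2 ^ j) = 2 ^ (j % 2) * A := by
  obtain ⟨b, hb, heq⟩ := h.eq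
  have hA : Odd A := odd_of_dvd h.odd (dvd_trans (dvd_mul_right _ _) h.dvd_left)
  have hsq : Squarefree (2 ^ (j % 2) * A) := by
    rw [Nat.squarefree_mul]
    · refine ⟨?_, h.sqA⟩
      rcases Nat.mod_two_eq_zero_or_one j with h | h <;> rw [h]
      · simp
      · simpa using Nat.prime_two.prime.squarefree
    · exact Nat.Coprime.pow_left _ (Nat.coprime_two_left.2 hA)
  have e : N₀ * 2 ^ j = 2 ^ (j % 2) * A * (b * 2 ^ (j / 2)) ^ 2 := by
    conv_lhs => rw [heq, ← Nat.mod_add_div j 2, pow_add, pow_mul]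
    rw [mul_pow, ← pow_mul, ← pow_mul, mul_comm (j / 2) 2]
    ring
  rw [e]
  exact _root_.squarefreePart_eq hsq (by positivity)

/-! ### Structured programs for oracle machines -/

/-- Names of the number registers. -/
inductive Reg
  | inp | len | modulus | count | height₀ | height₁ | height₂ | base | gcd₀ | gcd₁
  | pow₀ | pow₁ | pow₂ | diff | acc | parity | iter
  | rev | carry | quot | addend | factor | shifted | rem | one
  deriving DecidableEq

instance : Fintype Reg where
  elems := {.inp, .len, .modulus, .count, .height₀, .height₁, .height₂, .base, .gcd₀, .gcd₁,
    .pow₀, .pow₁, .pow₂, .diff, .acc, .parity, .iter,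
    .rev, .carry, .quot, .addend, .factor, .shifted, .rem, .one}
  complete r := by cases r <;> decide

/-- The stacks: one for each number register, the query stack and the answer stack. -/
inductive Stk
  | num (r : Reg) | qry | ans
  deriving DecidableEq, Fintype

/-- Structured programs. `branch k f` pops the stack `k` and continues according to the popped
symbol (or `none`, if the stack is empty), `loop k p` repeats `p` until `k` is empty. -/
inductive Prog
  | skip
  | push (k : Stk) (s : TapeSym)
  | branch (k : Stk) (f : Option TapeSym → Prog)
  | seq (p q : Prog)
  | loop (k : Stk) (p : Prog)
  | query

infixr:60 ";;" => Prog.seq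

namespace Prog

abbrev Stacks : Type := Stk → TapeStr

/-- `Runs O p S S' t`: with oracle `O`, the program `p` transforms the stacks `S` to `S'` in `t`
machine steps. -/
inductive Runs (O : TapeStr → TapeStr) : Prog → Stacks → Stacks → ℕ → Prop
  | skip (S) : Runs O skip S S 1
  | push (k s S) : Runs O (push k s) S (Function.update S k (s :: S k)) 1
  | branch {k f S S' t} : Runs O (f (S k).head?) (Function.update S k (S k).tail) S' t →
      Runs O (branch k f) S S' (t + 1)
  | seq {p q S S' S'' t t'} : Runs O p S S' t → Runs O q S' S'' t' →
      Runs O (seq p q) S S'' (t + t')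
  | loop_done {k p S} : S k = [] → Runs O (loop k p) S S 1
  | loop_step {k p S S' S'' t t'} : S k ≠ [] → Runs O p S S' t → Runs O (loop k p) S' S'' t' →
      Runs O (loop k p) S S'' (1 + t + t')
  | query (S) : Runs O query S
      (Function.update (Function.update S Stk.qry []) Stk.ans (O (S Stk.qry))) 2

/-- The program labels of a structured program. -/
def Label : Prog → Type
  | skip => Unit
  | push _ _ => Unit
  | branch _ f => Option (Σ o, Label (f o))
  | seq p q => Label p ⊕ Label q
  | loop _ p => Option (Label p)
  | query => Bool

instance instFintypeLabel : (p : Prog) → Fintype p.Label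
  | skip => inferInstanceAs (Fintype Unit)
  | push _ _ => inferInstanceAs (Fintype Unit)
  | branch _ f =>
    have : ∀ o, Fintype (f o).Label := fun o => instFintypeLabel (f o)
    inferInstanceAs (Fintype (Option (Σ o, (f o).Label)))
  | seq p q =>
    have := instFintypeLabel p
    have := instFintypeLabel q
    inferInstanceAs (Fintype (p.Label ⊕ q.Label))
  | loop _ p =>
    have := instFintypeLabel p
    inferInstanceAs (Fintype (Option p.Label))
  | query => inferInstanceAs (Fintype Bool)

/-- The first label of a structured program. -/
def entry : (p : Prog) → p.Label
  | skip => ()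
  | push _ _ => ()
  | branch _ _ => (none : Option _)
  | seq p _ => Sum.inl p.entry
  | loop _ _ => (none : Option _)
  | query => false

abbrev MStmt (Λ : Type) : Type := Turing.TM2.Stmt (fun _ : Stk => TapeSym) Λ (Option TapeSym)

/-- Continue at a label, or halt. -/
def jump {Λ : Type} : Option Λ → MStmt Λ
  | none => Turing.TM2.Stmt.halt
  | some l => Turing.TM2.Stmt.goto fun _ => l

/-- The machine code of a structured program whose labels are embedded by `ι` and which continues
at `next`. -/
def code {Λ : Type} : (p : Prog) → (p.Label → Λ) → Option Λ → p.Label → MStmt Λ ⊕ Λ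
  | skip, _, next => fun _ => Sum.inl (jump next)
  | push k s, _, next => fun _ => Sum.inl (Turing.TM2.Stmt.push k (fun _ => s) (jump next))
  | branch k f, ι, next => fun l =>
    match l with
    | none => Sum.inl (Turing.TM2.Stmt.pop k (fun _ o => o)
        (Turing.TM2.Stmt.goto fun o => ι (some ⟨o, (f o).entry⟩)))
    | some ⟨o, l⟩ => code (f o) (fun l' => ι (some ⟨o, l'⟩)) next l
  | seq p q, ι, next => fun l =>
    match l with
    | Sum.inl l => code p (fun l' => ι (Sum.inl l')) (some (ι (Sum.inr q.entry))) l
    | Sum.inr l => code q (fun l' => ι (Sum.inr l')) next l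
  | loop k p, ι, next => fun l =>
    match l with
    | none => Sum.inl (Turing.TM2.Stmt.peek k (fun _ o => o)
        (Turing.TM2.Stmt.branch Option.isSome
          (Turing.TM2.Stmt.goto fun _ => ι (some p.entry)) (jump next)))
    | some l => code p (fun l' => ι (some l')) (some (ι none)) l
  | query, ι, next => fun l =>
    match l with
    | false => Sum.inr (ι true)
    | true => Sum.inl (jump next)

theorem code_branch_none {Λ : Type} (k : Stk) (f : Option TapeSym → Prog)
    (ι : (branch k f).Label → Λ) (next : Option Λ) :
    code (branch k f) ι next (branch k f).entry = Sum.inl (Turing.TM2.Stmt.pop k (fun _ o => o)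
      (Turing.TM2.Stmt.goto fun o => ι (some ⟨o, (f o).entry⟩))) := by
  rw [code.eq_3]
  rfl

theorem code_branch_some {Λ : Type} (k : Stk) (f : Option TapeSym → Prog)
    (ι : (branch k f).Label → Λ) (next : Option Λ) (o : Option TapeSym) (l : (f o).Label) :
    code (branch k f) ι next (some ⟨o, l⟩) = code (f o) (fun l' => ι (some ⟨o, l'⟩)) next l := by
  rw [code.eq_3]

abbrev MCfg (Λ : Type) : Type := Turing.TM2.Cfg (fun _ : Stk => TapeSym) Λ (Option TapeSym)

theorem stepAux_jump {Λ : Type} (next : Option Λ) (v : Option TapeSym) (S : Stacks) :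
    Turing.TM2.stepAux (jump next) v S = ⟨next, v, S⟩ := by
  cases next <;> rfl

/-- One step of machine code. -/
def codeStep {Λ : Type} (prog : Λ → MStmt Λ ⊕ Λ) (O : TapeStr → TapeStr) :
    MCfg Λ → Option (MCfg Λ)
  | ⟨none, _, _⟩ => none
  | ⟨some l, v, S⟩ =>
    match prog l with
    | Sum.inl st => some (Turing.TM2.stepAux st v S)
    | Sum.inr l' => some ⟨some l', v,
        Function.update (Function.update S Stk.qry []) Stk.ans (O (S Stk.qry))⟩

/-! ### Correctness and exact cost of the compilation. -/

section Simulation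

variable {Λ : Type} {prog : Λ → MStmt Λ ⊕ Λ} {O : TapeStr → TapeStr}

variable (prog O) in
/-- The code moves from one configuration to another in exactly `t` steps. -/
def Steps (c c' : MCfg Λ) (t : ℕ) : Prop :=
  (flip bind (codeStep prog O))^[t] (some c) = some c'

theorem Steps.trans {c c' c'' : MCfg Λ} {t t' : ℕ}
    (h : Steps prog O c c' t) (h' : Steps prog O c' c'' t') : Steps prog O c c'' (t + t') := by
  rw [Steps] at *
  rw [add_comm, Function.iterate_add_apply, h, h']

theorem Steps.of_inl {l : Λ} {st : MStmt Λ} {v : Option TapeSym} {S : Stacks} {c : MCfg Λ}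
    (h : prog l = Sum.inl st) (hc : Turing.TM2.stepAux st v S = c) :
    Steps prog O ⟨some l, v, S⟩ c 1 := by
  change codeStep prog O ⟨some l, v, S⟩ = some c
  simp only [codeStep, h, hc]

theorem Steps.of_inr {l l' : Λ} {v : Option TapeSym} {S : Stacks} (h : prog l = Sum.inr l') :
    Steps prog O ⟨some l, v, S⟩ ⟨some l', v,
      Function.update (Function.update S Stk.qry []) Stk.ans (O (S Stk.qry))⟩ 1 := by
  change codeStep prog O ⟨some l, v, S⟩ = some _
  simp only [codeStep, h]

/-- Induction on the run, for an arbitrary embedding of labels and arbitrary continuation, so that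
it applies to subprograms. The final internal state is left existential: no program carries
information in it from one construct to the next. -/
theorem steps_of_runs {p : Prog} {S S' : Stacks} {t : ℕ} (h : Runs O p S S' t)
    (ι : p.Label → Λ) (next : Option Λ) (hc : ∀ l, prog (ι l) = p.code ι next l)
    (v : Option TapeSym) :
    ∃ v', Steps prog O ⟨some (ι p.entry), v, S⟩ ⟨next, v', S'⟩ t := by
  induction h generalizing next v with
  | skip S => exact ⟨v, Steps.of_inl (hc _) (stepAux_jump _ _ _)⟩
  | push k s S => exact ⟨v, Steps.of_inl (hc _) (stepAux_jump _ _ _)⟩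
  | @branch k f S S' t _ ih =>
    obtain ⟨v', h⟩ := ih (fun l' => ι (some ⟨_, l'⟩)) next
      (fun l => (hc _).trans (code_branch_some _ _ _ _ _ l)) (S k).head?
    exact ⟨v', add_comm 1 t ▸
      Steps.trans (Steps.of_inl ((hc _).trans (code_branch_none _ _ _ _)) rfl) h⟩
  | @seq p q S S' S'' t t' _ _ ih ih' =>
    obtain ⟨v', h⟩ := ih (fun l' => ι (Sum.inl l')) (some (ι (Sum.inr q.entry)))
      (fun l => hc (Sum.inl l)) v
    obtain ⟨v'', h'⟩ := ih' (fun l' => ι (Sum.inr l')) next (fun l => hc (Sum.inr l)) v'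
    exact ⟨v'', h.trans h'⟩
  | @loop_done k p S hS =>
    refine ⟨none, Steps.of_inl (hc none) ?_⟩
    simp only [Turing.TM2.stepAux, hS, List.head?_nil, Option.isSome_none, cond_false]
    rw [stepAux_jump]
  | @loop_step k p S S' S'' t t' hS _ _ ih ih' =>
    obtain ⟨v', h⟩ := ih (fun l' => ι (some l')) (some (ι none)) (fun l => hc (some l)) (S k).head?
    obtain ⟨v'', h'⟩ := ih' ι next hc v'
    refine ⟨v'', Steps.trans (Steps.trans (Steps.of_inl (hc none) ?_) h) h'⟩
    have : (S k).head?.isSome = true := by simpa using hS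
    simp only [Turing.TM2.stepAux, this, cond_true]
  | query S =>
    exact ⟨v, Steps.trans (t := 1) (t' := 1) (Steps.of_inr (hc false))
      (Steps.of_inl (hc true) (stepAux_jump _ _ _))⟩

end Simulation

/-- The oracle machine of a structured program. It reads its input from the answer stack and leaves
its output on the query stack. -/
def machine (p : Prog) : OracleTM where
  K := Stk
  Λ := p.Label
  σ := Option TapeSym
  input := Stk.ans
  output := Stk.qry
  query := Stk.qry
  answer := Stk.ans
  query_ne_answer := by decide
  main := p.entry
  init := none
  prog := p.code id none

theorem machine_step (p : Prog) (O : TapeStr → TapeStr) :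
    p.machine.step O = codeStep (p.code id none) O := by
  funext c
  rcases c with ⟨_ | l, v, S⟩
  · rfl
  · have hl : p.machine.prog l = p.code id none l := rfl
    rcases h : p.code id none l with st | l'
    · rw [h] at hl
      simp only [OracleTM.step, codeStep, hl, h]
      rfl
    · rw [h] at hl
      simp only [OracleTM.step, codeStep, hl, h]
      rfl

theorem outputsWithin_machine {p : Prog} {O : TapeStr → TapeStr} {x : TapeStr} {S' : Stacks}
    {t t' : ℕ} (h : Runs O p (Function.update (fun _ => []) Stk.ans x) S' t) (ht : t ≤ t') :
    p.machine.OutputsWithin O x (S' Stk.qry) t' := by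
  obtain ⟨v', hs⟩ := steps_of_runs (prog := p.code id none) h id none (fun _ => rfl) none
  refine ⟨⟨none, v', S'⟩, rfl, rfl, ⟨⟨⟨t, ?_⟩, ht⟩⟩⟩
  rw [machine_step]
  exact hs

end Prog

namespace Prog

/-! ### Programs on binary numbers -/

/-- A machine state in which all number registers hold canonical binary numbers. -/
structure St where
  reg : Reg → ℕ
  qry : TapeStr
  ans : TapeStr

namespace St

/-- The stacks of a state. -/
def content (s : St) : Stacks
  | .num r => (s.reg r).bits.map some
  | .qry => s.qry
  | .ans => s.ans

/-- Assign a value to a register. -/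
def set (s : St) (r : Reg) (v : ℕ) : St := { s with reg := fun q => if q = r then v else s.reg q }

@[simp, grind =] theorem set_reg (s : St) (r q : Reg) (v : ℕ) :
    (s.set r v).reg q = if q = r then v else s.reg q := rfl

@[simp, grind =] theorem set_qry (s : St) (r : Reg) (v : ℕ) : (s.set r v).qry = s.qry := rfl

@[simp, grind =] theorem set_ans (s : St) (r : Reg) (v : ℕ) : (s.set r v).ans = s.ans := rfl

theorem ext_reg {s s' : St} (h : ∀ q, s.reg q = s'.reg q) (hq : s.qry = s'.qry)
    (ha : s.ans = s'.ans) : s = s' := by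
  cases s; cases s'
  simp only [mk.injEq] at *
  exact ⟨funext h, hq, ha⟩

theorem set_self (s : St) (r : Reg) : s.set r (s.reg r) = s :=
  ext_reg (by grind) rfl rfl

theorem set_content (s : St) (r : Reg) (v : ℕ) :
    (s.set r v).content = Function.update s.content (Stk.num r) (v.bits.map some) := by
  funext k
  rcases k with q | _ | _
  · by_cases h : q = r
    · subst h; simp [content]
    · simp [content, h]
  · simp [content]
  · simp [content]

theorem content_num_eq_nil {s : St} {r : Reg} : s.content (.num r) = [] ↔ s.reg r = 0 := by
  rw [content, List.map_eq_nil_iff]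
  constructor
  · intro h
    rw [← Nat.size_eq_zero, ← Nat.size_eq_bits_len, h, List.length_nil]
  · intro h
    rw [h, Nat.zero_bits]

end St

theorem bits_two_mul_add {x : ℕ} {b : Bool} (h : 2 * x + b.toNat ≠ 0) :
    (2 * x + b.toNat).bits = b :: x.bits := by
  cases b
  · exact Nat.bit0_bits x (by simpa using h)
  · exact Nat.bit1_bits x

theorem size_two_mul_add {x : ℕ} {b : Bool} (h : 2 * x + b.toNat ≠ 0) :
    (2 * x + b.toNat).size = x.size + 1 := by
  rw [← Nat.size_eq_bits_len, bits_two_mul_add h, List.length_cons, Nat.size_eq_bits_len]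

theorem size_two_mul_add_le (x : ℕ) (b : Bool) : (2 * x + b.toNat).size ≤ x.size + 1 := by
  by_cases h : 2 * x + b.toNat = 0
  · simp [h]
  · exact (size_two_mul_add h).le

theorem exists_two_mul_add (x : ℕ) : ∃ (y : ℕ) (b : Bool), x = 2 * y + b.toNat := by
  rcases Nat.even_or_odd' x with ⟨c, h | h⟩
  · exact ⟨c, false, h⟩
  · exact ⟨c, true, h⟩

/-- With oracle `O`, the program `p` transforms the state `s` to `s'` in at most `t` steps. -/
def Does (O : TapeStr → TapeStr) (p : Prog) (s s' : St) (t : ℕ) : Prop :=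
  ∃ t' ≤ t, Runs O p s.content s'.content t'

variable {O : TapeStr → TapeStr}

theorem Does.mono {p : Prog} {s s' : St} {t t' : ℕ} (h : Does O p s s' t) (ht : t ≤ t') :
    Does O p s s' t' := by
  obtain ⟨u, hu, h⟩ := h
  exact ⟨u, hu.trans ht, h⟩

theorem Does.of_eq {p : Prog} {s s' s'' : St} {t : ℕ} (h : Does O p s s' t) (hs : s' = s'') :
    Does O p s s'' t := hs ▸ h

theorem Does.seq {p q : Prog} {s s' s'' : St} {t t' : ℕ} (h : Does O p s s' t)
    (h' : Does O q s' s'' t') : Does O (p ;; q) s s'' (t + t') := by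
  obtain ⟨u, hu, h⟩ := h
  obtain ⟨u', hu', h'⟩ := h'
  exact ⟨_, Nat.add_le_add hu hu', h.seq h'⟩

theorem does_skip (s : St) : Does O skip s s 1 := ⟨1, le_rfl, .skip _⟩

/-- The total-correctness rule for loops: a family of states, an invariant, and a variant bounding
the number of rounds. Each round costs `T` plus one test, and the failing test accounts for the last
`+ 1`. -/
theorem does_loop {ι : Type} (S : ι → St) (I : ι → Prop) (μ : ι → ℕ) {k : Stk} {p : Prog} {T : ℕ}
    (hbody : ∀ i, I i → (S i).content k ≠ [] → ∃ j, Does O p (S i) (S j) T ∧ I j ∧ μ j < μ i)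
    (i : ι) (hi : I i) :
    ∃ j, Does O (loop k p) (S i) (S j) (μ i * (T + 1) + 1) ∧ I j ∧ (S j).content k = [] := by
  induction h : μ i using Nat.strong_induction_on generalizing i with
  | _ n ih =>
    by_cases hk : (S i).content k = []
    · exact ⟨i, ⟨1, by omega, .loop_done hk⟩, hi, hk⟩
    · obtain ⟨j, ⟨t, ht, hj⟩, hIj, hlt⟩ := hbody i hi hk
      obtain ⟨j', ⟨t', ht', hj'⟩, hIj', hk'⟩ := ih (μ j) (h ▸ hlt) j hIj rfl
      refine ⟨j', ⟨_, ?_, .loop_step hk hj hj'⟩, hIj', hk'⟩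
      have : (μ j + 1) * (T + 1) ≤ n * (T + 1) := Nat.mul_le_mul_right _ (by omega)
      nlinarith

/-! #### Single bits -/

/-- Remove the least significant bit and continue according to its value. -/
def popBit (r : Reg) (f : Bool → Prog) : Prog :=
  branch (.num r) fun o => f (o == some (some true))

/-- An exhausted register reads as the bit zero and stays zero, so registers behave as if padded by
infinitely many leading zeros. Arithmetic on operands of different lengths relies on this. -/
theorem does_popBit {s s' : St} {r : Reg} {f : Bool → Prog} {x t : ℕ} {b : Bool}
    (hx : s.reg r = 2 * x + b.toNat) (h : Does O (f b) (s.set r x) s' t) :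
    Does O (popBit r f) s s' (t + 1) := by
  obtain ⟨u, hu, h⟩ := h
  refine ⟨u + 1, by omega, .branch ?_⟩
  have h1 : s.content (.num r) = (2 * x + b.toNat).bits.map some := by rw [← hx]; rfl
  by_cases h0 : 2 * x + b.toNat = 0
  · have hb : b = false := by
      cases b
      · rfl
      · simp at h0
    subst hb
    have hx0 : x = 0 := by simpa using h0
    subst hx0
    simp only [h1]
    simpa [St.set_content] using h
  · rw [bits_two_mul_add h0] at h1
    simp only [h1, List.map_cons, List.head?_cons, List.tail_cons]
    rw [St.set_content] at h
    cases b <;> exact h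

/-- Test whether a register is zero. -/
def ifZero (r : Reg) (p q : Prog) : Prog :=
  branch (.num r) fun o => o.elim p fun x => push (.num r) x ;; q

theorem does_ifZero_of_eq {s s' : St} {r : Reg} {p q : Prog} {t : ℕ} (h0 : s.reg r = 0)
    (h : Does O p s s' t) : Does O (ifZero r p q) s s' (t + 1) := by
  obtain ⟨u, hu, h⟩ := h
  refine ⟨u + 1, by omega, .branch ?_⟩
  have h1 : s.content (.num r) = [] := St.content_num_eq_nil.2 h0
  rw [h1, List.head?_nil, List.tail_nil, ← h1, Function.update_eq_self]
  exact h

theorem does_ifZero_of_ne {s s' : St} {r : Reg} {p q : Prog} {t : ℕ} (h0 : s.reg r ≠ 0)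
    (h : Does O q s s' t) : Does O (ifZero r p q) s s' (t + 2) := by
  obtain ⟨u, hu, h⟩ := h
  refine ⟨1 + u + 1, by omega, .branch ?_⟩
  have h1 : s.content (.num r) ≠ [] := fun h => h0 (St.content_num_eq_nil.1 h)
  obtain ⟨x, l, hl⟩ := List.exists_cons_of_ne_nil h1
  rw [hl, List.head?_cons, List.tail_cons]
  refine .seq (S' := s.content) ?_ h
  have := Runs.push (O := O) (.num r) x (Function.update s.content (.num r) l)
  rwa [Function.update_self, Function.update_idem, ← hl, Function.update_eq_self] at this

/-- Append a least significant bit. -/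
def pushBit (r : Reg) (b : Bool) : Prog :=
  if b then push (.num r) (some true) else ifZero r skip (push (.num r) (some false))

theorem does_push {s : St} {r : Reg} {b : Bool} (h : 2 * s.reg r + b.toNat ≠ 0) :
    Does O (push (.num r) (some b)) s (s.set r (2 * s.reg r + b.toNat)) 1 := by
  refine ⟨1, le_rfl, ?_⟩
  have h : (s.set r (2 * s.reg r + b.toNat)).content =
      Function.update s.content (.num r) (some b :: s.content (.num r)) := by
    rw [St.set_content, bits_two_mul_add h]
    rfl
  rw [h]
  exact .push _ _ _

/-- Pushing a zero bit onto the number zero must do nothing, to keep the representation canonical.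
-/
theorem does_pushBit (s : St) (r : Reg) (b : Bool) :
    Does O (pushBit r b) s (s.set r (2 * s.reg r + b.toNat)) 3 := by
  cases b
  · by_cases h : s.reg r = 0
    · refine ((does_ifZero_of_eq h (does_skip s)).mono (by omega)).of_eq ?_
      exact St.ext_reg (by grind) rfl rfl
    · exact does_ifZero_of_ne h (does_push (by simpa using h))
  · exact (does_push (b := true) (by simp)).mono (by omega)

/-! #### Reversal of bit strings -/

/-- The value of `z` after appending the bits of `t` below its most significant one, least
significant bit of `t` first. -/
def appendRev (t z : ℕ) : ℕ :=
  if t ≤ 1 then z else appendRev (t / 2) (2 * z + t % 2)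
termination_by t

theorem appendRev_one (z : ℕ) : appendRev 1 z = z := by
  rw [appendRev]; simp

theorem appendRev_bit {t : ℕ} (ht : 1 ≤ t) (b : Bool) (z : ℕ) :
    appendRev (2 * t + b.toNat) z = appendRev t (2 * z + b.toNat) := by
  rw [appendRev]
  have hb : b.toNat ≤ 1 := Bool.toNat_le b
  rw [if_neg (by omega), show (2 * t + b.toNat) / 2 = t by omega,
    show (2 * t + b.toNat) % 2 = b.toNat by omega]

/-- Pass the bits of `t` below its most significant one to `f`, least significant bit first. -/
def eachBit (t : Reg) (f : Bool → Prog) : Prog :=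
  loop (.num t) (popBit t fun b => ifZero t skip (f b))

/-- The top bit of `t` is a sentinel. It protects the zeros below it, which a canonical number would
otherwise lose, and it marks the end: a popped bit that leaves zero behind is the sentinel and is
not passed on. -/
theorem does_eachBit {t : Reg} {f : Bool → Prog} {S : ℕ → St} {T : ℕ}
    (hf : ∀ v z b, v ≠ 0 → Does O (f b) ((S z).set t v) ((S (2 * z + b.toNat)).set t v) T)
    {v : ℕ} (hv : 1 ≤ v) (z : ℕ) :
    Does O (eachBit t f) ((S z).set t v) ((S (appendRev v z)).set t 0)
      (v.size * (T + 5) + 1) := by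
  obtain ⟨⟨z', v'⟩, h1, h2, h3⟩ := does_loop (O := O) (fun i : ℕ × ℕ => (S i.1).set t i.2)
    (fun i => (i.2 = 0 ∧ i.1 = appendRev v z) ∨ (1 ≤ i.2 ∧ appendRev i.2 i.1 = appendRev v z))
    (fun i => i.2.size) (k := .num t) (p := popBit t fun b => ifZero t skip (f b)) (T := T + 4)
    (by
      rintro ⟨z, x⟩ hI hx
      rw [ne_eq, St.content_num_eq_nil] at hx
      replace hx : x ≠ 0 := by simpa using hx
      obtain ⟨y, b, rfl⟩ := exists_two_mul_add x
      by_cases hy : y = 0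
      · subst hy
        have hb : b = true := by
          cases b
          · simp at hx
          · rfl
        subst hb
        refine ⟨(z, 0), (does_popBit (x := 0) (b := true) (by simp)
          (does_ifZero_of_eq (by simp) (does_skip _))).mono (by omega) |>.of_eq ?_, ?_, ?_⟩
        · exact St.ext_reg (by grind) rfl rfl
        · left
          rcases hI with hI | hI
          · simp at hI
          · exact ⟨rfl, by simpa [appendRev_one] using hI.2⟩
        · simp
      · have e : (((S z).set t (2 * y + b.toNat)).set t y) = (S z).set t y :=
          St.ext_reg (by grind) rfl rfl
        have h := does_popBit (O := O) (s := (S z).set t (2 * y + b.toNat)) (r := t)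
          (f := fun b => ifZero t skip (f b)) (x := y) (b := b) (by simp)
          (does_ifZero_of_ne (by simpa using hy) (e ▸ hf y z b hy))
        refine ⟨(2 * z + b.toNat, y), h.mono (by omega), ?_, ?_⟩
        · right
          rcases hI with hI | hI
          · exact absurd hI.1 hx
          · exact ⟨by simp; omega, by rw [← hI.2, appendRev_bit (by omega)]⟩
        · simp only [size_two_mul_add hx]
          omega)
    (z, v) (Or.inr ⟨hv, rfl⟩)
  rw [St.content_num_eq_nil] at h3
  replace h3 : v' = 0 := by simpa using h3
  subst h3
  rcases h2 with ⟨-, h2⟩ | h2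
  · simp only at h2
    subst h2
    exact h1
  · simp at h2

/-- Move the bits of `x` to `rev`, in reverse order. -/
def reverse (x : Reg) : Prog :=
  push (.num .rev) (some true) ;; loop (.num x) (popBit x fun b => pushBit .rev b)

theorem does_reverse {s : St} {x : Reg} (hx : x ≠ .rev) (hrev : s.reg .rev = 0) :
    ∃ v, 1 ≤ v ∧ appendRev v 0 = s.reg x ∧ v.size = (s.reg x).size + 1 ∧
      Does O (reverse x) s ((s.set x 0).set .rev v) (5 * (s.reg x).size + 2) := by
  obtain ⟨⟨y, v⟩, h1, ⟨h2, h3, h4⟩, h5⟩ := does_loop (O := O)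
    (fun i : ℕ × ℕ => (s.set x i.1).set .rev i.2)
    (fun i => 1 ≤ i.2 ∧ appendRev i.2 i.1 = s.reg x ∧ i.2.size + i.1.size = (s.reg x).size + 1)
    (fun i => i.1.size) (k := .num x) (p := popBit x fun b => pushBit .rev b) (T := 4)
    (by
      rintro ⟨y, v⟩ ⟨h1, h2, h3⟩ hy
      rw [ne_eq, St.content_num_eq_nil] at hy
      replace hy : y ≠ 0 := by simpa [hx] using hy
      obtain ⟨y, b, rfl⟩ := exists_two_mul_add y
      have hv : 2 * v + b.toNat ≠ 0 := by simp at h1; omega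
      simp only [size_two_mul_add hy] at h3
      refine ⟨(y, 2 * v + b.toNat), (does_popBit (x := y) (b := b) (by simp [hx])
        (does_pushBit _ _ _)).of_eq ?_, ⟨?_, ?_, ?_⟩, ?_⟩
      · exact St.ext_reg (by grind) rfl rfl
      · simp only at h1 ⊢; omega
      · rw [appendRev_bit h1]; exact h2
      · simp only [size_two_mul_add hv]; omega
      · simp [size_two_mul_add hy])
    (s.reg x, 1) ⟨le_rfl, appendRev_one _, by simp [add_comm]⟩
  rw [St.content_num_eq_nil] at h5
  replace h5 : y = 0 := by simpa [hx] using h5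
  subst h5
  refine ⟨v, h2, h3, by simpa using h4, ?_⟩
  refine (Does.seq ((does_push (b := true) (by simp)).of_eq ?_) h1).mono ?_
  · exact St.ext_reg (by grind) rfl rfl
  · simp only; omega

/-- Set `x` to zero. -/
def clear (x : Reg) : Prog := loop (.num x) (popBit x fun _ => skip)

theorem does_clear {s : St} {x : Reg} {L : ℕ} (hL : s.reg x < 2 ^ L) :
    Does O (clear x) s (s.set x 0) (3 * L + 1) := by
  obtain ⟨y, h1, -, h5⟩ := does_loop (O := O) (fun i : ℕ => s.set x i) (fun _ => True)
    (fun i => i.size) (k := .num x) (p := popBit x fun _ => skip) (T := 2)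
    (by
      rintro y - hy
      rw [ne_eq, St.content_num_eq_nil] at hy
      replace hy : y ≠ 0 := by simpa using hy
      obtain ⟨y, b, rfl⟩ := exists_two_mul_add y
      refine ⟨y, (does_popBit (x := y) (b := b) (by simp) (does_skip _)).of_eq ?_, trivial, ?_⟩
      · exact St.ext_reg (by grind) rfl rfl
      · simp [size_two_mul_add hy])
    (s.reg x) trivial
  rw [St.content_num_eq_nil] at h5
  replace h5 : y = 0 := by simpa using h5
  subst h5
  rw [St.set_self] at h1
  have := Nat.size_le.2 hL
  exact h1.mono (by omega)

/-- Copy `x` to `y`, which must be zero. -/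
def copy (x y : Reg) : Prog := reverse x ;; eachBit .rev fun b => pushBit x b ;; pushBit y b

theorem does_copy {s : St} {x y : Reg} {L : ℕ} (hxy : x ≠ y) (hx : x ≠ .rev) (hy : y ≠ .rev)
    (hrev : s.reg .rev = 0) (hy0 : s.reg y = 0) (hL : s.reg x < 2 ^ L) :
    Does O (copy x y) s (s.set y (s.reg x)) (16 * L + 14) := by
  obtain ⟨v, h1, h2, h3, h4⟩ := does_reverse (O := O) hx hrev
  have h5 := does_eachBit (O := O) (t := .rev) (f := fun b => pushBit x b ;; pushBit y b)
    (S := fun z => (s.set x z).set y z) (T := 6)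
    (fun v z b _ => (Does.seq (does_pushBit _ _ _) (does_pushBit _ _ _)).of_eq
      (St.ext_reg (by grind) rfl rfl)) h1 0
  rw [h2] at h5
  have e : (((s.set x 0).set y 0).set .rev v) = (s.set x 0).set .rev v :=
    St.ext_reg (by grind) rfl rfl
  rw [e] at h5
  have := Nat.size_le.2 hL
  refine ((Does.seq h4 h5).mono (by omega)).of_eq (St.ext_reg (by grind) rfl rfl)

/-! #### Addition and subtraction -/

/-- One step of bitwise arithmetic with carry. -/
def ripple (g : Bool → Bool → Bool → Bool) (x w : Reg) : Prog :=
  popBit x fun a => popBit w fun b => popBit .carry fun d =>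
    pushBit .rev (a ^^ b ^^ d) ;; pushBit .carry (g a b d)

theorem does_ripple {g : Bool → Bool → Bool → Bool} {x w : Reg} (hxw : x ≠ w) (hx : x ≠ .rev)
    (hw : w ≠ .rev) (hx' : x ≠ .carry) (hw' : w ≠ .carry) (s : St) (p q v : ℕ) (a b d : Bool) :
    Does O (ripple g x w)
      ((((s.set x (2 * p + a.toNat)).set w (2 * q + b.toNat)).set .carry d.toNat).set .rev v)
      ((((s.set x p).set w q).set .carry (g a b d).toNat).set .rev
        (2 * v + (a ^^ b ^^ d).toNat)) 9 := by
  refine Does.of_eq (does_popBit (x := p) (b := a) (by grind) (does_popBit (x := q) (b := b)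
    (by grind) (does_popBit (x := 0) (b := d) (by grind)
    (Does.seq (does_pushBit _ _ _) (does_pushBit _ _ _))))) ?_
  refine St.ext_reg (fun r => ?_) rfl rfl
  simp only [St.set_reg]
  grind

/-- The carry of a binary addition. -/
def majority (a b d : Bool) : Bool := (a && b) || (a && d) || (b && d)

/-- `x := x + w`, `w := 0`. -/
def addTo (x w : Reg) : Prog :=
  push (.num .rev) (some true) ;; loop (.num x) (ripple majority x w) ;;
    loop (.num w) (ripple majority x w) ;; loop (.num .carry) (ripple majority x w) ;;
    eachBit .rev fun b => pushBit x b

theorem bits_add (p q : ℕ) (a b d : Bool) :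
    2 * (p + q + (majority a b d).toNat) + (a ^^ b ^^ d).toNat =
      2 * p + a.toNat + (2 * q + b.toNat) + d.toNat := by
  cases a <;> cases b <;> cases d <;> simp [majority] <;> omega

/-- A loop can test only one stack, so three loops run the same ripple step until `x`, then `w`,
then the carry is exhausted. The invariant throughout is that the bits already in `rev`, placed
below `x + w + carry`, give the original sum. -/
theorem does_addTo {s : St} {x w : Reg} {L : ℕ} (hxw : x ≠ w) (hx : x ≠ .rev)
    (hw : w ≠ .rev) (hx' : x ≠ .carry) (hw' : w ≠ .carry) (hrev : s.reg .rev = 0)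
    (hcarry : s.reg .carry = 0) (hxL : s.reg x < 2 ^ L) (hwL : s.reg w < 2 ^ L) :
    Does O (addTo x w) s ((s.set x (s.reg x + s.reg w)).set w 0) (40 * L + 40) := by
  have hxs := Nat.size_le.2 hxL
  have hws := Nat.size_le.2 hwL
  set S : ℕ × ℕ × Bool × ℕ → St := fun i =>
    (((s.set x i.1).set w i.2.1).set .carry i.2.2.1.toNat).set .rev i.2.2.2 with hS
  have hSx : ∀ i, (S i).reg x = i.1 := fun i => by simp [hS, hx, hx', hxw]
  have hSw : ∀ i, (S i).reg w = i.2.1 := fun i => by simp [hS, hw, hw']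
  have hSc : ∀ i, (S i).reg .carry = i.2.2.1.toNat := fun i => by simp [hS]
  have body : ∀ p q a b d v, Does O (ripple majority x w)
      (S (2 * p + a.toNat, 2 * q + b.toNat, d, v))
      (S (p, q, majority a b d, 2 * v + (a ^^ b ^^ d).toNat)) 9 := fun p q a b d v =>
    does_ripple hxw hx hw hx' hw' s p q v a b d
  have hval : ∀ p q a b d v, 1 ≤ v →
      appendRev (2 * v + (a ^^ b ^^ d).toNat) (p + q + (majority a b d).toNat) =
        appendRev v (2 * p + a.toNat + (2 * q + b.toNat) + d.toNat) := by
    intro p q a b d v hv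
    rw [appendRev_bit hv, bits_add]
  obtain ⟨⟨x1, w1, d1, v1⟩, h1, ⟨hv1, hr1, hs1, hw1⟩, hz1⟩ := does_loop (O := O) S
    (fun i => 1 ≤ i.2.2.2 ∧ appendRev i.2.2.2 (i.1 + i.2.1 + i.2.2.1.toNat) = s.reg x + s.reg w ∧
      i.2.2.2.size + i.1.size + i.2.1.size ≤ 2 * L + 1 ∧ i.2.1.size ≤ L)
    (fun i => i.1.size) (k := .num x) (p := ripple majority x w) (T := 9)
    (by
      rintro ⟨p, q, d, v⟩ ⟨h1, h2, h3, h4⟩ hy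
      rw [ne_eq, St.content_num_eq_nil, hSx] at hy
      simp only at h1 h2 h3 h4 hy
      obtain ⟨p, a, rfl⟩ := exists_two_mul_add p
      obtain ⟨q, b, rfl⟩ := exists_two_mul_add q
      rw [size_two_mul_add hy] at h3
      have := size_two_mul_add_le v (a ^^ b ^^ d)
      have hq : q.size ≤ (2 * q + b.toNat).size := Nat.size_le_size (by omega)
      refine ⟨_, body p q a b d v, ⟨by simp only; omega, (hval _ _ _ _ _ _ h1).trans h2, ?_, ?_⟩, ?_⟩
      · simp only; omega
      · simp only; omega
      · simp [size_two_mul_add hy])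
    (s.reg x, s.reg w, false, 1) ⟨le_rfl, by simp [appendRev_one], by simp; omega, hws⟩
  rw [St.content_num_eq_nil, hSx] at hz1
  simp only at hz1 hv1 hr1 hs1 hw1
  subst hz1
  obtain ⟨⟨x2, w2, d2, v2⟩, h2, ⟨hx2, hv2, hr2, hs2⟩, hz2⟩ := does_loop (O := O) S
    (fun i => i.1 = 0 ∧ 1 ≤ i.2.2.2 ∧
      appendRev i.2.2.2 (i.1 + i.2.1 + i.2.2.1.toNat) = s.reg x + s.reg w ∧
      i.2.2.2.size + i.2.1.size ≤ 2 * L + 1)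
    (fun i => i.2.1.size) (k := .num w) (p := ripple majority x w) (T := 9)
    (by
      rintro ⟨p, q, d, v⟩ ⟨h0, h1, h2, h3⟩ hy
      rw [ne_eq, St.content_num_eq_nil, hSw] at hy
      simp only at h0 h1 h2 h3 hy
      subst h0
      obtain ⟨q, b, rfl⟩ := exists_two_mul_add q
      rw [size_two_mul_add hy] at h3
      have := size_two_mul_add_le v (false ^^ b ^^ d)
      refine ⟨_, body 0 q false b d v, ⟨rfl, by simp only; omega,
        (hval _ _ _ _ _ _ h1).trans h2, ?_⟩, ?_⟩
      · simp only; omega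
      · simp [size_two_mul_add hy])
    (0, w1, d1, v1) ⟨rfl, hv1, hr1, by simpa using hs1⟩
  rw [St.content_num_eq_nil, hSw] at hz2
  simp only at hz2 hx2 hv2 hr2 hs2
  subst hz2 hx2
  obtain ⟨⟨x3, w3, d3, v3⟩, h3, ⟨hx3, hw3, hv3, hr3, hs3⟩, hz3⟩ := does_loop (O := O) S
    (fun i => i.1 = 0 ∧ i.2.1 = 0 ∧ 1 ≤ i.2.2.2 ∧
      appendRev i.2.2.2 (i.1 + i.2.1 + i.2.2.1.toNat) = s.reg x + s.reg w ∧
      i.2.2.2.size + i.2.2.1.toNat ≤ 2 * L + 2)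
    (fun i => i.2.2.1.toNat) (k := .num .carry) (p := ripple majority x w) (T := 9)
    (by
      rintro ⟨p, q, d, v⟩ ⟨h0, h0', h1, h2, h3⟩ hy
      rw [ne_eq, St.content_num_eq_nil, hSc] at hy
      simp only at h0 h0' h1 h2 h3 hy
      subst h0 h0'
      have hd : d = true := by cases d <;> simp_all
      subst hd
      have := size_two_mul_add_le v (false ^^ false ^^ true)
      refine ⟨_, body 0 0 false false true v, ⟨rfl, rfl, by simp only; omega,
        (hval _ _ _ _ _ _ h1).trans h2, ?_⟩, ?_⟩
      · simp only [majority, Bool.toNat_true] at h3 ⊢; simp; simp at this; omega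
      · simp [majority])
    (0, 0, d2, v2) ⟨rfl, rfl, hv2, hr2, by
      have := Bool.toNat_le d2
      simp at hs2 ⊢; omega⟩
  rw [St.content_num_eq_nil, hSc] at hz3
  simp only at hz3 hx3 hw3 hv3 hr3 hs3
  subst hx3 hw3
  have hd : d3 = false := by cases d3 <;> simp_all
  subst hd
  have h4 := does_eachBit (O := O) (t := .rev) (f := fun b => pushBit x b)
    (S := fun z => ((s.set x z).set w 0).set .carry 0) (T := 3)
    (fun v z b _ => (does_pushBit _ _ _).of_eq (St.ext_reg (by grind) rfl rfl)) hv3 0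
  have h0 : Does O (push (.num .rev) (some true)) s (S (s.reg x, s.reg w, false, 1)) 1 :=
    (does_push (b := true) (by simp)).of_eq (St.ext_reg (by grind) rfl rfl)
  simp only [add_zero, Bool.toNat_false] at hr3
  rw [hr3] at h4
  have e1 := Bool.toNat_le d2
  refine ((h0.seq (h1.seq (h2.seq (h3.seq h4)))).mono ?_).of_eq (St.ext_reg (by grind) rfl rfl)
  have : v3.size * (3 + 5) ≤ (2 * L + 2) * 8 := Nat.mul_le_mul_right _ (by omega)
  simp only
  omega

/-- The borrow of a binary subtraction. -/
def borrow (a b d : Bool) : Bool := (!a && b) || (!a && d) || (b && d)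

/-- `x := x - w`, `w := 0`. -/
def subFrom (x w : Reg) : Prog :=
  push (.num .rev) (some true) ;; loop (.num x) (ripple borrow x w) ;;
    eachBit .rev fun b => pushBit x b

theorem bits_sub (p q : ℕ) (a b d : Bool)
    (h : 2 * q + b.toNat + d.toNat ≤ 2 * p + a.toNat) :
    q + (borrow a b d).toNat ≤ p ∧
    2 * (p - q - (borrow a b d).toNat) + (a ^^ b ^^ d).toNat =
      2 * p + a.toNat - (2 * q + b.toNat) - d.toNat := by
  cases a <;> cases b <;> cases d <;> simp [borrow] at h ⊢ <;> omega

/-- One loop suffices: the invariant `w + borrow ≤ x` forces `w` and the borrow to vanish together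
with `x`. Leading zeros of the difference disappear when the bits are pushed back. -/
theorem does_subFrom {s : St} {x w : Reg} {L : ℕ} (hxw : x ≠ w) (hx : x ≠ .rev)
    (hw : w ≠ .rev) (hx' : x ≠ .carry) (hw' : w ≠ .carry) (hrev : s.reg .rev = 0)
    (hcarry : s.reg .carry = 0) (hxL : s.reg x < 2 ^ L) (hwx : s.reg w ≤ s.reg x) :
    Does O (subFrom x w) s ((s.set x (s.reg x - s.reg w)).set w 0) (40 * L + 40) := by
  have hxs := Nat.size_le.2 hxL
  set S : ℕ × ℕ × Bool × ℕ → St := fun i =>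
    (((s.set x i.1).set w i.2.1).set .carry i.2.2.1.toNat).set .rev i.2.2.2 with hS
  have hSx : ∀ i, (S i).reg x = i.1 := fun i => by simp [hS, hx, hx', hxw]
  have body : ∀ p q a b d v, Does O (ripple borrow x w)
      (S (2 * p + a.toNat, 2 * q + b.toNat, d, v))
      (S (p, q, borrow a b d, 2 * v + (a ^^ b ^^ d).toNat)) 9 := fun p q a b d v =>
    does_ripple hxw hx hw hx' hw' s p q v a b d
  obtain ⟨⟨x1, w1, d1, v1⟩, h1, ⟨hv1, hr1, hs1, hw1⟩, hz1⟩ := does_loop (O := O) S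
    (fun i => 1 ≤ i.2.2.2 ∧ appendRev i.2.2.2 (i.1 - i.2.1 - i.2.2.1.toNat) = s.reg x - s.reg w ∧
      i.2.2.2.size + i.1.size ≤ L + 1 ∧ i.2.1 + i.2.2.1.toNat ≤ i.1)
    (fun i => i.1.size) (k := .num x) (p := ripple borrow x w) (T := 9)
    (by
      rintro ⟨p, q, d, v⟩ ⟨h1, h2, h3, h4⟩ hy
      rw [ne_eq, St.content_num_eq_nil, hSx] at hy
      simp only at h1 h2 h3 h4 hy
      obtain ⟨p, a, rfl⟩ := exists_two_mul_add p
      obtain ⟨q, b, rfl⟩ := exists_two_mul_add q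
      rw [size_two_mul_add hy] at h3
      have := size_two_mul_add_le v (a ^^ b ^^ d)
      obtain ⟨h5, h6⟩ := bits_sub p q a b d h4
      refine ⟨_, body p q a b d v, ⟨by simp only; omega, ?_, by simp only; omega, h5⟩, ?_⟩
      · rw [← h2, ← h6]
        exact appendRev_bit h1 _ _
      · simp [size_two_mul_add hy])
    (s.reg x, s.reg w, false, 1) ⟨le_rfl, by simp [appendRev_one], by simp; omega, by simpa⟩
  rw [St.content_num_eq_nil, hSx] at hz1
  simp only at hz1 hv1 hr1 hs1 hw1
  subst hz1
  have hw0 : w1 = 0 := by omega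
  have hd : d1 = false := by cases d1 <;> simp_all
  subst hw0 hd
  have h4 := does_eachBit (O := O) (t := .rev) (f := fun b => pushBit x b)
    (S := fun z => ((s.set x z).set w 0).set .carry 0) (T := 3)
    (fun v z b _ => (does_pushBit _ _ _).of_eq (St.ext_reg (by grind) rfl rfl)) hv1 0
  have h0 : Does O (push (.num .rev) (some true)) s (S (s.reg x, s.reg w, false, 1)) 1 :=
    (does_push (b := true) (by simp)).of_eq (St.ext_reg (by grind) rfl rfl)
  simp only [Nat.sub_zero, Bool.toNat_false] at hr1
  rw [hr1] at h4
  refine ((h0.seq (h1.seq h4)).mono ?_).of_eq (St.ext_reg (by grind) rfl rfl)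
  have : v1.size * (3 + 5) ≤ (L + 1) * 8 := Nat.mul_le_mul_right _ (by omega)
  simp only
  omega

/-- `x := x + 1`. -/
def incr (x : Reg) : Prog := push (.num .addend) (some true) ;; addTo x .addend

/-- `x := x - 1`. -/
def decr (x : Reg) : Prog := push (.num .addend) (some true) ;; subFrom x .addend

theorem does_incr {s : St} {x : Reg} {L : ℕ} (hx : x ≠ .rev) (hx' : x ≠ .carry)
    (hx'' : x ≠ .addend) (hrev : s.reg .rev = 0) (hcarry : s.reg .carry = 0)
    (haddend : s.reg .addend = 0) (hL : s.reg x < 2 ^ L) (hL1 : 1 ≤ L) :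
    Does O (incr x) s (s.set x (s.reg x + 1)) (40 * L + 41) := by
  have h1 : 1 < 2 ^ L := Nat.one_lt_two_pow (by omega)
  refine (((does_push (b := true) (by simp)).seq (does_addTo (L := L) hx'' hx (by decide) hx'
    (by decide) (by grind) (by grind) (by grind) (by grind))).mono (by omega)).of_eq
    (St.ext_reg (by grind) rfl rfl)

theorem does_decr {s : St} {x : Reg} {L : ℕ} (hx : x ≠ .rev) (hx' : x ≠ .carry)
    (hx'' : x ≠ .addend) (hrev : s.reg .rev = 0) (hcarry : s.reg .carry = 0)
    (haddend : s.reg .addend = 0) (hL : s.reg x < 2 ^ L) (hpos : 1 ≤ s.reg x) :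
    Does O (decr x) s (s.set x (s.reg x - 1)) (40 * L + 41) := by
  refine (((does_push (b := true) (by simp)).seq (does_subFrom (L := L) hx'' hx (by decide) hx'
    (by decide) (by grind) (by grind) (by grind) (by grind))).mono (by omega)).of_eq
    (St.ext_reg (by grind) rfl rfl)

end Prog

/-- The registers used internally by arithmetic operations. -/
def Reg.isScratch : Reg → Bool
  | .rev | .carry | .quot | .addend | .factor | .shifted | .rem | .one => true
  | _ => false

namespace Prog

variable {O : TapeStr → TapeStr}

/-- All scratch registers are zero, and the query and answer stacks are empty. -/
structure St.Clean (s : St) : Prop where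
  rev : s.reg .rev = 0
  carry : s.reg .carry = 0
  quot : s.reg .quot = 0
  addend : s.reg .addend = 0
  factor : s.reg .factor = 0
  shifted : s.reg .shifted = 0
  rem : s.reg .rem = 0
  one : s.reg .one = 0
  qry : s.qry = []
  ans : s.ans = []

theorem ne_of_isScratch {x y : Reg} (hx : x.isScratch = false) (hy : y.isScratch = true) :
    x ≠ y := by
  rintro rfl
  simp [hx] at hy

/-! #### Multiplication and exact division -/

/-- `x := x * y`. -/
def mulBy (x y : Reg) : Prog :=
  copy x .factor ;; clear x ;; copy y .shifted ;;
    loop (.num .factor) (popBit .factor fun b =>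
      (if b then copy .shifted .addend ;; addTo x .addend else skip) ;; pushBit .shifted false) ;;
    clear .shifted

theorem does_mulBy {s : St} {x y : Reg} {L : ℕ} (hx : x.isScratch = false)
    (hy : y.isScratch = false) (hxy : x ≠ y) (hs : s.Clean) (hxL : s.reg x < 2 ^ L)
    (hyL : s.reg y < 2 ^ L) (hL : s.reg x * s.reg y < 2 ^ L) :
    Does O (mulBy x y) s (s.set x (s.reg x * s.reg y)) (100 * (L + 2) ^ 2) := by
  have n1 := ne_of_isScratch hx (y := .rev) rfl
  have n2 := ne_of_isScratch hx (y := .carry) rfl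
  have n3 := ne_of_isScratch hx (y := .addend) rfl
  have n4 := ne_of_isScratch hx (y := .factor) rfl
  have n5 := ne_of_isScratch hx (y := .shifted) rfl
  have m1 := ne_of_isScratch hy (y := .rev) rfl
  have m2 := ne_of_isScratch hy (y := .factor) rfl
  have m3 := ne_of_isScratch hy (y := .shifted) rfl
  have c1 := hs.rev
  have c2 := hs.carry
  have c3 := hs.addend
  have c4 := hs.factor
  have c5 := hs.shifted
  set S : ℕ × ℕ × ℕ → St := fun i =>
    ((s.set x i.1).set .factor i.2.1).set .shifted i.2.2 with hS
  obtain ⟨⟨z, f, h⟩, h1, ⟨hv, hb⟩, hz⟩ := does_loop (O := O) S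
    (fun i => i.1 + i.2.1 * i.2.2 = s.reg x * s.reg y ∧ i.2.2 < 2 ^ (L + 1))
    (fun i => i.2.1.size) (k := .num .factor) (p := popBit .factor fun b =>
      (if b then copy .shifted .addend ;; addTo x .addend else skip) ;; pushBit .shifted false)
    (T := 60 * L + 150)
    (by
      rintro ⟨z, f, h⟩ ⟨h1, h2⟩ hy
      rw [ne_eq, St.content_num_eq_nil] at hy
      replace hy : f ≠ 0 := by simpa [hS] using hy
      simp only at h1 h2
      obtain ⟨f, b, rfl⟩ := exists_two_mul_add f
      -- As the remaining factor is nonzero, `h` is bounded by the product. Only the final, unused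
      -- doubling can exceed `2 ^ L`, hence the exponent `L + 1` in the invariant.
      have hh : h < 2 ^ L := by
        have : 1 * h ≤ (2 * f + b.toNat) * h := Nat.mul_le_mul_right _ (by omega)
        omega
      have hz : z < 2 ^ L := by omega
      refine ⟨(z + b.toNat * h, f, 2 * h), (does_popBit (x := f) (b := b) (by simp [hS])
        (Does.seq (s' := ((s.set x (z + b.toNat * h)).set .factor f).set .shifted h)
          (t := 56 * L + 54) ?_
          (does_pushBit _ _ _))).mono (by omega) |>.of_eq ?_, ⟨?_, ?_⟩, ?_⟩
      · cases b
        · refine ((does_skip _).mono (by omega)).of_eq (St.ext_reg (fun r => ?_) rfl rfl)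
          simp only [hS, St.set_reg]; grind
        · refine ((Does.seq (does_copy (L := L) (by decide) (by decide) (by decide) ?_ ?_ ?_)
            (does_addTo (L := L) n3 n1 (by decide) n2 (by decide) ?_ ?_ ?_ ?_)).mono
              (by omega)).of_eq (St.ext_reg (fun r => ?_) rfl rfl)
          all_goals simp only [hS, St.set_reg]; grind
      · refine St.ext_reg (fun r => ?_) rfl rfl
        simp only [hS, St.set_reg]; grind
      · simp only; rw [← h1]; ring
      · simp only; rw [pow_succ]; omega
      · simp [size_two_mul_add hy])
    (0, s.reg x, s.reg y) ⟨by simp, by simp only; rw [pow_succ]; omega⟩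
  rw [St.content_num_eq_nil] at hz
  replace hz : f = 0 := by simpa [hS] using hz
  subst hz
  simp only [zero_mul, add_zero] at hv hb
  have e1 := does_copy (O := O) (s := s) (x := x) (y := .factor) (L := L) n4 n1 (by decide) c1 c4 hxL
  have e2 := does_clear (O := O) (s := s.set .factor (s.reg x)) (x := x) (L := L)
    (by simpa [n4] using hxL)
  have e3 := does_copy (O := O) (s := (s.set .factor (s.reg x)).set x 0) (x := y) (y := .shifted)
    (L := L) m3 m1 (by decide) (by grind) (by grind) (by grind)
  have e4 := does_clear (O := O) (s := S (z, 0, h)) (x := .shifted) (L := L + 1)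
    (by simpa [hS] using hb)
  have e5 : ((s.set .factor (s.reg x)).set x 0).set .shifted
      (((s.set .factor (s.reg x)).set x 0).reg y) = S (0, s.reg x, s.reg y) := by
    refine St.ext_reg (fun r => ?_) rfl rfl
    simp only [hS, St.set_reg]; grind
  rw [e5] at e3
  have hxs := Nat.size_le.2 hxL
  refine ((e1.seq (e2.seq (e3.seq (h1.seq e4)))).mono ?_).of_eq (St.ext_reg (fun r => ?_) rfl rfl)
  · have : (s.reg x).size * (60 * L + 150 + 1) ≤ L * (60 * L + 150 + 1) :=
      Nat.mul_le_mul_right _ hxs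
    have e6 : L * (60 * L + 150 + 1) = 60 * (L * L) + 151 * L := by ring
    have e7 : 100 * (L + 2) ^ 2 = 100 * (L * L) + 400 * L + 400 := by ring
    rw [e7]
    simp only
    omega
  · simp only [hS, St.set_reg]; grind

/-- `x := x / y` for odd `y` dividing `x`. -/
def divBy (x y : Reg) : Prog :=
  push (.num .quot) (some true) ;;
    loop (.num x) (popBit x fun b =>
      (if b then push (.num x) (some true) ;; copy y .addend ;; subFrom x .addend ;;
        popBit x fun _ => skip else skip) ;; pushBit .quot b) ;;
    eachBit .quot fun b => pushBit x b

/-- Exact division from the low end: as the divisor `d` is odd, the lowest bit of `d * q` is the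
lowest bit of `q`. Subtract `d` if that bit is one, then halve. No trial comparison is needed. -/
theorem does_divBy {s : St} {x y : Reg} {L : ℕ} (hx : x.isScratch = false)
    (hy : y.isScratch = false) (hxy : x ≠ y) (hs : s.Clean) (hxL : s.reg x < 2 ^ L)
    (hodd : Odd (s.reg y)) (hdvd : s.reg y ∣ s.reg x) :
    Does O (divBy x y) s (s.set x (s.reg x / s.reg y)) (100 * (L + 2) ^ 2) := by
  have n1 := ne_of_isScratch hx (y := .rev) rfl
  have n2 := ne_of_isScratch hx (y := .carry) rfl
  have n3 := ne_of_isScratch hx (y := .addend) rfl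
  have n4 := ne_of_isScratch hx (y := .quot) rfl
  have m1 := ne_of_isScratch hy (y := .rev) rfl
  have m2 := ne_of_isScratch hy (y := .addend) rfl
  have m3 := ne_of_isScratch hy (y := .quot) rfl
  have c1 := hs.rev
  have c2 := hs.carry
  have c3 := hs.addend
  have c4 := hs.quot
  have hxs := Nat.size_le.2 hxL
  set d := s.reg y with hd
  set S : ℕ × ℕ → St := fun i => (s.set x (d * i.1)).set .quot i.2 with hS
  have hSx : ∀ i, (S i).reg x = d * i.1 := fun i => by simp [hS, n4]
  obtain ⟨⟨q, v⟩, h1, ⟨hv, hb, hc, -⟩, hz⟩ := does_loop (O := O) S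
    (fun i => 1 ≤ i.2 ∧ appendRev i.2 i.1 = s.reg x / d ∧
      i.2.size + (d * i.1).size ≤ L + 1 ∧ d * i.1 < 2 ^ L)
    (fun i => (d * i.1).size) (k := .num x) (p := popBit x fun b =>
      (if b then push (.num x) (some true) ;; copy y .addend ;; subFrom x .addend ;;
        popBit x fun _ => skip else skip) ;; pushBit .quot b)
    (T := 60 * L + 70)
    (by
      rintro ⟨q, v⟩ ⟨h1, h2, h3, h4⟩ hne
      rw [ne_eq, St.content_num_eq_nil, hSx] at hne
      simp only at h1 h2 h3 h4 hne
      obtain ⟨q, b, rfl⟩ := exists_two_mul_add q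
      obtain ⟨c, hc⟩ := hodd
      have hdx : d ≤ d * (2 * q + b.toNat) := by
        refine Nat.le_mul_of_pos_right _ (Nat.pos_of_ne_zero ?_)
        rintro h; simp [h] at hne
      have hlt : 2 * (d * q) ≤ d * (2 * q + b.toNat) := by
        rw [Nat.mul_left_comm]; exact Nat.mul_le_mul_left _ (by omega)
      have hsz : (d * q).size + 1 ≤ (d * (2 * q + b.toNat)).size := by
        by_cases h0 : d * q = 0
        · rw [h0, Nat.size_zero, zero_add]
          exact Nat.size_pos.2 (by omega)
        · have := size_two_mul_add (x := d * q) (b := false) (by simpa using h0)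
          simp only [Bool.toNat_false, add_zero] at this
          rw [← this]
          exact Nat.size_le_size hlt
      have hvs := size_two_mul_add_le v b
      refine ⟨(q, 2 * v + b.toNat), (does_popBit (x := (d * (2 * q + b.toNat)) / 2) (b := b) ?_
        (Does.seq (s' := (s.set x (d * q)).set .quot v) (t := 56 * L + 60) ?_
          (does_pushBit _ _ _))).mono (by omega) |>.of_eq ?_, ⟨?_, ?_, ?_, ?_⟩, ?_⟩
      · rw [hSx]
        simp only
        cases b
        · simp only [Bool.toNat_false, add_zero, Nat.mul_left_comm]; omega
        · have : d * (2 * q + 1) = 2 * (d * q + c) + 1 := by rw [hc]; ring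
          simp only [Bool.toNat_true, this]; omega
      · cases b
        · refine ((does_skip _).mono (by omega)).of_eq (St.ext_reg (fun r => ?_) rfl rfl)
          have : d * (2 * q + 0) / 2 = d * q := by
            rw [add_zero, Nat.mul_left_comm]; omega
          simp only [hS, St.set_reg, Bool.toNat_false, this]; grind
        · have e1 : d * (2 * q + 1) / 2 = d * q + c := by
            have : d * (2 * q + 1) = 2 * (d * q + c) + 1 := by rw [hc]; ring
            omega
          simp only [Bool.toNat_true] at h4 hdx
          have e2 : 2 * (d * q + c) + 1 = d * (2 * q + 1) := by rw [hc]; ring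
          have e3 : d * (2 * q + 1) - d = 2 * (d * q) := by rw [← e2]; omega
          simp only [Bool.toNat_true, e1, if_true]
          set s₁ := ((s.set x (d * (2 * q + 1))).set .quot v) with hs₁
          have a1 : Does O (push (.num x) (some true)) ((S (2 * q + 1, v)).set x (d * q + c)) s₁ 1 := by
            refine (does_push (b := true) (by simp)).of_eq (St.ext_reg (fun r => ?_) rfl rfl)
            simp only [hS, hs₁, St.set_reg, Bool.toNat_true]; grind
          have a2 : Does O (copy y .addend) s₁ (s₁.set .addend d) (16 * L + 14) := by
            refine (does_copy (L := L) m2 m1 (by decide) ?_ ?_ ?_).of_eq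
              (St.ext_reg (fun r => ?_) rfl rfl)
            all_goals simp only [hs₁, St.set_reg]
            all_goals grind
          have a3 : Does O (subFrom x .addend) (s₁.set .addend d) (s₁.set x (2 * (d * q)))
              (40 * L + 40) := by
            refine (does_subFrom (L := L) n3 n1 (by decide) n2 (by decide) ?_ ?_ ?_ ?_).of_eq
              (St.ext_reg (fun r => ?_) rfl rfl)
            all_goals simp only [hs₁, St.set_reg]
            all_goals grind
          have a4 : Does O (popBit x fun _ => skip) (s₁.set x (2 * (d * q)))
              ((s.set x (d * q)).set .quot v) 2 := by
            refine does_popBit (x := d * q) (b := false) (by simp) ((does_skip _).of_eq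
              (St.ext_reg (fun r => ?_) rfl rfl))
            simp only [hs₁, St.set_reg]; grind
          exact (a1.seq (a2.seq (a3.seq a4))).mono (by omega)
      · refine St.ext_reg (fun r => ?_) rfl rfl
        simp only [hS, St.set_reg]; grind
      · simp only; omega
      · rw [← h2]; exact appendRev_bit h1 _ _
      · simp only; omega
      · simp only; omega
      · simp only; omega)
    (s.reg x / d, 1) ⟨le_rfl, appendRev_one _, by
      simp only [Nat.mul_div_cancel' hdvd, Nat.size_one]; omega, by
      simpa only [Nat.mul_div_cancel' hdvd] using hxL⟩
  rw [St.content_num_eq_nil, hSx] at hz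
  simp only at hz hv hb hc
  have hq : q = 0 := by
    rcases Nat.mul_eq_zero.1 hz with h | h
    · simp [h] at hodd
    · exact h
  subst hq
  have h4 := does_eachBit (O := O) (t := .quot) (f := fun b => pushBit x b)
    (S := fun z => s.set x z) (T := 3)
    (fun v z b _ => (does_pushBit _ _ _).of_eq (St.ext_reg (by grind) rfl rfl)) hv 0
  have h0 : Does O (push (.num .quot) (some true)) s (S (s.reg x / d, 1)) 1 := by
    refine (does_push (b := true) (by simp)).of_eq (St.ext_reg (fun r => ?_) rfl rfl)
    simp only [hS, St.set_reg, Nat.mul_div_cancel' hdvd]; grind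
  rw [hb] at h4
  have e : S (0, v) = (s.set x 0).set .quot v := by simp [hS]
  rw [e] at h1
  refine ((h0.seq (h1.seq h4)).mono ?_).of_eq (St.ext_reg (by grind) rfl rfl)
  simp only [Nat.mul_div_cancel' hdvd]
  have h5 : v.size * (3 + 5) ≤ (L + 1) * 8 := Nat.mul_le_mul_right _ (by omega)
  have h6 : (s.reg x).size * (60 * L + 70 + 1) ≤ L * (60 * L + 70 + 1) :=
    Nat.mul_le_mul_right _ hxs
  have e6 : L * (60 * L + 70 + 1) = 60 * (L * L) + 71 * L := by ring
  have e7 : 100 * (L + 2) ^ 2 = 100 * (L * L) + 400 * L + 400 := by ring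
  rw [e7]
  omega

/-! #### Communication with the oracle -/

/-- Replace the content of the query stack. -/
def St.setQry (s : St) (q : TapeStr) : St := { s with qry := q }

/-- Replace the content of the answer stack. -/
def St.setAns (s : St) (a : TapeStr) : St := { s with ans := a }

@[simp, grind =] theorem St.setQry_reg (s : St) (q : TapeStr) : (s.setQry q).reg = s.reg := rfl
@[simp, grind =] theorem St.setQry_qry (s : St) (q : TapeStr) : (s.setQry q).qry = q := rfl
@[simp, grind =] theorem St.setQry_ans (s : St) (q : TapeStr) : (s.setQry q).ans = s.ans := rfl
@[simp, grind =] theorem St.setAns_reg (s : St) (q : TapeStr) : (s.setAns q).reg = s.reg := rfl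
@[simp, grind =] theorem St.setAns_qry (s : St) (q : TapeStr) : (s.setAns q).qry = s.qry := rfl
@[simp, grind =] theorem St.setAns_ans (s : St) (q : TapeStr) : (s.setAns q).ans = q := rfl

theorem St.setQry_content (s : St) (q : TapeStr) :
    (s.setQry q).content = Function.update s.content .qry q := by
  funext k
  rcases k with _ | _ | _ <;> simp [content, setQry]

theorem St.setAns_content (s : St) (a : TapeStr) :
    (s.setAns a).content = Function.update s.content .ans a := by
  funext k
  rcases k with _ | _ | _ <;> simp [content, setAns]

theorem does_push_qry (s : St) (x : TapeSym) :
    Does O (push .qry x) s (s.setQry (x :: s.qry)) 1 := by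
  refine ⟨1, le_rfl, ?_⟩
  rw [St.setQry_content]
  exact .push _ _ _

theorem does_query (s : St) : Does O query s ((s.setQry []).setAns (O s.qry)) 2 := by
  refine ⟨2, le_rfl, ?_⟩
  rw [St.setAns_content, St.setQry_content]
  exact .query _

/-- Append a bit to `x` and write it to the query stack. -/
def emitBit (x : Reg) (b : Bool) : Prog :=
  (if b then push .qry (some true) else ifZero x skip (push .qry (some false))) ;; pushBit x b

/-- Write the encoding of `x` on the query stack. -/
def emit (x : Reg) : Prog := push .qry none ;; reverse x ;; eachBit .rev (emitBit x)

/-- A stack is filled from the bottom, so the end marker goes first and the bits follow with the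
most significant one first; `x` is rebuilt at the same time. The zero test in `emitBit` makes the
step relation hold at `z = 0` as well. -/
theorem does_emit {s : St} {x : Reg} {L : ℕ} (hx : x ≠ .rev) (hrev : s.reg .rev = 0)
    (hL : s.reg x < 2 ^ L) :
    Does O (emit x) s (s.setQry ((s.reg x).bits.map some ++ none :: s.qry)) (16 * L + 15) := by
  have h0 := does_push_qry (O := O) s none
  obtain ⟨v, h1, h2, h3, h4⟩ := does_reverse (O := O) (s := s.setQry (none :: s.qry)) hx
    (by simpa using hrev)
  have h5 := does_eachBit (O := O) (t := .rev) (f := emitBit x)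
    (S := fun z => (s.set x z).setQry (z.bits.map some ++ none :: s.qry)) (T := 6)
    (fun v z b _ => by
      have hp := (does_pushBit (O := O) (((s.set x z).setQry
        ((2 * z + b.toNat).bits.map some ++ none :: s.qry)).set .rev v) x b).of_eq
        (s'' := ((s.set x (2 * z + b.toNat)).setQry
          ((2 * z + b.toNat).bits.map some ++ none :: s.qry)).set .rev v)
        (St.ext_reg (fun r => by simp only [St.set_reg, St.setQry_reg]; grind) rfl rfl)
      refine Does.seq (t := 3) ?_ hp
      cases b
      · by_cases hz : z = 0
        · subst hz
          refine (does_ifZero_of_eq ?_ ((does_skip _).of_eq ?_)).mono (by omega)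
          · simp [hx]
          · simp
        · refine does_ifZero_of_ne (by simpa [hx]) ((does_push_qry _ _).of_eq ?_)
          rw [bits_two_mul_add (by simpa using hz)]
          rfl
      · refine ((does_push_qry _ _).of_eq ?_).mono (by omega)
        rw [bits_two_mul_add (by simp)]
        rfl) h1 0
  rw [h2] at h5
  have e : ((s.set x 0).setQry (Nat.bits 0 |>.map some |>.append (none :: s.qry))).set .rev v =
      ((s.setQry (none :: s.qry)).set x 0).set .rev v := by
    simp only [Nat.zero_bits]
    rfl
  have hs := Nat.size_le.2 hL
  rw [St.setQry_reg] at h3 h4 h5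
  replace h5 := e ▸ h5
  refine ((h0.seq (h4.seq h5)).mono (by omega)).of_eq (St.ext_reg (fun r => ?_) rfl rfl)
  simp only [St.set_reg, St.setQry_reg]
  grind

/-- Read the answer stack, holding the encoding of a number, into `x`. -/
def receive (x : Reg) : Prog :=
  push (.num .rev) (some true) ;;
    loop .ans (branch .ans fun o => o.elim skip fun y => y.elim skip fun b => pushBit .rev b) ;;
    eachBit .rev fun b => pushBit x b

theorem does_branch_ans {s s' : St} {f : Option TapeSym → Prog} {y : TapeSym} {l : TapeStr} {t : ℕ}
    (hl : s.ans = y :: l) (h : Does O (f (some y)) (s.setAns l) s' t) :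
    Does O (branch .ans f) s s' (t + 1) := by
  obtain ⟨u, hu, h⟩ := h
  refine ⟨u + 1, by omega, .branch ?_⟩
  have e : s.content .ans = y :: l := hl
  rw [e, List.head?_cons, List.tail_cons, ← St.setAns_content]
  exact h

theorem does_receive {s : St} {x : Reg} {y L : ℕ} (hx : x ≠ .rev) (hrev : s.reg .rev = 0)
    (hx0 : s.reg x = 0) (hans : s.ans = y.bits.map some ++ [none]) (hL : y < 2 ^ L) :
    Does O (receive x) s ((s.setAns []).set x y) (16 * L + 20) := by
  have hys := Nat.size_le.2 hL
  -- `some z` means that the bits of `z` and the end marker are still unread; `none` means that the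
  -- marker has been consumed.
  set S : Option ℕ × ℕ → St := fun i =>
    (s.setAns (i.1.elim [] fun z => z.bits.map some ++ [none])).set .rev i.2 with hS
  obtain ⟨⟨z, v⟩, h1, ⟨hv, hr, hsz⟩, hz⟩ := does_loop (O := O) S
    (fun i => 1 ≤ i.2 ∧ appendRev i.2 (i.1.getD 0) = y ∧ i.2.size + (i.1.getD 0).size ≤ L + 1)
    (fun i => i.1.elim 0 fun z => z.size + 1) (k := .ans)
    (p := branch .ans fun o => o.elim skip fun y => y.elim skip fun b => pushBit .rev b) (T := 4)
    (by
      rintro ⟨z, v⟩ ⟨h1, h2, h3⟩ hne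
      rcases z with _ | z
      · exact absurd rfl hne
      simp only [Option.getD_some] at h1 h2 h3
      by_cases hz : z = 0
      · subst hz
        refine ⟨(none, v), (does_branch_ans (y := none) (l := []) (by simp [hS])
          ((does_skip _).of_eq rfl)).mono (by omega), ⟨h1, h2, h3⟩, by simp⟩
      · obtain ⟨z, b, rfl⟩ := exists_two_mul_add z
        have hsz := size_two_mul_add_le v b
        rw [size_two_mul_add hz] at h3
        refine ⟨(some z, 2 * v + b.toNat), does_branch_ans (y := some b)
          (l := z.bits.map some ++ [none]) (by simp [hS, bits_two_mul_add hz])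
          ((does_pushBit _ _ _).of_eq (St.ext_reg (fun r => ?_) rfl rfl)), ⟨?_, ?_, ?_⟩, ?_⟩
        · simp only [hS, St.set_reg, St.setAns_reg]; grind
        · simp only; omega
        · rw [← h2]; exact appendRev_bit h1 _ _
        · simp only [Option.getD_some]; omega
        · simp [size_two_mul_add hz])
    (some y, 1) ⟨le_rfl, appendRev_one _, by simp; omega⟩
  have hz' : z = none := by
    rcases z with _ | z
    · rfl
    · simp [hS, St.content] at hz
  subst hz'
  simp only [Option.getD_none, Nat.size_zero, add_zero] at hv hr hsz
  have h4 := does_eachBit (O := O) (t := .rev) (f := fun b => pushBit x b)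
    (S := fun z => (s.setAns []).set x z) (T := 3)
    (fun v z b _ => (does_pushBit _ _ _).of_eq (St.ext_reg (by grind) rfl rfl)) hv 0
  rw [hr] at h4
  have h0 : Does O (push (.num .rev) (some true)) s (S (some y, 1)) 1 := by
    refine (does_push (b := true) (by simp)).of_eq (St.ext_reg (fun r => ?_) rfl hans)
    simp only [hS, St.set_reg, St.setAns_reg]; grind
  have e : S (none, v) = ((s.setAns []).set x 0).set .rev v := by
    refine St.ext_reg (fun r => ?_) rfl rfl
    simp only [hS, St.set_reg, St.setAns_reg]; grind
  rw [e] at h1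
  refine ((h0.seq (h1.seq h4)).mono ?_).of_eq (St.ext_reg (by grind) rfl rfl)
  have h5 : v.size * (3 + 5) ≤ (L + 1) * 8 := Nat.mul_le_mul_right _ (by omega)
  simp only [Option.elim_some]
  omega

/-- `r := ᵏa mod m`, by an oracle call. -/
def ask (a k m r : Reg) : Prog := emit m ;; emit k ;; emit a ;; query ;; receive r

/-- The three numbers are written in reverse order, modulus first, so that the base ends on top of
the query stack. -/
theorem does_ask (hO : MTP.SolvedBy O) {s : St} {a k m r : Reg} {L : ℕ} (ha : a ≠ .rev)
    (hk : k ≠ .rev) (hm : m ≠ .rev) (hr : r ≠ .rev) (hrev : s.reg .rev = 0) (hr0 : s.reg r = 0)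
    (hqry : s.qry = []) (hans : s.ans = []) (ha0 : 0 < s.reg a) (hk0 : 0 < s.reg k)
    (hm0 : 0 < s.reg m) (haL : s.reg a < 2 ^ L) (hkL : s.reg k < 2 ^ L) (hmL : s.reg m < 2 ^ L) :
    Does O (ask a k m r) s (s.set r (tetration (s.reg a) (s.reg k) % s.reg m))
      (64 * L + 67) := by
  set Q₁ : TapeStr := (s.reg m).bits.map some ++ none :: s.qry with hQ₁
  set Q₂ : TapeStr := (s.reg k).bits.map some ++ none :: Q₁ with hQ₂
  set Q₃ : TapeStr := (s.reg a).bits.map some ++ none :: Q₂ with hQ₃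
  set y := tetration (s.reg a) (s.reg k) % s.reg m with hy
  have h1 : Does O (emit m) s (s.setQry Q₁) _ := does_emit hm hrev hmL
  have h2 : Does O (emit k) (s.setQry Q₁) (s.setQry Q₂) _ :=
    does_emit (s := s.setQry Q₁) hk hrev hkL
  have h3 : Does O (emit a) (s.setQry Q₂) (s.setQry Q₃) _ :=
    does_emit (s := s.setQry Q₂) ha hrev haL
  have h4 : Does O query (s.setQry Q₃) (s.setAns (O Q₃)) 2 := by
    refine (does_query _).of_eq (St.ext_reg (fun _ => rfl) ?_ rfl)
    simp [hqry]
  have hans' : O Q₃ = y.bits.map some ++ [none] := by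
    have := hO (⟨s.reg a, ha0⟩, ⟨s.reg k, hk0⟩, ⟨s.reg m, hm0⟩)
    simpa [MTP, encodeNats, hQ₃, hQ₂, hQ₁, hqry] using this
  have h5 : Does O (receive r) (s.setAns (O Q₃)) (((s.setAns (O Q₃)).setAns []).set r y) _ :=
    does_receive hr hrev hr0 hans' ((Nat.mod_lt _ hm0).trans hmL)
  refine ((h1.seq (h2.seq (h3.seq (h4.seq h5)))).mono (by omega)).of_eq
    (St.ext_reg (fun _ => rfl) rfl ?_)
  simp [hans]

/-! #### Greatest common divisors -/

/-- `x := gcd x y`, `y := 0`, by the Euclidean algorithm; the oracle computes the remainders. -/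
def gcdTo (x y : Reg) : Prog :=
  push (.num .one) (some true) ;;
    loop (.num y) (ask x .one y .rem ;; clear x ;; copy y x ;; clear y ;; copy .rem y ;;
      clear .rem) ;;
    clear .one

/-- A remainder is a tetration of height one modulo the divisor, so the oracle replaces general
division. -/
theorem does_gcdTo (hO : MTP.SolvedBy O) {s : St} {x y : Reg} {L : ℕ} (hx : x.isScratch = false)
    (hy : y.isScratch = false) (hxy : x ≠ y) (hs : s.Clean) (hxL : s.reg x < 2 ^ L)
    (hyL : s.reg y < 2 ^ L) (hx0 : 0 < s.reg x) :
    Does O (gcdTo x y) s ((s.set x ((s.reg x).gcd (s.reg y))).set y 0) (300 * (L + 2) ^ 2) := by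
  have n1 := ne_of_isScratch hx (y := .rev) rfl
  have n2 := ne_of_isScratch hx (y := .rem) rfl
  have n3 := ne_of_isScratch hx (y := .one) rfl
  have m1 := ne_of_isScratch hy (y := .rev) rfl
  have m2 := ne_of_isScratch hy (y := .rem) rfl
  have m3 := ne_of_isScratch hy (y := .one) rfl
  have c1 := hs.rev
  have c2 := hs.rem
  have c3 := hs.one
  have c4 := hs.qry
  have c5 := hs.ans
  set S : ℕ × ℕ → St := fun i => ((s.set .one 1).set x i.1).set y i.2 with hS
  have hSy : ∀ i, (S i).reg y = i.2 := fun i => by simp [hS]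
  obtain ⟨⟨a, b⟩, h1, ⟨ha0, haL, hbL, hg⟩, hz⟩ := does_loop (O := O) S
    (fun i => 0 < i.1 ∧ i.1 < 2 ^ L ∧ i.2 < 2 ^ L ∧ i.1.gcd i.2 = (s.reg x).gcd (s.reg y))
    -- If `b ≤ a`, then `2 * (a % b) < a` and the total size drops. If `a < b`, the round only swaps
    -- the two numbers, which is paid for by the indicator.
    (fun i => i.1.size + i.2.size + if i.1 < i.2 then 1 else 0) (k := .num y)
    (p := ask x .one y .rem ;; clear x ;; copy y x ;; clear y ;; copy .rem y ;; clear .rem)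
    (T := 105 * L + 100)
    (by
      rintro ⟨a, b⟩ ⟨h1, h2, h3, h4⟩ hne
      rw [ne_eq, St.content_num_eq_nil, hSy] at hne
      simp only at h1 h2 h3 h4 hne
      have hb0 : 0 < b := Nat.pos_of_ne_zero hne
      have h1L : 1 < 2 ^ L := by
        have : a < 2 ^ L := h2
        omega
      set s₁ := (S (a, b)).set .rem (a % b) with hs₁
      have a1 : Does O (ask x .one y .rem) (S (a, b)) s₁ (64 * L + 67) := by
        refine (does_ask (s := S (a, b)) (L := L) (k := .one) (r := .rem) hO n1 (by decide) m1
          (by decide) ?_ ?_ c4 c5 ?_ ?_ ?_ ?_ ?_ ?_).of_eq (St.ext_reg (fun r => ?_) rfl rfl)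
        all_goals simp only [hs₁, hS, St.set_reg]
        all_goals grind [tetration_one]
      have a2 : Does O (clear x) s₁ (s₁.set x 0) (3 * L + 1) :=
        does_clear (by simp only [hs₁, hS, St.set_reg]; grind)
      have a3 : Does O (copy y x) (s₁.set x 0) (s₁.set x b) (16 * L + 14) := by
        refine (does_copy (L := L) hxy.symm m1 n1 ?_ ?_ ?_).of_eq (St.ext_reg (fun r => ?_) rfl rfl)
        all_goals simp only [hs₁, hS, St.set_reg]
        all_goals grind
      have a4 : Does O (clear y) (s₁.set x b) ((s₁.set x b).set y 0) (3 * L + 1) :=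
        does_clear (by simp only [hs₁, hS, St.set_reg]; grind)
      have hab : a % b < 2 ^ L := (Nat.mod_lt a hb0).trans h3
      have a5 : Does O (copy .rem y) ((s₁.set x b).set y 0) ((s₁.set x b).set y (a % b))
          (16 * L + 14) := by
        refine (does_copy (L := L) m2.symm (by decide) m1 ?_ ?_ ?_).of_eq
          (St.ext_reg (fun r => ?_) rfl rfl)
        all_goals simp only [hs₁, hS, St.set_reg]
        all_goals grind
      have a6 : Does O (clear .rem) ((s₁.set x b).set y (a % b)) (S (b, a % b)) (3 * L + 1) := by
        refine (does_clear (L := L) ?_).of_eq (St.ext_reg (fun r => ?_) rfl rfl)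
        all_goals simp only [hs₁, hS, St.set_reg]
        all_goals grind
      refine ⟨_, (a1.seq (a2.seq (a3.seq (a4.seq (a5.seq a6))))).mono (by omega),
        ⟨hb0, h3, hab, ?_⟩, ?_⟩
      · rw [← h4, Nat.gcd_comm a b, Nat.gcd_rec b a, Nat.gcd_comm]
      · have hlt : ¬b < a % b := not_lt.2 (Nat.mod_lt a hb0).le
        simp only [if_neg hlt]
        split_ifs with h
        · rw [Nat.mod_eq_of_lt h]; omega
        · have h5 : 2 * (a % b) < a := by
            have := Nat.mod_lt a hb0
            have h6 := Nat.div_add_mod a b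
            have : b * 1 ≤ b * (a / b) := Nat.mul_le_mul_left _ (Nat.div_pos (by omega) hb0)
            omega
          have h6 : (a % b).size + 1 ≤ a.size := by
            by_cases h0 : a % b = 0
            · rw [h0, Nat.size_zero, zero_add]; exact Nat.size_pos.2 h1
            · have := size_two_mul_add (x := a % b) (b := false) (by simpa using h0)
              simp only [Bool.toNat_false, add_zero] at this
              rw [← this]
              exact Nat.size_le_size h5.le
          omega)
    (s.reg x, s.reg y) ⟨hx0, hxL, hyL, rfl⟩
  rw [St.content_num_eq_nil, hSy] at hz
  simp only at hz ha0 haL hg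
  subst hz
  rw [Nat.gcd_zero_right] at hg
  have h0 : Does O (push (.num .one) (some true)) s (S (s.reg x, s.reg y)) 1 := by
    refine (does_push (b := true) (by simp)).of_eq (St.ext_reg (fun r => ?_) rfl rfl)
    simp only [hS, St.set_reg]; grind
  have h2 : Does O (clear .one) (S (a, 0)) ((s.set x a).set y 0) 4 := by
    refine (does_clear (L := 1) ?_).of_eq (St.ext_reg (fun r => ?_) rfl rfl)
    all_goals simp only [hS, St.set_reg]
    all_goals grind
  rw [← hg]
  refine (h0.seq (h1.seq h2)).mono ?_
  have e1 := Nat.size_le.2 hxL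
  have e2 := Nat.size_le.2 hyL
  have e3 : ((s.reg x).size + (s.reg y).size + if s.reg x < s.reg y then 1 else 0) *
      (105 * L + 100 + 1) ≤ (2 * L + 1) * (105 * L + 100 + 1) :=
    Nat.mul_le_mul_right _ (by split_ifs <;> omega)
  have e4 : (2 * L + 1) * (105 * L + 100 + 1) = 210 * (L * L) + 307 * L + 101 := by ring
  have e5 : 300 * (L + 2) ^ 2 = 300 * (L * L) + 1200 * L + 1200 := by ring
  rw [e5]
  simp only
  omega

/-! ### The reduction -/

/-- The values of the registers that are not scratch registers. -/
structure Vars where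
  inp : ℕ := 0
  len : ℕ := 0
  modulus : ℕ := 0
  count : ℕ := 0
  height₀ : ℕ := 0
  height₁ : ℕ := 0
  height₂ : ℕ := 0
  base : ℕ := 0
  gcd₀ : ℕ := 0
  gcd₁ : ℕ := 0
  pow₀ : ℕ := 0
  pow₁ : ℕ := 0
  pow₂ : ℕ := 0
  diff : ℕ := 0
  acc : ℕ := 0
  parity : ℕ := 0
  iter : ℕ := 0

/-- The state with given values of the variables, everything else being empty. -/
def Vars.toSt (v : Vars) : St where
  reg r := match r with
    | .inp => v.inp
    | .len => v.len
    | .modulus => v.modulus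
    | .count => v.count
    | .height₀ => v.height₀
    | .height₁ => v.height₁
    | .height₂ => v.height₂
    | .base => v.base
    | .gcd₀ => v.gcd₀
    | .gcd₁ => v.gcd₁
    | .pow₀ => v.pow₀
    | .pow₁ => v.pow₁
    | .pow₂ => v.pow₂
    | .diff => v.diff
    | .acc => v.acc
    | .parity => v.parity
    | .iter => v.iter
    | _ => 0
  qry := []
  ans := []

theorem Vars.clean (v : Vars) : v.toSt.Clean := ⟨rfl, rfl, rfl, rfl, rfl, rfl, rfl, rfl, rfl, rfl⟩

/-- Divide `inp` by two as long as it is even, keeping the parity of the number of divisions. -/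
def stripTwos : Prog :=
  push (.num .iter) (some true) ;;
    loop (.num .iter) (popBit .inp fun b =>
      if b then push (.num .inp) (some true) ;; popBit .iter fun _ => skip
      else popBit .parity fun c => pushBit .parity !c)

/-- Here `iter` is a flag rather than a counter: it is cleared once the lowest bit of `inp` is one,
and that bit is then restored. Only the parity of the exponent of two matters for the squarefree
part. -/
theorem does_stripTwos {N : ℕ} (hN : 0 < N) :
    ∃ N' j, Odd N' ∧ N = N' * 2 ^ j ∧
      Does O stripTwos (Vars.toSt { inp := N }) (Vars.toSt { inp := N', parity := j % 2 })
        (6 * N.size + 8) := by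
  set S : ℕ × ℕ × Bool → St := fun i =>
    Vars.toSt { inp := i.1, parity := i.2.1 % 2, iter := i.2.2.toNat } with hS
  obtain ⟨⟨x, j, w⟩, h1, ⟨h2, h3, h4⟩, hz⟩ := does_loop (O := O) S
    (fun i => i.1 * 2 ^ i.2.1 = N ∧ 0 < i.1 ∧ (i.2.2 = false → Odd i.1))
    (fun i => i.1.size + i.2.2.toNat) (k := .num .iter) (p := popBit .inp fun b =>
      if b then push (.num .inp) (some true) ;; popBit .iter fun _ => skip
      else popBit .parity fun c => pushBit .parity !c) (T := 5)
    (by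
      rintro ⟨x, j, w⟩ ⟨h1, h2, h3⟩ hne
      rw [ne_eq, St.content_num_eq_nil] at hne
      have hw : w = true := by
        cases w
        · exact absurd rfl hne
        · rfl
      subst hw
      simp only at h1 h2
      obtain ⟨x, b, rfl⟩ := exists_two_mul_add x
      cases b
      · obtain ⟨k, c, hc⟩ := exists_two_mul_add j
        have hj : j % 2 = c.toNat := by have := Bool.toNat_le c; omega
        have toggle : Does O (popBit .parity fun c => pushBit .parity !c)
            ((S (2 * x + false.toNat, j, true)).set .inp x) (S (x, j + 1, true)) 4 := by
          refine does_popBit (x := 0) (b := c) ?_ ((does_pushBit _ _ _).of_eq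
            (St.ext_reg (fun r => ?_) rfl rfl))
          · simp [hS, Vars.toSt, hj]
          · have : (j + 1) % 2 = (!c).toNat := by cases c <;> simp at hj ⊢ <;> omega
            cases r <;> simp [hS, Vars.toSt, this]
        refine ⟨(x, j + 1, true), does_popBit (x := x) (b := false) rfl toggle,
          ⟨?_, ?_, by simp⟩, ?_⟩
        · rw [← h1, pow_succ]; simp; ring
        · simpa using h2
        · rw [size_two_mul_add (by omega)]; simp
      · refine ⟨(2 * x + 1, j, false), Does.mono (t := 1 + 2 + 1) (does_popBit (x := x)
          (b := true) rfl ((does_push (b := true) (by simp)).seq (does_popBit (x := 0) (b := true) ?_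
          ((does_skip _).of_eq (St.ext_reg (fun r => ?_) rfl rfl))))) (by omega),
          ⟨h1, h2, fun _ => ⟨x, rfl⟩⟩, ?_⟩
        · simp [hS, Vars.toSt]
        · cases r <;> simp [hS, Vars.toSt]
        · simp)
    (N, 0, true) ⟨by simp, hN, by simp⟩
  rw [St.content_num_eq_nil] at hz
  have hw : w = false := by
    cases w
    · rfl
    · simp [hS, Vars.toSt] at hz
  subst hw
  refine ⟨x, j, h4 rfl, h2.symm, ?_⟩
  have h0 : Does O (push (.num .iter) (some true)) (Vars.toSt { inp := N }) (S (N, 0, true)) 1 := by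
    refine (does_push (b := true) (by simp)).of_eq (St.ext_reg (fun r => ?_) rfl rfl)
    cases r <;> rfl
  exact (h0.seq h1).mono (by simp; omega)

/-- Compute the length `n` of the input and the modulus. -/
def setModulus : Prog :=
  copy .inp .modulus ;; mulBy .modulus .inp ;; mulBy .modulus .inp ;; copy .inp .iter ;;
    loop (.num .iter) (popBit .iter fun _ =>
      incr .len ;; mulBy .modulus .inp ;; mulBy .modulus .inp)

/-- A copy of `N` serves as a counter of its own bits. Starting from `N ^ 3`, every bit adds one to
the length and two to the exponent. -/
theorem does_setModulus {N e L : ℕ} (hL : N.size * (2 * N.size + 3) + 1 ≤ L) :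
    Does O setModulus (Vars.toSt { inp := N, parity := e })
      (Vars.toSt { inp := N, parity := e, len := N.size, modulus := N ^ (2 * N.size + 3) })
      (300 * (L + 2) ^ 3) := by
  have hNL : ∀ j ≤ 2 * N.size + 3, N ^ j < 2 ^ L := by
    intro j hj
    calc N ^ j ≤ (2 ^ N.size) ^ j := Nat.pow_le_pow_left (Nat.lt_size_self N).le j
      _ = 2 ^ (N.size * j) := (pow_mul _ _ _).symm
      _ ≤ 2 ^ (N.size * (2 * N.size + 3)) :=
        Nat.pow_le_pow_right (by norm_num) (Nat.mul_le_mul_left _ hj)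
      _ < 2 ^ L := Nat.pow_lt_pow_right (by norm_num) hL
  have hN1 : N < 2 ^ L := by simpa using hNL 1 (by omega)
  have hlen : N.size < 2 ^ L :=
    lt_of_le_of_lt (by nlinarith) (Nat.lt_two_pow_self (n := L))
  set S : ℕ → St := fun i => Vars.toSt
    { inp := N, parity := e, len := N.size - i.size
      modulus := N ^ (3 + 2 * (N.size - i.size)), iter := i } with hS
  have mulSelf : ∀ v : Vars, ∀ j, v.inp = N → v.modulus = N ^ j → j + 1 ≤ 2 * N.size + 3 →
      Does O (mulBy .modulus .inp) v.toSt
        (Vars.toSt { v with modulus := N ^ (j + 1) }) (100 * (L + 2) ^ 2) := by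
    intro v j h1 h2 h3
    have e1 : v.modulus * v.inp = N ^ (j + 1) := by rw [h1, h2, pow_succ]
    refine (does_mulBy (L := L) rfl rfl (by decide) v.clean ?_ ?_ ?_).of_eq
      (St.ext_reg (fun r => ?_) rfl rfl)
    · change v.modulus < _
      rw [h2]; exact hNL j (by omega)
    · change v.inp < _
      rw [h1]; exact hN1
    · change v.modulus * v.inp < _
      rw [e1]; exact hNL _ h3
    · rw [← e1]
      cases r <;> rfl
  obtain ⟨i, h1, -, hz⟩ := does_loop (O := O) S (fun i => i.size ≤ N.size) (fun i => i.size)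
    (k := .num .iter) (p := popBit .iter fun _ =>
      incr .len ;; mulBy .modulus .inp ;; mulBy .modulus .inp) (T := 250 * (L + 2) ^ 2)
    (by
      intro i hi hne
      rw [ne_eq, St.content_num_eq_nil] at hne
      replace hne : i ≠ 0 := hne
      obtain ⟨i, b, rfl⟩ := exists_two_mul_add i
      have hsz := size_two_mul_add hne
      set v : Vars :=
        { inp := N, parity := e, len := N.size - i.size
          modulus := N ^ (3 + 2 * (N.size - (i.size + 1))), iter := i } with hv
      have a1 : Does O (incr .len) ((S (2 * i + b.toNat)).set .iter i) v.toSt (40 * L + 41) := by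
        refine (does_incr (L := L) (by decide) (by decide) (by decide) rfl rfl rfl ?_ ?_).of_eq
          (St.ext_reg (fun r => ?_) rfl rfl)
        · change N.size - _ < _
          omega
        · omega
        · cases r <;> simp [hS, Vars.toSt, hsz, hv]
          omega
      have a2 := mulSelf v _ rfl rfl (by omega)
      have a3 := mulSelf { v with modulus := N ^ (3 + 2 * (N.size - (i.size + 1)) + 1) }
        _ rfl rfl (by omega)
      refine ⟨i, (does_popBit (x := i) (b := b) rfl (a1.seq (a2.seq a3))).mono ?_ |>.of_eq ?_,
        by omega, by omega⟩
      · nlinarith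
      · have : 3 + 2 * (N.size - (i.size + 1)) + 1 + 1 = 3 + 2 * (N.size - i.size) := by omega
        simp only [hS, hv, this])
    N le_rfl
  rw [St.content_num_eq_nil] at hz
  replace hz : i = 0 := hz
  subst hz
  have b1 : Does O (copy .inp .modulus) (Vars.toSt { inp := N, parity := e })
      (Vars.toSt { inp := N, parity := e, modulus := N ^ 1 }) (16 * L + 14) := by
    refine (does_copy (L := L) (by decide) (by decide) (by decide) rfl rfl hN1).of_eq
      (St.ext_reg (fun r => ?_) rfl rfl)
    rw [pow_one]
    cases r <;> rfl
  have b2 := mulSelf { inp := N, parity := e, modulus := N ^ 1 } 1 rfl rfl (by omega)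
  have b3 := mulSelf { inp := N, parity := e, modulus := N ^ 2 } 2 rfl rfl (by omega)
  have b4 : Does O (copy .inp .iter) (Vars.toSt { inp := N, parity := e, modulus := N ^ 3 })
      (S N) (16 * L + 14) := by
    refine (does_copy (L := L) (by decide) (by decide) (by decide) rfl rfl hN1).of_eq
      (St.ext_reg (fun r => ?_) rfl rfl)
    cases r <;> simp [hS, Vars.toSt]
  refine ((b1.seq (b2.seq (b3.seq (b4.seq h1)))).mono ?_).of_eq (St.ext_reg (fun r => ?_) rfl rfl)
  · have h2 : N.size ≤ L := by nlinarith
    have h3 : N.size * (250 * (L + 2) ^ 2 + 1) ≤ L * (250 * (L + 2) ^ 2 + 1) :=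
      Nat.mul_le_mul_right _ h2
    have e1 : 300 * (L + 2) ^ 3 = 300 * (L ^ 3) + 1800 * L ^ 2 + 3600 * L + 2400 := by ring
    have e2 : L * (250 * (L + 2) ^ 2 + 1) = 250 * L ^ 3 + 1000 * L ^ 2 + 1001 * L := by ring
    have e3 : 100 * (L + 2) ^ 2 = 100 * L ^ 2 + 400 * L + 400 := by ring
    rw [e1, e3]
    omega
  · have : 3 + 2 * N.size = 2 * N.size + 3 := by ring
    cases r <;> simp [hS, Vars.toSt, this]

theorem does_copy_vars {v v' : Vars} {x y : Reg} {L : ℕ} (hx : x.isScratch = false)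
    (hy : y.isScratch = false) (hxy : x ≠ y) (hy0 : v.toSt.reg y = 0) (hL : v.toSt.reg x < 2 ^ L)
    (h : v.toSt.set y (v.toSt.reg x) = v'.toSt) : Does O (copy x y) v.toSt v'.toSt (16 * L + 14) :=
  (does_copy hxy (ne_of_isScratch hx rfl) (ne_of_isScratch hy rfl) rfl hy0 hL).of_eq h

theorem does_incr_vars {v v' : Vars} {x : Reg} {L : ℕ} (hx : x.isScratch = false)
    (hL : v.toSt.reg x < 2 ^ L) (hL1 : 1 ≤ L) (h : v.toSt.set x (v.toSt.reg x + 1) = v'.toSt) :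
    Does O (incr x) v.toSt v'.toSt (40 * L + 41) :=
  (does_incr (ne_of_isScratch hx rfl) (ne_of_isScratch hx rfl) (ne_of_isScratch hx rfl) rfl rfl rfl
    hL hL1).of_eq h

theorem Vars.set_eq {v v' : Vars} {x : Reg} {n : ℕ}
    (h : ∀ r, (if r = x then n else v.toSt.reg r) = v'.toSt.reg r) : v.toSt.set x n = v'.toSt :=
  St.ext_reg h rfl rfl

/-- Compute the number of bases and the heights, and set up the greatest common divisors. -/
def setBounds : Prog :=
  push (.num .count) (some true) ;; copy .len .iter ;;
    loop (.num .iter) (popBit .iter fun _ =>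
      pushBit .count false ;; pushBit .count false ;; pushBit .count false ;;
      pushBit .count false ;; pushBit .count false ;; pushBit .count false ;;
      pushBit .count false ;; pushBit .count false) ;;
    copy .len .height₀ ;; push (.num .height₀) (some true) ;;
    copy .height₀ .height₁ ;; incr .height₁ ;; copy .height₁ .height₂ ;; incr .height₂ ;;
    push (.num .base) (some true) ;; copy .modulus .gcd₀ ;; copy .modulus .gcd₁

/-- Eight zero bits appended for every bit of `n` give `2 ^ (8 * s)` with `s = n.size`, which is
polynomial in `n`. A one bit appended to `n` gives the height `2 * n + 1`; two consecutive gaps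
involve three consecutive heights. -/
theorem does_setBounds {N e n m L : ℕ} (hn : 2 * n + 3 < 2 ^ L) (hm : m < 2 ^ L) (hL : 1 ≤ L) :
    Does O setBounds (Vars.toSt { inp := N, parity := e, len := n, modulus := m })
      (Vars.toSt
        { inp := N, parity := e, len := n, modulus := m, count := 2 ^ (8 * n.size)
          height₀ := 2 * n + 1, height₁ := 2 * n + 2, height₂ := 2 * n + 3
          base := 1, gcd₀ := m, gcd₁ := m })
      (300 * (L + 1)) := by
  set S : ℕ → St := fun i => Vars.toSt
    { inp := N, parity := e, len := n, modulus := m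
      count := 2 ^ (8 * (n.size - i.size)), iter := i } with hS
  obtain ⟨i, h1, -, hz⟩ := does_loop (O := O) S (fun i => i.size ≤ n.size) (fun i => i.size)
    (k := .num .iter) (p := popBit .iter fun _ =>
      pushBit .count false ;; pushBit .count false ;; pushBit .count false ;;
      pushBit .count false ;; pushBit .count false ;; pushBit .count false ;;
      pushBit .count false ;; pushBit .count false) (T := 25)
    (by
      intro i hi hne
      rw [ne_eq, St.content_num_eq_nil] at hne
      replace hne : i ≠ 0 := hne
      obtain ⟨i, b, rfl⟩ := exists_two_mul_add i
      have hsz := size_two_mul_add hne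
      have hd : ∀ s : St, ∀ v, Does O (pushBit .count false) (s.set .count v)
          (s.set .count (2 * v)) 3 := fun s v =>
        (does_pushBit _ _ _).of_eq (St.ext_reg (by grind) rfl rfl)
      set s := (S (2 * i + b.toNat)).set .iter i with hs
      set c := 2 ^ (8 * (n.size - (i.size + 1))) with hc
      have hs' : s = s.set .count c := by
        refine St.ext_reg (fun r => ?_) rfl rfl
        cases r <;> simp [hs, hS, Vars.toSt, hc, hsz]
      refine ⟨i, does_popBit (x := i) (b := b) rfl (Does.mono (t := 24) ?_ (by omega)),
        by omega, by omega⟩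
      rw [← hs, hs']
      refine ((hd _ _).seq ((hd _ _).seq ((hd _ _).seq ((hd _ _).seq ((hd _ _).seq
        ((hd _ _).seq ((hd _ _).seq (hd _ _)))))))).of_eq (St.ext_reg (fun r => ?_) rfl rfl)
      have e : n.size - i.size = n.size - (i.size + 1) + 1 := by omega
      have e' : 2 ^ (8 * (n.size - i.size)) =
          2 * (2 * (2 * (2 * (2 * (2 * (2 * (2 * c))))))) := by
        rw [e, Nat.mul_add, pow_add, hc]; ring
      cases r <;> simp [hs, hS, Vars.toSt, e'])
    n le_rfl
  rw [St.content_num_eq_nil] at hz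
  replace hz : i = 0 := hz
  subst hz
  have hnL : n < 2 ^ L := by omega
  have b1 : Does O (push (.num .count) (some true))
      (Vars.toSt { inp := N, parity := e, len := n, modulus := m })
      (Vars.toSt { inp := N, parity := e, len := n, modulus := m, count := 1 }) 1 :=
    (does_push (b := true) (by simp)).of_eq (Vars.set_eq fun r => by cases r <;> rfl)
  have b2 : Does O (copy .len .iter)
      (Vars.toSt { inp := N, parity := e, len := n, modulus := m, count := 1 }) (S n)
      (16 * L + 14) :=
    does_copy_vars rfl rfl (by decide) rfl hnL
      (Vars.set_eq fun r => by cases r <;> simp [Vars.toSt])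
  set v : Vars :=
    { inp := N, parity := e, len := n, modulus := m, count := 2 ^ (8 * n.size) } with hv
  have b3 : Does O (copy .len .height₀) (S 0) (Vars.toSt { v with height₀ := n }) (16 * L + 14) :=
    does_copy_vars rfl rfl (by decide) rfl hnL
      (Vars.set_eq fun r => by cases r <;> simp [Vars.toSt, hv])
  have b4 : Does O (push (.num .height₀) (some true)) (Vars.toSt { v with height₀ := n })
      (Vars.toSt { v with height₀ := 2 * n + 1 }) 1 :=
    (does_push (b := true) (by simp)).of_eq (Vars.set_eq fun r => by cases r <;> rfl)
  have b5 : Does O (copy .height₀ .height₁) (Vars.toSt { v with height₀ := 2 * n + 1 })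
      (Vars.toSt { v with height₀ := 2 * n + 1, height₁ := 2 * n + 1 }) (16 * L + 14) :=
    does_copy_vars rfl rfl (by decide) rfl (show 2 * n + 1 < _ by omega)
      (Vars.set_eq fun r => by cases r <;> rfl)
  have b6 : Does O (incr .height₁)
      (Vars.toSt { v with height₀ := 2 * n + 1, height₁ := 2 * n + 1 })
      (Vars.toSt { v with height₀ := 2 * n + 1, height₁ := 2 * n + 2 }) (40 * L + 41) :=
    does_incr_vars rfl (show 2 * n + 1 < _ by omega) hL (Vars.set_eq fun r => by cases r <;> rfl)
  have b7 : Does O (copy .height₁ .height₂)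
      (Vars.toSt { v with height₀ := 2 * n + 1, height₁ := 2 * n + 2 })
      (Vars.toSt { v with height₀ := 2 * n + 1, height₁ := 2 * n + 2, height₂ := 2 * n + 2 })
      (16 * L + 14) :=
    does_copy_vars rfl rfl (by decide) rfl (show 2 * n + 2 < _ by omega)
      (Vars.set_eq fun r => by cases r <;> rfl)
  have b8 : Does O (incr .height₂)
      (Vars.toSt { v with height₀ := 2 * n + 1, height₁ := 2 * n + 2, height₂ := 2 * n + 2 })
      (Vars.toSt { v with height₀ := 2 * n + 1, height₁ := 2 * n + 2, height₂ := 2 * n + 3 })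
      (40 * L + 41) :=
    does_incr_vars rfl (show 2 * n + 2 < _ by omega) hL (Vars.set_eq fun r => by cases r <;> rfl)
  set w : Vars :=
    { v with height₀ := 2 * n + 1, height₁ := 2 * n + 2, height₂ := 2 * n + 3 } with hw
  have b9 : Does O (push (.num .base) (some true)) w.toSt (Vars.toSt { w with base := 1 }) 1 :=
    (does_push (b := true) (by simp)).of_eq (Vars.set_eq fun r => by cases r <;> rfl)
  have b10 : Does O (copy .modulus .gcd₀) (Vars.toSt { w with base := 1 })
      (Vars.toSt { w with base := 1, gcd₀ := m }) (16 * L + 14) :=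
    does_copy_vars rfl rfl (by decide) rfl hm (Vars.set_eq fun r => by cases r <;> rfl)
  have b11 : Does O (copy .modulus .gcd₁) (Vars.toSt { w with base := 1, gcd₀ := m })
      (Vars.toSt { w with base := 1, gcd₀ := m, gcd₁ := m }) (16 * L + 14) :=
    does_copy_vars rfl rfl (by decide) rfl hm (Vars.set_eq fun r => by cases r <;> rfl)
  refine (b1.seq (b2.seq (h1.seq (b3.seq (b4.seq (b5.seq (b6.seq (b7.seq (b8.seq
    (b9.seq (b10.seq b11))))))))))).mono ?_
  have := Nat.size_le.2 hnL
  omega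

/-- For all bases, take the greatest common divisors with the gaps at two consecutive heights. -/
def gcdLoop : Prog :=
  loop (.num .count) (decr .count ;; incr .base ;;
    ask .base .height₀ .modulus .pow₀ ;; ask .base .height₁ .modulus .pow₁ ;;
    ask .base .height₂ .modulus .pow₂ ;;
    copy .modulus .diff ;; subFrom .diff .pow₀ ;; copy .pow₁ .iter ;; addTo .diff .iter ;;
    gcdTo .gcd₀ .diff ;;
    copy .modulus .diff ;; subFrom .diff .pow₁ ;; addTo .diff .pow₂ ;; gcdTo .gcd₁ .diff)

/-- Since the running gcd divides `m`, only the gap modulo `m` matters. Adding `m` first keeps the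
difference of the residues nonnegative. -/
theorem gcd_mod_sub_mod_add {g m x y : ℕ} (hg : g ∣ m) (hm : 0 < m) (hxy : x ≤ y) :
    g.gcd (m - x % m + y % m) = g.gcd (y - x) := by
  have h1 : m - x % m + y % m ≡ y - x [MOD m] := by
    have hx := Nat.mod_lt x hm
    refine Nat.ModEq.add_right_cancel' x ?_
    rw [Nat.sub_add_cancel hxy]
    calc m - x % m + y % m + x ≡ m - x % m + y % m + x % m [MOD m] :=
          (Nat.mod_modEq x m).symm.add_left _
      _ = m + y % m := by omega
      _ ≡ y % m [MOD m] := by simp [Nat.ModEq]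
      _ ≡ y [MOD m] := Nat.mod_modEq y m
  have h2 : m - x % m + y % m ≡ y - x [MOD g] := h1.of_dvd hg
  rw [Nat.gcd_comm, Nat.gcd_comm g]
  exact h2.gcd_eq

/-- The base starts at one and is increased before use, so `B` rounds cover `2, …, B + 1`; initially
the range of bases is empty and both gcds equal `m`. -/
theorem does_gcdLoop (hO : MTP.SolvedBy O) {N e n m k L B : ℕ} (hm0 : 0 < m) (hm : 2 * m < 2 ^ L)
    (hk : k + 2 < 2 ^ L) (hk0 : 0 < k) (hB : B + 1 < 2 ^ L) :
    Does O gcdLoop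
      (Vars.toSt
        { inp := N, parity := e, len := n, modulus := m, count := B
          height₀ := k, height₁ := k + 1, height₂ := k + 2
          base := 1, gcd₀ := m, gcd₁ := m })
      (Vars.toSt
        { inp := N, parity := e, len := n, modulus := m
          height₀ := k, height₁ := k + 1, height₂ := k + 2
          base := B + 1, gcd₀ := gapGcd m (B + 1) k, gcd₁ := gapGcd m (B + 1) (k + 1) })
      (B * (1000 * (L + 2) ^ 2 + 1) + 1) := by
  set u : Vars :=
    { inp := N, parity := e, len := n, modulus := m
      height₀ := k, height₁ := k + 1, height₂ := k + 2 } with hu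
  set S : ℕ → St := fun c => Vars.toSt
    { u with
      count := c, base := B + 1 - c, gcd₀ := gapGcd m (B + 1 - c) k
      gcd₁ := gapGcd m (B + 1 - c) (k + 1) } with hS
  have hL1 : 1 ≤ L := by
    rcases Nat.eq_zero_or_pos L with rfl | h
    · simp at hB
    · exact h
  have hgm : ∀ b j, gapGcd m b j ≤ m := fun b j => Nat.le_of_dvd hm0 (gapGcd_dvd _ _ _)
  obtain ⟨i, h1, -, hz⟩ := does_loop (O := O) S (fun c => c ≤ B) (fun c => c) (k := .num .count)
    (p := decr .count ;; incr .base ;;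
      ask .base .height₀ .modulus .pow₀ ;; ask .base .height₁ .modulus .pow₁ ;;
      ask .base .height₂ .modulus .pow₂ ;;
      copy .modulus .diff ;; subFrom .diff .pow₀ ;; copy .pow₁ .iter ;; addTo .diff .iter ;;
      gcdTo .gcd₀ .diff ;;
      copy .modulus .diff ;; subFrom .diff .pow₁ ;; addTo .diff .pow₂ ;; gcdTo .gcd₁ .diff)
    (T := 1000 * (L + 2) ^ 2)
    (by
      intro c hc hne
      rw [ne_eq, St.content_num_eq_nil] at hne
      replace hne : c ≠ 0 := hne
      obtain ⟨c, rfl⟩ : ∃ j, c = j + 1 := ⟨c - 1, by omega⟩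
      obtain ⟨b, hb⟩ : ∃ b, B + 1 - (c + 1) = b := ⟨_, rfl⟩
      have hb' : B + 1 - c = b + 1 := by omega
      have hb1 : 1 ≤ b := by omega
      have ha : 2 ≤ b + 1 := by omega
      have lt₀ := tetration_lt_succ ha k
      have lt₁ := tetration_lt_succ ha (k + 1)
      set x₀ := tetration (b + 1) k % m with hx₀
      set x₁ := tetration (b + 1) (k + 1) % m with hx₁
      set x₂ := tetration (b + 1) (k + 2) % m with hx₂
      have hx₀m : x₀ < m := Nat.mod_lt _ hm0
      have hx₁m : x₁ < m := Nat.mod_lt _ hm0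
      have hx₂m : x₂ < m := Nat.mod_lt _ hm0
      set g₀ := gapGcd m b k with hg₀
      set g₁ := gapGcd m b (k + 1) with hg₁
      have hg₀m : g₀ ≤ m := hgm _ _
      have hg₁m : g₁ ≤ m := hgm _ _
      have hg₀0 : 0 < g₀ := Nat.gcd_pos_of_pos_left _ hm0
      have hg₁0 : 0 < g₁ := Nat.gcd_pos_of_pos_left _ hm0
      have e₀ : g₀.gcd (m - x₀ + x₁) = gapGcd m (b + 1) k := by
        rw [gapGcd_succ hb1, ← hg₀]
        exact gcd_mod_sub_mod_add (gapGcd_dvd _ _ _) hm0 lt₀.le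
      have e₁ : g₁.gcd (m - x₁ + x₂) = gapGcd m (b + 1) (k + 1) := by
        rw [gapGcd_succ hb1, ← hg₁]
        exact gcd_mod_sub_mod_add (gapGcd_dvd _ _ _) hm0 lt₁.le
      have hmL : m < 2 ^ L := by omega
      set v : Vars := { u with count := c, base := b + 1, gcd₀ := g₀, gcd₁ := g₁ } with hv
      have a1 : Does O (decr .count) (S (c + 1)) (Vars.toSt { v with base := b }) (40 * L + 41) := by
        refine (does_decr (L := L) (by decide) (by decide) (by decide) rfl rfl rfl
          (show c + 1 < _ by omega) (show 1 ≤ c + 1 by omega)).of_eq (Vars.set_eq fun r => ?_)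
        simp only [hS, hb]
        cases r <;> rfl
      have a2 : Does O (incr .base) (Vars.toSt { v with base := b }) v.toSt (40 * L + 41) :=
        does_incr_vars rfl (show b < _ by omega) hL1 (Vars.set_eq fun r => by cases r <;> rfl)
      have a3 : Does O (ask .base .height₀ .modulus .pow₀) v.toSt
          (Vars.toSt { v with pow₀ := x₀ }) (64 * L + 67) := by
        refine (does_ask hO (by decide) (by decide) (by decide) (by decide) rfl rfl rfl rfl
          (show 0 < b + 1 by omega) (show 0 < k from hk0) (show 0 < m from hm0)
          (show b + 1 < _ by omega) (show k < _ by omega) (show m < _ from hmL)).of_eq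
          (Vars.set_eq fun r => by cases r <;> rfl)
      have a4 : Does O (ask .base .height₁ .modulus .pow₁) (Vars.toSt { v with pow₀ := x₀ })
          (Vars.toSt { v with pow₀ := x₀, pow₁ := x₁ }) (64 * L + 67) := by
        refine (does_ask hO (by decide) (by decide) (by decide) (by decide) rfl rfl rfl rfl
          (show 0 < b + 1 by omega) (show 0 < k + 1 by omega) (show 0 < m from hm0)
          (show b + 1 < _ by omega) (show k + 1 < _ by omega) (show m < _ from hmL)).of_eq
          (Vars.set_eq fun r => by cases r <;> rfl)
      have a5 : Does O (ask .base .height₂ .modulus .pow₂)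
          (Vars.toSt { v with pow₀ := x₀, pow₁ := x₁ })
          (Vars.toSt { v with pow₀ := x₀, pow₁ := x₁, pow₂ := x₂ }) (64 * L + 67) := by
        refine (does_ask hO (by decide) (by decide) (by decide) (by decide) rfl rfl rfl rfl
          (show 0 < b + 1 by omega) (show 0 < k + 2 by omega) (show 0 < m from hm0)
          (show b + 1 < _ by omega) (show k + 2 < _ by omega) (show m < _ from hmL)).of_eq
          (Vars.set_eq fun r => by cases r <;> rfl)
      have a6 : Does O (copy .modulus .diff)
          (Vars.toSt { v with pow₀ := x₀, pow₁ := x₁, pow₂ := x₂ })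
          (Vars.toSt { v with pow₀ := x₀, pow₁ := x₁, pow₂ := x₂, diff := m }) (16 * L + 14) :=
        does_copy_vars rfl rfl (by decide) rfl hmL (Vars.set_eq fun r => by cases r <;> rfl)
      have a7 : Does O (subFrom .diff .pow₀)
          (Vars.toSt { v with pow₀ := x₀, pow₁ := x₁, pow₂ := x₂, diff := m })
          (Vars.toSt { v with pow₁ := x₁, pow₂ := x₂, diff := m - x₀ }) (40 * L + 40) :=
        (does_subFrom (by decide) (by decide) (by decide) (by decide) (by decide) rfl rfl hmL
          hx₀m.le).of_eq (St.ext_reg (fun r => by cases r <;> rfl) rfl rfl)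
      have a8 : Does O (copy .pow₁ .iter)
          (Vars.toSt { v with pow₁ := x₁, pow₂ := x₂, diff := m - x₀ })
          (Vars.toSt { v with pow₁ := x₁, pow₂ := x₂, diff := m - x₀, iter := x₁ })
          (16 * L + 14) :=
        does_copy_vars rfl rfl (by decide) rfl (hx₁m.trans hmL)
          (Vars.set_eq fun r => by cases r <;> rfl)
      have a9 : Does O (addTo .diff .iter)
          (Vars.toSt { v with pow₁ := x₁, pow₂ := x₂, diff := m - x₀, iter := x₁ })
          (Vars.toSt { v with pow₁ := x₁, pow₂ := x₂, diff := m - x₀ + x₁ }) (40 * L + 40) :=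
        (does_addTo (by decide) (by decide) (by decide) (by decide) (by decide) rfl rfl
          (show m - x₀ < _ by omega) (show x₁ < _ by omega)).of_eq
          (St.ext_reg (fun r => by cases r <;> rfl) rfl rfl)
      have a10 : Does O (gcdTo .gcd₀ .diff)
          (Vars.toSt { v with pow₁ := x₁, pow₂ := x₂, diff := m - x₀ + x₁ })
          (Vars.toSt { v with pow₁ := x₁, pow₂ := x₂, gcd₀ := gapGcd m (b + 1) k })
          (300 * (L + 2) ^ 2) := by
        refine (does_gcdTo (x := .gcd₀) (y := .diff) (L := L)
          (s := Vars.toSt { v with pow₁ := x₁, pow₂ := x₂, diff := m - x₀ + x₁ }) hO rfl rfl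
          (by decide) (Vars.clean _) (show g₀ < _ by omega)
          (show m - x₀ + x₁ < _ by omega) hg₀0).of_eq (St.ext_reg (fun r => ?_) rfl rfl)
        rw [← e₀]
        cases r <;> rfl
      have a11 : Does O (copy .modulus .diff)
          (Vars.toSt { v with pow₁ := x₁, pow₂ := x₂, gcd₀ := gapGcd m (b + 1) k })
          (Vars.toSt { v with pow₁ := x₁, pow₂ := x₂, gcd₀ := gapGcd m (b + 1) k, diff := m })
          (16 * L + 14) :=
        does_copy_vars rfl rfl (by decide) rfl hmL (Vars.set_eq fun r => by cases r <;> rfl)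
      have a12 : Does O (subFrom .diff .pow₁)
          (Vars.toSt { v with pow₁ := x₁, pow₂ := x₂, gcd₀ := gapGcd m (b + 1) k, diff := m })
          (Vars.toSt { v with pow₂ := x₂, gcd₀ := gapGcd m (b + 1) k, diff := m - x₁ })
          (40 * L + 40) :=
        (does_subFrom (by decide) (by decide) (by decide) (by decide) (by decide) rfl rfl hmL
          hx₁m.le).of_eq (St.ext_reg (fun r => by cases r <;> rfl) rfl rfl)
      have a13 : Does O (addTo .diff .pow₂)
          (Vars.toSt { v with pow₂ := x₂, gcd₀ := gapGcd m (b + 1) k, diff := m - x₁ })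
          (Vars.toSt { v with gcd₀ := gapGcd m (b + 1) k, diff := m - x₁ + x₂ }) (40 * L + 40) :=
        (does_addTo (by decide) (by decide) (by decide) (by decide) (by decide) rfl rfl
          (show m - x₁ < _ by omega) (show x₂ < _ by omega)).of_eq
          (St.ext_reg (fun r => by cases r <;> rfl) rfl rfl)
      have a14 : Does O (gcdTo .gcd₁ .diff)
          (Vars.toSt { v with gcd₀ := gapGcd m (b + 1) k, diff := m - x₁ + x₂ })
          (S c) (300 * (L + 2) ^ 2) := by
        refine (does_gcdTo (x := .gcd₁) (y := .diff) (L := L)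
          (s := Vars.toSt { v with gcd₀ := gapGcd m (b + 1) k, diff := m - x₁ + x₂ }) hO rfl rfl
          (by decide) (Vars.clean _) (show g₁ < _ by omega)
          (show m - x₁ + x₂ < _ by omega) hg₁0).of_eq (St.ext_reg (fun r => ?_) rfl rfl)
        simp only [hS, hb', ← e₁]
        cases r <;> rfl
      refine ⟨c, (a1.seq (a2.seq (a3.seq (a4.seq (a5.seq (a6.seq (a7.seq (a8.seq (a9.seq (a10.seq
        (a11.seq (a12.seq (a13.seq a14))))))))))))).mono ?_, by omega, by omega⟩
      have e1 : 1000 * (L + 2) ^ 2 = 1000 * L ^ 2 + 4000 * L + 4000 := by ring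
      have e2 : 300 * (L + 2) ^ 2 = 300 * L ^ 2 + 1200 * L + 1200 := by ring
      rw [e1, e2]
      omega)
    B le_rfl
  rw [St.content_num_eq_nil] at hz
  replace hz : i = 0 := hz
  subst hz
  have hstart : ∀ j, gapGcd m 1 j = m := fun j => by simp [gapGcd]
  have eB : S B = Vars.toSt { u with count := B, base := 1, gcd₀ := m, gcd₁ := m } := by
    have : B + 1 - B = 1 := by omega
    simp only [hS, this, hstart]
  rw [eB] at h1
  exact h1

/-- With the radical of `inp` in `gcd₁`, compute the squarefree part of `inp` in `acc`, by
removing the square of every prime whose square divides `inp`, until `inp` is one. -/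
def peel : Prog :=
  push (.num .acc) (some true) ;; copy .inp .iter ;;
    loop (.num .iter) (popBit .iter fun _ =>
      divBy .inp .gcd₁ ;; mulBy .acc .gcd₁ ;; copy .inp .diff ;; gcdTo .gcd₁ .diff ;;
      divBy .inp .gcd₁ ;; divBy .acc .gcd₁ ;; copy .inp .diff ;; gcdTo .gcd₁ .diff)

/-- The bits of a copy of `N` count the rounds: `inp` is at most two to the number of bits left,
hence one at the end. All divisors divide the odd `N`, as `divBy` requires. -/
theorem does_peel (hO : MTP.SolvedBy O) {v : Vars} {N R L : ℕ} (hodd : Odd N)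
    (hR : IsRadicalOf N R) (hL : N < 2 ^ L) (hinp : v.inp = N) (hgcd : v.gcd₁ = R)
    (hacc : v.acc = 0) (hdiff : v.diff = 0) (hiter : v.iter = 0) :
    ∃ R' A, PeelInv N 1 R' A ∧ Does O peel v.toSt
      (Vars.toSt { v with inp := 1, gcd₁ := R', acc := A }) (1300 * (L + 2) ^ 3) := by
  set S : ℕ × ℕ × ℕ × ℕ → St := fun i => Vars.toSt
    { v with iter := i.1, inp := i.2.1, gcd₁ := i.2.2.1, acc := i.2.2.2 } with hS
  obtain ⟨⟨c, M, R', A⟩, h1, ⟨hinv, hM⟩, hz⟩ := does_loop (O := O) S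
    (fun i => PeelInv N i.2.1 i.2.2.1 i.2.2.2 ∧ i.2.1 ≤ 2 ^ i.1.size) (fun i => i.1.size)
    (k := .num .iter) (p := popBit .iter fun _ =>
      divBy .inp .gcd₁ ;; mulBy .acc .gcd₁ ;; copy .inp .diff ;; gcdTo .gcd₁ .diff ;;
      divBy .inp .gcd₁ ;; divBy .acc .gcd₁ ;; copy .inp .diff ;; gcdTo .gcd₁ .diff)
    (T := 1100 * (L + 2) ^ 2)
    (by
      rintro ⟨c, M, R, A⟩ ⟨hinv, hM⟩ hne
      rw [ne_eq, St.content_num_eq_nil] at hne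
      replace hne : c ≠ 0 := hne
      obtain ⟨c, b, rfl⟩ := exists_two_mul_add c
      have hsz := size_two_mul_add hne
      simp only [hsz] at hinv hM
      have hAM : A * M ≤ N := Nat.le_of_dvd hodd.pos hinv.dvd_left
      have hA0 : 0 < A := Nat.pos_of_ne_zero hinv.sqA.ne_zero
      have hR0 : 0 < R := Nat.pos_of_ne_zero hinv.rad.squarefree.ne_zero
      have hRM : R ≤ M := Nat.le_of_dvd hinv.pos hinv.rad.dvd
      have hMN : M ≤ N := (Nat.le_mul_of_pos_left M hA0).trans hAM
      have hAN : A ≤ N := (Nat.le_mul_of_pos_right A hinv.pos).trans hAM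
      have hARN : A * R ≤ N := (Nat.mul_le_mul_left A hRM).trans hAM
      have hMo : Odd M := odd_of_dvd hodd ((dvd_mul_left _ _).trans hinv.dvd_left)
      have hRo : Odd R := odd_of_dvd hMo hinv.rad.dvd
      obtain ⟨M₁, hM₁⟩ : ∃ x, x = M / R := ⟨_, rfl⟩
      obtain ⟨R₁, hR₁⟩ : ∃ x, x = R.gcd M₁ := ⟨_, rfl⟩
      obtain ⟨M₂, hM₂⟩ : ∃ x, x = M₁ / R₁ := ⟨_, rfl⟩
      obtain ⟨A₂, hA₂⟩ : ∃ x, x = A * R / R₁ := ⟨_, rfl⟩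
      obtain ⟨R₂, hR₂⟩ : ∃ x, x = R₁.gcd M₂ := ⟨_, rfl⟩
      have hinv' := hinv.step hM₁ hR₁ hM₂ hA₂ hR₂
      have hM₁c : M₁ ≤ 2 ^ c.size := hM₁ ▸ hinv.div_le hM
      have hM₁M : M₁ ≤ M := hM₁ ▸ Nat.div_le_self _ _
      have hM₂M : M₂ ≤ M₁ := hM₂ ▸ Nat.div_le_self _ _
      have hR₁R : R₁ ∣ R := hR₁ ▸ Nat.gcd_dvd_left _ _
      have hR₁M : R₁ ∣ M₁ := hR₁ ▸ Nat.gcd_dvd_right _ _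
      have hR₁o : Odd R₁ := odd_of_dvd hRo hR₁R
      have hR₁le : R₁ ≤ R := Nat.le_of_dvd hR0 hR₁R
      set w : Vars := { v with iter := c } with hw
      have a1 : Does O (divBy .inp .gcd₁) (Vars.toSt { w with inp := M, gcd₁ := R, acc := A })
          (Vars.toSt { w with inp := M₁, gcd₁ := R, acc := A }) (100 * (L + 2) ^ 2) := by
        refine (does_divBy (x := .inp) (y := .gcd₁) (L := L)
          (s := Vars.toSt { w with inp := M, gcd₁ := R, acc := A }) rfl rfl (by decide)
          (Vars.clean _) (show M < _ by omega) hRo hinv.rad.dvd).of_eq (Vars.set_eq fun r => ?_)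
        rw [hM₁]
        cases r <;> rfl
      have a2 : Does O (mulBy .acc .gcd₁) (Vars.toSt { w with inp := M₁, gcd₁ := R, acc := A })
          (Vars.toSt { w with inp := M₁, gcd₁ := R, acc := A * R }) (100 * (L + 2) ^ 2) :=
        (does_mulBy (x := .acc) (y := .gcd₁) (L := L)
          (s := Vars.toSt { w with inp := M₁, gcd₁ := R, acc := A }) rfl rfl (by decide)
          (Vars.clean _) (show A < _ by omega) (show R < _ by omega)
          (show A * R < _ by omega)).of_eq (Vars.set_eq fun r => by cases r <;> rfl)
      have a3 : Does O (copy .inp .diff)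
          (Vars.toSt { w with inp := M₁, gcd₁ := R, acc := A * R })
          (Vars.toSt { w with inp := M₁, gcd₁ := R, acc := A * R, diff := M₁ }) (16 * L + 14) :=
        does_copy_vars rfl rfl (by decide) hdiff (show M₁ < _ by omega)
          (Vars.set_eq fun r => by cases r <;> rfl)
      have a4 : Does O (gcdTo .gcd₁ .diff)
          (Vars.toSt { w with inp := M₁, gcd₁ := R, acc := A * R, diff := M₁ })
          (Vars.toSt { w with inp := M₁, gcd₁ := R₁, acc := A * R }) (300 * (L + 2) ^ 2) := by
        refine (does_gcdTo (x := .gcd₁) (y := .diff) (L := L)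
          (s := Vars.toSt { w with inp := M₁, gcd₁ := R, acc := A * R, diff := M₁ }) hO rfl rfl
          (by decide) (Vars.clean _) (show R < _ by omega) (show M₁ < _ by omega) hR0).of_eq
          (St.ext_reg (fun r => ?_) rfl rfl)
        rw [hR₁]
        cases r <;> first | rfl | exact hdiff.symm
      have a5 : Does O (divBy .inp .gcd₁)
          (Vars.toSt { w with inp := M₁, gcd₁ := R₁, acc := A * R })
          (Vars.toSt { w with inp := M₂, gcd₁ := R₁, acc := A * R }) (100 * (L + 2) ^ 2) := by
        refine (does_divBy (x := .inp) (y := .gcd₁) (L := L)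
          (s := Vars.toSt { w with inp := M₁, gcd₁ := R₁, acc := A * R }) rfl rfl (by decide)
          (Vars.clean _) (show M₁ < _ by omega) hR₁o hR₁M).of_eq (Vars.set_eq fun r => ?_)
        rw [hM₂]
        cases r <;> rfl
      have a6 : Does O (divBy .acc .gcd₁)
          (Vars.toSt { w with inp := M₂, gcd₁ := R₁, acc := A * R })
          (Vars.toSt { w with inp := M₂, gcd₁ := R₁, acc := A₂ }) (100 * (L + 2) ^ 2) := by
        refine (does_divBy (x := .acc) (y := .gcd₁) (L := L)
          (s := Vars.toSt { w with inp := M₂, gcd₁ := R₁, acc := A * R }) rfl rfl (by decide)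
          (Vars.clean _) (show A * R < _ by omega) hR₁o (hR₁R.mul_left A)).of_eq
          (Vars.set_eq fun r => ?_)
        rw [hA₂]
        cases r <;> rfl
      have a7 : Does O (copy .inp .diff)
          (Vars.toSt { w with inp := M₂, gcd₁ := R₁, acc := A₂ })
          (Vars.toSt { w with inp := M₂, gcd₁ := R₁, acc := A₂, diff := M₂ }) (16 * L + 14) :=
        does_copy_vars rfl rfl (by decide) hdiff (show M₂ < _ by omega)
          (Vars.set_eq fun r => by cases r <;> rfl)
      have a8 : Does O (gcdTo .gcd₁ .diff)
          (Vars.toSt { w with inp := M₂, gcd₁ := R₁, acc := A₂, diff := M₂ })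
          (S (c, M₂, R₂, A₂)) (300 * (L + 2) ^ 2) := by
        refine (does_gcdTo (x := .gcd₁) (y := .diff) (L := L)
          (s := Vars.toSt { w with inp := M₂, gcd₁ := R₁, acc := A₂, diff := M₂ }) hO rfl rfl
          (by decide) (Vars.clean _) (show R₁ < _ by omega) (show M₂ < _ by omega)
          hR₁o.pos).of_eq (St.ext_reg (fun r => ?_) rfl rfl)
        rw [hR₂]
        cases r <;> first | rfl | exact hdiff.symm
      have a0 : (S (2 * c + b.toNat, M, R, A)).set .iter c =
          Vars.toSt { w with inp := M, gcd₁ := R, acc := A } :=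
        Vars.set_eq fun r => by cases r <;> rfl
      refine ⟨(c, M₂, R₂, A₂), Does.mono (does_popBit (x := c) (b := b) rfl
        (a0 ▸ a1.seq (a2.seq (a3.seq (a4.seq (a5.seq (a6.seq (a7.seq a8)))))))) ?_,
        ⟨hinv', by simp only; omega⟩, by simp only; omega⟩
      have e1 : 1100 * (L + 2) ^ 2 = 1100 * L ^ 2 + 4400 * L + 4400 := by ring
      have e2 : 300 * (L + 2) ^ 2 = 300 * L ^ 2 + 1200 * L + 1200 := by ring
      have e3 : 100 * (L + 2) ^ 2 = 100 * L ^ 2 + 400 * L + 400 := by ring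
      rw [e1, e2, e3]
      omega)
    (N, N, R, 1) ⟨.start hodd hR, (Nat.lt_size_self N).le⟩
  rw [St.content_num_eq_nil] at hz
  replace hz : c = 0 := hz
  subst hz
  have hM1 : M = 1 := by
    have := hinv.pos
    simp only [Nat.size_zero, pow_zero] at hM this
    omega
  subst hM1
  refine ⟨R', A, hinv, ?_⟩
  have b1 : Does O (push (.num .acc) (some true)) v.toSt (Vars.toSt { v with acc := 1 }) 1 := by
    refine (does_push (b := true) (by simp)).of_eq (Vars.set_eq fun r => ?_)
    cases r <;> simp [Vars.toSt, hacc]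
  have b2 : Does O (copy .inp .iter) (Vars.toSt { v with acc := 1 }) (S (N, N, R, 1))
      (16 * L + 14) :=
    does_copy_vars rfl rfl (by decide) hiter (show v.inp < _ by omega)
      (Vars.set_eq fun r => by cases r <;> simp [Vars.toSt, hinp, hgcd])
  refine ((b1.seq (b2.seq h1)).mono ?_).of_eq (St.ext_reg (fun r => ?_) rfl rfl)
  · have h3 : N.size * (1100 * (L + 2) ^ 2 + 1) ≤ L * (1100 * (L + 2) ^ 2 + 1) :=
      Nat.mul_le_mul_right _ (Nat.size_le.2 hL)
    have e1 : 1300 * (L + 2) ^ 3 = 1300 * (L ^ 3) + 7800 * L ^ 2 + 15600 * L + 10400 := by ring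
    have e2 : L * (1100 * (L + 2) ^ 2 + 1) = 1100 * L ^ 3 + 4400 * L ^ 2 + 4401 * L := by ring
    rw [e1]
    simp only
    omega
  · cases r <;> simp [hS, Vars.toSt, hiter]

/-- Write `2 ^ parity * acc` on the output stack. -/
def output : Prog :=
  (popBit .parity fun b => if b then pushBit .acc false else skip) ;; emit .acc

theorem does_output {v : Vars} {A L : ℕ} {b : Bool} (hb : v.parity = b.toNat) (hA : v.acc = A)
    (hL : 2 ^ b.toNat * A < 2 ^ L) :
    ∃ s : St, s.qry = encodeNats [2 ^ b.toNat * A] ∧ Does O output v.toSt s (16 * L + 20) := by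
  have h1 : Does O (popBit .parity fun b => if b then pushBit .acc false else skip) v.toSt
      (Vars.toSt { v with parity := 0, acc := 2 ^ b.toNat * A }) 4 := by
    refine does_popBit (x := 0) (b := b) (by simpa [Vars.toSt] using hb) ?_
    cases b
    · refine ((does_skip _).of_eq (Vars.set_eq fun r => ?_)).mono (by omega)
      cases r <;> simp [Vars.toSt, hA]
    · refine (does_pushBit _ .acc false).of_eq (St.ext_reg (fun r => ?_) rfl rfl)
      cases r <;> simp [Vars.toSt, hA]
  have h2 := does_emit (O := O) (x := .acc) (L := L)
    (s := Vars.toSt { v with parity := 0, acc := 2 ^ b.toNat * A }) (by decide) rfl hL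
  refine ⟨_, ?_, (h1.seq h2).mono (by omega)⟩
  simp [Vars.toSt, encodeNats]

/-- The reduction of squarefree decomposition to modular tetration. -/
def squarefreeProg : Prog :=
  receive .inp ;; stripTwos ;; setModulus ;; setBounds ;; gcdLoop ;; divBy .gcd₁ .gcd₀ ;; peel ;;
    output

/-- The bound `L` dominates the bit lengths of all numbers that occur: about `n * (2 * n + 3)` for
twice the modulus and at most `8 * n + 1` for the number of bases. -/
theorem runs_squarefreeProg (hO : MTP.SolvedBy O) {N n L : ℕ} (hN : 0 < N) (hn : N.size ≤ n)
    (hL : 2 * n ^ 2 + 11 * n + 10 ≤ L) :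
    ∃ S' t, Runs O squarefreeProg (Function.update (fun _ => []) Stk.ans (encodeNats [N])) S' t ∧
      S' Stk.qry = encodeNats [squarefreePart N] ∧
      t ≤ 256 * n ^ 8 * (1000 * (L + 2) ^ 2 + 1) + 2500 * (L + 2) ^ 3 := by
  have hstart : Function.update (fun _ => []) Stk.ans (encodeNats [N]) =
      ((Vars.toSt {}).setAns (encodeNats [N])).content := by
    funext k
    rcases k with r | _ | _
    · cases r <;> simp [St.content, Vars.toSt, St.setAns]
    · simp [St.content, Vars.toSt, St.setAns]
    · simp [St.content, St.setAns]
  have hnL : n ≤ L := by nlinarith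
  have hNL : N < 2 ^ n := Nat.size_le.1 hn
  have hNL' : 2 * N < 2 ^ L := by
    have : 2 ^ (n + 1) ≤ 2 ^ L := Nat.pow_le_pow_right (by norm_num) (by nlinarith)
    rw [pow_succ] at this
    omega
  obtain ⟨M, j, hodd, hNM, h2⟩ := does_stripTwos (O := O) hN
  have hMN : M ≤ N := by rw [hNM]; exact Nat.le_mul_of_pos_right _ (by positivity)
  obtain ⟨m, hm⟩ : ∃ x, x = M.size := ⟨_, rfl⟩
  have hmn : m ≤ n := hm ▸ (Nat.size_le_size hMN).trans hn
  have hm1 : 1 ≤ m := hm ▸ Nat.size_pos.2 hodd.pos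
  have hmm : m * (2 * m + 3) ≤ n * (2 * n + 3) := Nat.mul_le_mul hmn (by omega)
  have hmL : m * (2 * m + 3) + 2 ≤ L := by nlinarith
  have hms : m.size ≤ m := Nat.size_le.2 Nat.lt_two_pow_self
  -- The input lies on the answer stack, so it is read exactly like an oracle answer.
  have h1 : Does O (receive .inp) ((Vars.toSt {}).setAns (encodeNats [N]))
      (Vars.toSt { inp := N }) (16 * L + 20) :=
    (does_receive (y := N) (by decide) rfl rfl (by simp [encodeNats]) (by omega)).of_eq
      (St.ext_reg (fun r => by cases r <;> rfl) rfl rfl)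
  have h3 := does_setModulus (O := O) (N := M) (e := j % 2) (L := L) (by rw [← hm]; omega)
  rw [← hm] at h3
  obtain ⟨Q, hQ⟩ : ∃ x, x = M ^ (2 * m + 3) := ⟨_, rfl⟩
  have hMm : M < 2 ^ m := hm ▸ Nat.lt_size_self M
  have hQL : 2 * Q < 2 ^ L := by
    have : Q ≤ 2 ^ (m * (2 * m + 3)) := by
      rw [hQ, pow_mul]; exact Nat.pow_le_pow_left hMm.le _
    have h' : 2 ^ (m * (2 * m + 3) + 2) ≤ 2 ^ L := Nat.pow_le_pow_right (by norm_num) hmL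
    rw [pow_add] at h'
    have : 0 < 2 ^ (m * (2 * m + 3)) := by positivity
    omega
  have hQodd : Odd Q := hQ ▸ hodd.pow
  rw [← hQ] at h3
  have hlen : 2 * m + 3 < 2 ^ L :=
    lt_of_le_of_lt (by nlinarith) (Nat.lt_two_pow_self (n := L))
  have h4 := does_setBounds (O := O) (N := M) (e := j % 2) (n := m) (m := Q) (L := L) hlen
    (by omega) (by nlinarith)
  obtain ⟨B, hB⟩ : ∃ x, x = 2 ^ (8 * m.size) := ⟨_, rfl⟩
  have hBL : B + 1 < 2 ^ L := by
    have h' : 2 ^ (8 * m.size + 1) < 2 ^ L := Nat.pow_lt_pow_right (by norm_num) (by nlinarith)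
    rw [pow_succ, ← hB] at h'
    have : 0 < B := hB ▸ by positivity
    omega
  rw [← hB] at h4
  have h5 := does_gcdLoop hO (N := M) (e := j % 2) (n := m) (k := 2 * m + 1) hQodd.pos hQL hlen
    (by omega) hBL
  obtain ⟨R, hR, hrad⟩ := gapGcd_dvd_and_isRadical (s := m.size) (b := B + 1) hodd hMm
    (Nat.lt_size_self m) (by omega)
  rw [← hQ] at hR
  set G := gapGcd Q (B + 1) (2 * m + 1) with hG
  have hGQ : G ∣ Q := gapGcd_dvd _ _ _
  have hGodd : Odd G := odd_of_dvd hQodd hGQ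
  have hGR : G * R ≤ Q := hR ▸ Nat.le_of_dvd hQodd.pos (gapGcd_dvd _ _ _)
  set u : Vars :=
    { inp := M, parity := j % 2, len := m, modulus := Q
      height₀ := 2 * m + 1, height₁ := 2 * m + 2, height₂ := 2 * m + 3
      base := B + 1, gcd₀ := G } with hu
  have h6 : Does O (divBy .gcd₁ .gcd₀) (Vars.toSt { u with gcd₁ := G * R })
      (Vars.toSt { u with gcd₁ := R }) (100 * (L + 2) ^ 2) := by
    refine (does_divBy (x := .gcd₁) (y := .gcd₀) (L := L)
      (s := Vars.toSt { u with gcd₁ := G * R }) rfl rfl (by decide) (Vars.clean _)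
      (show G * R < _ by omega) hGodd (dvd_mul_right G R)).of_eq (Vars.set_eq fun r => ?_)
    cases r <;> first | rfl | exact Nat.mul_div_cancel_left R hGodd.pos
  obtain ⟨R', A, hinv, h7⟩ := does_peel hO (v := { u with gcd₁ := R }) (L := L) hodd hrad
    (by omega) rfl rfl rfl rfl rfl
  obtain ⟨i, b, hb⟩ := exists_two_mul_add j
  have hjb : j % 2 = b.toNat := by have := Bool.toNat_le b; omega
  have hval := hinv.squarefreePart_eq (j := j)
  rw [← hNM, hjb] at hval
  have hAM : A ≤ M := Nat.le_of_dvd hodd.pos ((Dvd.intro _ rfl).trans hinv.dvd_left)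
  have hAL : 2 ^ b.toNat * A < 2 ^ L := by
    have : 2 ^ b.toNat ≤ 2 := by cases b <;> simp
    have := Nat.mul_le_mul this hAM
    omega
  obtain ⟨s, hs, h8⟩ := does_output (O := O) (L := L)
    (v := { u with inp := 1, gcd₁ := R', acc := A }) hjb rfl hAL
  rw [show 2 * m + 1 + 1 = 2 * m + 2 from rfl, hR] at h5
  obtain ⟨t, ht, hrun⟩ := h1.seq (h2.seq (h3.seq (h4.seq (h5.seq (h6.seq (h7.seq h8))))))
  refine ⟨_, t, hstart ▸ hrun, by rw [hval, ← hs]; rfl, ht.trans ?_⟩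
  -- The number of bases is `(2 ^ m.size) ^ 8`, and `2 ^ m.size ≤ 2 * m`.
  have hBn : B ≤ 256 * n ^ 8 := by
    have h' : 2 ^ m.size ≤ 2 * m := by
      obtain ⟨q, c, hq⟩ := exists_two_mul_add m
      have h0 : m.size ≠ 0 := (Nat.size_pos.2 hm1).ne'
      obtain ⟨z, hz⟩ := Nat.exists_eq_succ_of_ne_zero h0
      have : 2 ^ z ≤ m := Nat.lt_size.1 (by omega)
      rw [hz, pow_succ]
      omega
    calc B = (2 ^ m.size) ^ 8 := by rw [hB, ← pow_mul, mul_comm]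
      _ ≤ (2 * n) ^ 8 := Nat.pow_le_pow_left (by omega) 8
      _ = 256 * n ^ 8 := by ring
  have h9 := Nat.mul_le_mul_right (1000 * (L + 2) ^ 2 + 1) hBn
  generalize B * (1000 * (L + 2) ^ 2 + 1) = X at h9
  generalize 256 * n ^ 8 * (1000 * (L + 2) ^ 2 + 1) = Y at h9 ⊢
  have e1 : (L + 2) ^ 3 = L ^ 3 + 6 * L ^ 2 + 12 * L + 8 := by ring
  have e2 : (L + 2) ^ 2 = L ^ 2 + 4 * L + 4 := by ring
  rw [e1, e2]
  omega

end Prog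

theorem mainTheorem1 : PolyTimeReducible SDP MTP := by
  refine ⟨Prog.squarefreeProg.machine,
    256 * .X ^ 8 * (1000 * (2 * .X ^ 2 + 11 * .X + 10 + 2) ^ 2 + 1) +
      2500 * (2 * .X ^ 2 + 11 * .X + 10 + 2) ^ 3, fun O hO (N : ℕ+) => ?_⟩
  obtain ⟨S', t, hrun, hout, ht⟩ := Prog.runs_squarefreeProg hO (N := (N : ℕ))
    (n := (encodeNats [(N : ℕ)]).length) N.pos (by simp [encodeNats, Nat.size_eq_bits_len]) le_rfl
  have := Prog.outputsWithin_machine hrun ht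
  rw [hout] at this
  simpa [SDP] using this
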